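/- **Setting.** A database $D$ is a finite multiset of tuples of a relational schema with finite attribute domains; $D,D'$ are neighbours if one arises from the other by adding one tuple. There are analysts $A_1,\dots,A_m$ and histogram views $V_1,\dots,V_n$; $V_j(D)$ lists, for each possible value of a chosen finite set of attributes of one relation, the number of tuples with that value. A randomized algorithm $\mathcal M$ is $(\epsilon,\delta)$-DP if $\Pr[\mathcal M(D)\in O]\le e^{\epsilon}\Pr[\mathcal M(D')\in O]+\delta$ for all neighbours $D,D'$ and all measurable $O$; it is $[(A_1,\epsilon_1,\delta_1),\dots,(A_m,\epsilon_m,\delta_m)]$-multi-analyst DP if, for each $i$, the part of its output released to $A_i$ is $(\epsilon_i,\delta_i)$-DP. Fix $\delta_0\in(0,1)$ and let $\sigma(\epsilon)$ be the noise level of the analytic Gaussian mechanism, the least $\sigma>0$ with $\Phi(\frac1{2\sigma}-\epsilon\sigma)-e^{\epsilon}\Phi(-\frac1{2\sigma}-\epsilon\sigma)\le\delta_0$. The provenance table has constraints $(\psi_{A_i},\delta_{A_i})$, $(\psi_{V_j},\delta_{V_j})$, $(\psi_P,\delta_P)$, all numbers $\ge 0$, for analysts, views and the table, and a matrix $P[A_i,V_j]$,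 initially $0$. In each round a request $(A_i,V_j,\epsilon)$ arrives ($\epsilon$ is demanded by the analyst or translated from an accuracy requirement, without access to the data). It is rejected unless $\epsilon>0$ and the constraint check passes; otherwise a synopsis of $V_j$ is released to $A_i$. *Vanilla mechanism.* The check demands that the sum of all entries of $P$, of row $i$ and of column $j$, each plus $\epsilon$, is at most $\psi_P$, $\psi_{A_i}$ and $\psi_{V_j}$, and that $\delta_0$ times the number of released synopses (including the new one) in the table, row $i$ and column $j$ is at most $\delta_P,\delta_{A_i},\delta_{V_j}$. It releases $V_j(D)+\mathcal N(0,\sigma(\epsilon)^2I)$ with fresh noise and adds $\epsilon$ to $P[A_i,V_j]$. *Additive Gaussian mechanism.* For each view it keeps a hidden global synopsis with a budget $\epsilon_j$ (initially $0$, no synopsis), a noise variance $v_j$ and the number $k_j$ of intermediate synopses combined in it. If $\epsilon>\epsilon_j$, a fresh intermediate synopsis with noise variance $v_\Delta=\sigma(\epsilon-\epsilon_j)^2$ is generated and combined with the global one with weights $w=\frac{v_j}{v_\Delta+v_j}$ and $1-w$ (the first one is taken as it is), and $\epsilon_j\leftarrow\epsilon$, $k_j\leftarrow k_j+1$, $v_j\leftarrow(1-w)^2v_j+w^2v_\Delta$.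 It releases the global synopsis plus fresh noise of variance $\sigma(\epsilon)^2-\min(v_j,\sigma(\epsilon_j)^2)$ per bin, and sets $P[A_i,V_j]\leftarrow\min(\epsilon_j,P[A_i,V_j]+\epsilon)$, with the updated $\epsilon_j$. The number $N[A_i,V_j]$ of $\delta_0$-charges, initially $0$, becomes $k_j$ if $\epsilon_j$ attains this minimum and increases by $1$ otherwise. With $\epsilon'$ the resulting increase of $P[A_i,V_j]$, the check (made before any of this is carried out) demands, with $P$ the matrix before the update, $\max_a P[A_a,V_j]+\epsilon'\le\psi_{V_j}$, $\sum_l\max_a P[A_a,V_l]+\epsilon'\le\psi_P$, $\sum_l P[A_i,V_l]+\epsilon'\le\psi_{A_i}$, and, for the updated counts, $k_j\delta_0\le\delta_{V_j}$, $\sum_l k_l\delta_0\le\delta_P$, $\sum_l N[A_i,V_l]\delta_0\le\delta_{A_i}$. **Theorem (System Privacy Guarantee).** For both mechanisms and every number $T$ of rounds: 1. For every fixed sequence of requests, the system is $[(A_1,\psi_{A_1},\delta_{A_1}),\dots,(A_m,\psi_{A_m},\delta_{A_m})]$-multi-analyst DP. More generally, for each $i$, everything released to $A_i$ is $(\psi_{A_i},\delta_{A_i})$-DP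 if the requests are chosen adaptively, as a measurable function of what has been released to $A_i$ before. 2. For each $j$, everything released from view $V_j$ (to all analysts together) is $(\min(\psi_{V_j},\psi_P),\min(\delta_{V_j},\delta_P))$-DP if the requests are chosen adaptively, as a measurable function of what has been released from $V_j$ before (in particular, for every fixed sequence of requests). 3. If all the analysts collude, that is, if the requests are chosen adaptively as a measurable function of all earlier responses and all responses are observed, the system is $(\psi_P,\delta_P)$-DP. -/

import Mathlib

open MeasureTheory ProbabilityTheory
open scoped NNReal ENNReal

noncomputable section

namespace DProv

/-! ### Databases and histogram views -/

/-- A relational schema: relations, the attributes of each relation, and the finite domain of each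
attribute. -/
structure Schema where
  Rel : Type
  Attr : Rel → Type
  Dom : (r : Rel) → Attr r → Type
  [domFintype : ∀ r a, Fintype (Dom r a)]

attribute [instance] Schema.domFintype

/-- A tuple of one of the relations of the schema. -/
abbrev Tuple (𝒮 : Schema) : Type := Σ r : 𝒮.Rel, (a : 𝒮.Attr r) → 𝒮.Dom r a

/-- A database instance: a finite multiset of tuples. -/
abbrev Database (𝒮 : Schema) : Type := Multiset (Tuple 𝒮)

/-- Two databases are neighbours if one arises from the other by adding one tuple. -/
def Neighbour {𝒮 : Schema} (D D' : Database 𝒮) : Prop :=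
  ∃ t : Tuple 𝒮, D' = t ::ₘ D ∨ D = t ::ₘ D'

/-- A (full-domain) histogram view: a finite set of attributes of one relation. -/
structure HistView (𝒮 : Schema) where
  rel : 𝒮.Rel
  attrs : Finset (𝒮.Attr rel)

/-- The bins of a histogram view: all possible values of its attributes. -/
abbrev HistView.Bin {𝒮 : Schema} (V : HistView 𝒮) : Type :=
  (a : V.attrs) → 𝒮.Dom V.rel a

instance {𝒮 : Schema} (V : HistView 𝒮) : Fintype V.Bin := by
  classical exact inferInstance

open Classical in
/-- The exact answer `V(D)`: for every bin, the number of tuples of the database in that bin. -/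
def HistView.eval {𝒮 : Schema} (V : HistView 𝒮) (D : Database 𝒮) : V.Bin → ℝ := fun b =>
  (D.countP fun x => ∃ t : (a : 𝒮.Attr V.rel) → 𝒮.Dom V.rel a,
    x = ⟨V.rel, t⟩ ∧ ∀ a : V.attrs, t a = b a : ℕ)

/-! ### Differential privacy -/

/-- `(ε, δ)`-differential privacy of the randomized algorithm `M`, where `M D ω` is the output on
the database `D` when the random coins are `ω`, drawn from `μ`. -/
def IsDP {𝒮 : Schema} {Ω O : Type*} [MeasurableSpace Ω] [MeasurableSpace O] (μ : Measure Ω)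
    (M : Database 𝒮 → Ω → O) (ε δ : ℝ) : Prop :=
  ∀ D D' : Database 𝒮, Neighbour D D' → ∀ s : Set O, MeasurableSet s →
    μ {ω | M D ω ∈ s} ≤
      ENNReal.ofReal (Real.exp ε) * μ {ω | M D' ω ∈ s} + ENNReal.ofReal δ

/-- `[(A₁, ε₁, δ₁), …, (Aₘ, εₘ, δₘ)]`-multi-analyst DP: `M D ω i` is what analyst `i` receives. -/
def IsMultiAnalystDP {𝒮 : Schema} {Ω : Type*} [MeasurableSpace Ω] {m : ℕ} {O : Fin m → Type*}
    [∀ i, MeasurableSpace (O i)] (μ : Measure Ω) (M : Database 𝒮 → Ω → (i : Fin m) → O i)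
    (ε δ : Fin m → ℝ) : Prop :=
  ∀ i, IsDP μ (fun D ω => M D ω i) (ε i) (δ i)

/-- The cumulative distribution function `Φ` of the standard normal distribution. -/
def stdNormalCdf (x : ℝ) : ℝ := cdf (gaussianReal 0 1) x

/-- Noise level of the analytic Gaussian mechanism for budget `(ε, δ)` and `ℓ₂`-sensitivity `Δ`: the
least `σ > 0` that satisfies the analytic Gaussian condition. -/
def analyticGM (ε δ Δ : ℝ) : ℝ :=
  sInf {σ : ℝ | 0 < σ ∧
    stdNormalCdf (Δ / (2 * σ) - ε * σ / Δ)
      - Real.exp ε * stdNormalCdf (-(Δ / (2 * σ)) - ε * σ / Δ) ≤ δ}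

/-! ### The system -/

section System

variable {𝒮 : Schema} {m n : ℕ}

/-- The constraints of the provenance table: an allowed `(ε, δ)` loss for each analyst (row), each
view (column), and the whole table. -/
structure Constraints (m n : ℕ) where
  ψA : Fin m → ℝ≥0
  ψV : Fin n → ℝ≥0
  ψP : ℝ≥0
  δA : Fin m → ℝ≥0
  δV : Fin n → ℝ≥0
  δP : ℝ≥0

/-- A request handed to the mechanism: the analyst, the view that answers the query, and the
privacy budget `ε` demanded for the synopsis. In the accuracy-oriented mode `ε` is the translation
of the accuracy requirement, which uses the request and earlier requests, but not the data. -/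
abbrev Request (m n : ℕ) : Type := Fin m × Fin n × ℝ

/-- A synopsis of view `j`: a real number for every bin. -/
abbrev Synopsis (𝒱 : Fin n → HistView 𝒮) (j : Fin n) : Type := (𝒱 j).Bin → ℝ

/-- Response to a request: either a rejection, or the synopsis of view `j` released to analyst `i`
(tagged with `(i, j)`). Query answers are functions of the released synopsis. -/
abbrev Response (m : ℕ) (𝒱 : Fin n → HistView 𝒮) : Type :=
  Unit ⊕ (Σ p : Fin m × Fin n, Synopsis 𝒱 p.2)

/-- A rejection. -/
abbrev Response.reject {𝒱 : Fin n → HistView 𝒮} : Response m 𝒱 := Sum.inl ()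

/-- The release of synopsis `y` of view `j` to analyst `i`. -/
abbrev Response.release {𝒱 : Fin n → HistView 𝒮} (i : Fin m) (j : Fin n) (y : Synopsis 𝒱 j) :
    Response m 𝒱 := Sum.inr ⟨(i, j), y⟩

/-- Two families of standard normal variables, the fresh randomness available in one round. -/
abbrev Draw (𝒱 : Fin n → HistView 𝒮) : Type :=
  ((j : Fin n) → Synopsis 𝒱 j) × ((j : Fin n) → Synopsis 𝒱 j)

/-- The law of the randomness of one round: all coordinates independent and standard normal. -/
def drawLaw (𝒱 : Fin n → HistView 𝒮) : Measure (Draw 𝒱) :=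
  (Measure.pi fun _ => Measure.pi fun _ => gaussianReal 0 1).prod
    (Measure.pi fun _ => Measure.pi fun _ => gaussianReal 0 1)

/-- The law of the randomness of `T` independent rounds. -/
def noiseLaw (𝒱 : Fin n → HistView 𝒮) (T : ℕ) : Measure (Fin T → Draw 𝒱) :=
  Measure.pi fun _ => drawLaw 𝒱

/-- A mechanism that can be plugged into the system: its internal state, the constraint check, and
the function that produces the released synopsis and the new state. -/
structure Mechanism (m : ℕ) (𝒱 : Fin n → HistView 𝒮) where
  State : Type
  init : State
  constraintCheck : State → Request m n → Prop
  run : Database 𝒮 → Draw 𝒱 → State → (q : Request m n) → State × Synopsis 𝒱 q.2.1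

/-- A policy describes how requests arise: the request of round `t` as a function of the responses of
the earlier rounds. It stands for the analysts' choices, the choice of the view, and the
translation of accuracy requirements into budgets; none of these accesses the data. -/
abbrev Policy (m : ℕ) (𝒱 : Fin n → HistView 𝒮) : Type :=
  (t : ℕ) → (Fin t → Response m 𝒱) → Request m n

open Classical in
/-- `T` rounds of the system: receive a request, check the constraints, then run the mechanism and
release its synopsis, or reject. Returns the internal state and all the responses. -/
def exec {𝒱 : Fin n → HistView 𝒮} (M : Mechanism m 𝒱) (π : Policy m 𝒱) (D : Database 𝒮) :
    (T : ℕ) → (Fin T → Draw 𝒱) → M.State × (Fin T → Response m 𝒱)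
  | 0, _ => (M.init, Fin.elim0)
  | T + 1, ω =>
    let past := exec M π D T fun t => ω t.castSucc
    let q := π T past.2
    if M.constraintCheck past.1 q then
      let res := M.run D (ω (Fin.last T)) past.1 q
      (res.1, Fin.snoc (α := fun _ => Response m 𝒱) past.2 (Response.release q.1 q.2.1 res.2))
    else (past.1, Fin.snoc (α := fun _ => Response m 𝒱) past.2 Response.reject)

/-- All the responses of the system in `T` rounds. -/
def transcript {𝒱 : Fin n → HistView 𝒮} (M : Mechanism m 𝒱) (π : Policy m 𝒱) (T : ℕ)
    (D : Database 𝒮) (ω : Fin T → Draw 𝒱) : Fin T → Response m 𝒱 :=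
  (exec M π D T ω).2

open Classical in
/-- What an observer sees who gets only the synopses of view `j` released to analyst `i` with
`(i, j) ∈ S`. -/
def observe {𝒱 : Fin n → HistView 𝒮} (S : Set (Fin m × Fin n)) {T : ℕ}
    (h : Fin T → Response m 𝒱) : Fin T → Response m 𝒱 := fun t =>
  match h t with
  | Sum.inl _ => Response.reject
  | Sum.inr r => if r.1 ∈ S then Sum.inr r else Response.reject

/-- What is released to analyst `i`. -/
def toAnalyst {𝒱 : Fin n → HistView 𝒮} {T : ℕ} (h : Fin T → Response m 𝒱) (i : Fin m) :
    Fin T → Response m 𝒱 := observe {p | p.1 = i} h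

/-- What is released, to any analyst, from view `j`. -/
def fromView {𝒱 : Fin n → HistView 𝒮} {T : ℕ} (h : Fin T → Response m 𝒱) (j : Fin n) :
    Fin T → Response m 𝒱 := observe {p | p.2 = j} h

/-- The requests depend on the earlier responses only through `f` (what some observer sees). -/
def Policy.DependsOnlyOn {𝒱 : Fin n → HistView 𝒮} (π : Policy m 𝒱)
    (f : {t : ℕ} → (Fin t → Response m 𝒱) → Fin t → Response m 𝒱) : Prop :=
  ∀ (t : ℕ) (h h' : Fin t → Response m 𝒱), f h = f h' → π t h = π t h'

/-- The policy that submits a fixed sequence of requests. -/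
def Policy.fixed {𝒱 : Fin n → HistView 𝒮} (q : ℕ → Request m n) : Policy m 𝒱 := fun t _ => q t

/-! ### The vanilla approach -/

/-- The provenance matrix of the vanilla approach: cumulative `ε`-loss `P i j` and number `N i j` of
synopses of view `j` released to analyst `i` (each costs the system's `δ₀`). -/
structure VanillaState (m n : ℕ) where
  P : Fin m → Fin n → ℝ
  N : Fin m → Fin n → ℕ

/-- Every request gets a fresh synopsis from the analytic Gaussian mechanism; losses are composed by
sequential composition over the whole table, the row, and the column. -/
def vanilla (𝒱 : Fin n → HistView 𝒮) (Ψ : Constraints m n) (δ₀ : ℝ) : Mechanism m 𝒱 where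
  State := VanillaState m n
  init := ⟨fun _ _ => 0, fun _ _ => 0⟩
  constraintCheck := fun s (i, j, ε) =>
    0 < ε ∧
    (∑ a, ∑ v, s.P a v) + ε ≤ Ψ.ψP ∧ (∑ v, s.P i v) + ε ≤ Ψ.ψA i ∧ (∑ a, s.P a j) + ε ≤ Ψ.ψV j ∧
    ((∑ a, ∑ v, s.N a v : ℕ) + 1) * δ₀ ≤ Ψ.δP ∧ ((∑ v, s.N i v : ℕ) + 1) * δ₀ ≤ Ψ.δA i ∧
    ((∑ a, s.N a j : ℕ) + 1) * δ₀ ≤ Ψ.δV j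
  run := fun D z s (i, j, ε) =>
    (⟨Function.update s.P i (Function.update (s.P i) j (s.P i j + ε)),
      Function.update s.N i (Function.update (s.N i) j (s.N i j + 1))⟩,
     (𝒱 j).eval D + analyticGM ε δ₀ 1 • z.1 j)

/-! ### The additive Gaussian approach -/

/-- State of the additive Gaussian approach. For every view: the budget `ε` of its global synopsis,
the number `k` of intermediate synopses combined in it (`0` if there is none yet), its noise
variance `v`, and the global synopsis `G` itself, which is hidden from the analysts. The provenance
matrix has the cumulative `ε`-loss `P` and the number `N` of charges of `δ₀`. -/
structure AdditiveState (m : ℕ) (𝒱 : Fin n → HistView 𝒮) where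
  P : Fin m → Fin n → ℝ
  N : Fin m → Fin n → ℕ
  ε : Fin n → ℝ
  k : Fin n → ℕ
  v : Fin n → ℝ
  G : (j : Fin n) → Synopsis 𝒱 j

namespace AdditiveState

variable {𝒱 : Fin n → HistView 𝒮}

/-- Budget of the global synopsis of view `j` once a request with budget `ε` is served. -/
def newBudget (s : AdditiveState m 𝒱) (j : Fin n) (ε : ℝ) : ℝ := max (s.ε j) ε

/-- Number of intermediate synopses of view `j` once a request with budget `ε` is served. -/
def newCount (s : AdditiveState m 𝒱) (j : Fin n) (ε : ℝ) : ℕ :=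
  if s.ε j < ε then s.k j + 1 else s.k j

/-- The new entry `min (ε_global, P[i, j] + ε)` of the provenance matrix. -/
def newP (s : AdditiveState m 𝒱) (i : Fin m) (j : Fin n) (ε : ℝ) : ℝ :=
  min (s.newBudget j ε) (s.P i j + ε)

/-- The number of `δ₀`-charges that belongs to `newP`: those of the global synopsis if its budget
attains the minimum, and one more than before otherwise. -/
def newN (s : AdditiveState m 𝒱) (i : Fin m) (j : Fin n) (ε : ℝ) : ℕ :=
  if s.newBudget j ε ≤ s.P i j + ε then s.newCount j ε else s.N i j + 1

/-- Weight of the fresh intermediate synopsis in the combination, inversely proportional to the noise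
variances; a first synopsis is taken as it is. -/
def weight (s : AdditiveState m 𝒱) (δ₀ : ℝ) (j : Fin n) (ε : ℝ) : ℝ :=
  if s.k j = 0 then 1 else s.v j / (analyticGM (ε - s.ε j) δ₀ 1 ^ 2 + s.v j)

/-- Noise variance of the global synopsis of view `j` once a request with budget `ε` is served. -/
def newVar (s : AdditiveState m 𝒱) (δ₀ : ℝ) (j : Fin n) (ε : ℝ) : ℝ :=
  if s.ε j < ε then
    (1 - s.weight δ₀ j ε) ^ 2 * s.v j + s.weight δ₀ j ε ^ 2 * analyticGM (ε - s.ε j) δ₀ 1 ^ 2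
  else s.v j

/-- The global synopsis of view `j` once a request with budget `ε` is served: if the budget is too
small, a fresh intermediate synopsis for the missing budget is combined with it. -/
def newGlobal (s : AdditiveState m 𝒱) (δ₀ : ℝ) (D : Database 𝒮) (j : Fin n) (ε : ℝ)
    (ξ : Synopsis 𝒱 j) : Synopsis 𝒱 j :=
  if s.ε j < ε then
    (1 - s.weight δ₀ j ε) • s.G j +
      s.weight δ₀ j ε • ((𝒱 j).eval D + analyticGM (ε - s.ε j) δ₀ 1 • ξ)
  else s.G j

/-- Variance of the noise added to the global synopsis to get the local one: `σ'² - σ²` with `σ'`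
and `σ` the noise levels for the budgets `ε` of the request and of the global synopsis. (Where
the tracked variance of a combined global synopsis is below `σ²`, it replaces `σ²`, so that the
local synopsis never has less noise than `σ'²`.) -/
def localVar (s : AdditiveState m 𝒱) (δ₀ : ℝ) (j : Fin n) (ε : ℝ) : ℝ :=
  analyticGM ε δ₀ 1 ^ 2 - min (s.newVar δ₀ j ε) (analyticGM (s.newBudget j ε) δ₀ 1 ^ 2)

end AdditiveState

/-- Local synopses are noisier versions of a hidden global synopsis per view. In the constraint
check, `ε' = newP - P[i, j]` is the new cost; the loss of a view is the maximum of its column, the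
loss of the table the sum of these maxima, the loss of an analyst the sum of the row. -/
def additiveGaussian (𝒱 : Fin n → HistView 𝒮) (Ψ : Constraints m n) (δ₀ : ℝ) :
    Mechanism m 𝒱 where
  State := AdditiveState m 𝒱
  init := ⟨fun _ _ => 0, fun _ _ => 0, fun _ => 0, fun _ => 0, fun _ => 0, fun _ => 0⟩
  constraintCheck := fun s (i, j, ε) =>
    0 < ε ∧
    (⨆ a, s.P a j) + (s.newP i j ε - s.P i j) ≤ Ψ.ψV j ∧
    (∑ v, ⨆ a, s.P a v) + (s.newP i j ε - s.P i j) ≤ Ψ.ψP ∧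
    (∑ v, s.P i v) + (s.newP i j ε - s.P i j) ≤ Ψ.ψA i ∧
    s.newCount j ε * δ₀ ≤ Ψ.δV j ∧
    (∑ v, Function.update s.k j (s.newCount j ε) v : ℕ) * δ₀ ≤ Ψ.δP ∧
    (∑ v, Function.update (s.N i) j (s.newN i j ε) v : ℕ) * δ₀ ≤ Ψ.δA i
  run := fun D z s (i, j, ε) =>
    (⟨Function.update s.P i (Function.update (s.P i) j (s.newP i j ε)),
      Function.update s.N i (Function.update (s.N i) j (s.newN i j ε)),
      Function.update s.ε j (s.newBudget j ε),
      Function.update s.k j (s.newCount j ε),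
      Function.update s.v j (s.newVar δ₀ j ε),
      Function.update s.G j (s.newGlobal δ₀ D j ε (z.1 j))⟩,
     s.newGlobal δ₀ D j ε (z.1 j) + √(s.localVar δ₀ j ε) • z.2 j)

end System

end DProv

end

namespace DProv

/-! ### The hockey-stick divergence of the Gaussian mechanism -/

/-! For Gaussian noise, privacy is governed by one number, the information `R`. If exact answers
differ by one in a single bin and the noise has variance `1 / R`, the log-likelihood ratio of the
outputs is `w - R / 2` with `w ∼ N(0, R)`, and the least `δ` that goes with `ε` is `hockeyStick R
(exp ε)`. This quantity increases with `R` and obeys sequential composition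
(`hockeyStick_add_mul_le`); `analyticGM ε δ₀ 1` is `1 / √R` for the largest `R` that is `(ε,
δ₀)`-private.

Adaptivity is harmless because information, not the pair `(ε, δ)`, is composed. By the semigroup
identity `lintegral_hockeyStick`, spending a part `r` of the information merely turns the level `c`
into `c * exp (w - r / 2)`. Induction on the rounds then shows that an observer whose information
never exceeds a fixed `Rm`, on any path, sees something as private as one Gaussian mechanism with
information `Rm` (`IsBeliefSystem.lintegral_outProb_le`). The constraint check ensures that the
information after each accepted visible request is `(ψ, δ)`-private, and
`exists_maximal_information` turns this into the path-independent bound `R ≤ Rm`.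

In the vanilla approach the information is bounded by the sum of `1 / σ(ε)²` over the observed
synopses, and the entries of the table certify its privacy by composition. In the additive approach
the responses are correlated through the hidden global synopses, so the observer's knowledge is
followed as in a Kalman filter: given the responses seen, the global synopsis of view `j` is
Gaussian, with mean affine in `V_j(D)` of slope `β` and with variance `β * v`, where `β = 1 - v *
I`. The information `1 / v` of the global synopsis thus splits into the part `I` already revealed
and the rest `β / v`.

Two bounds on `I` follow. First, `I ≤ 1 / v`, which the intermediate budgets control because
precisions add in the combination. Secondly, each response adds at most `1 / σ(ε)²`. These are the
two arguments of the minimum that defines the new entry of `P`; the first alone yields the view and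
table guarantees, both together the analyst guarantee. -/

/-- The hockey-stick divergence at level `c` between `N(0, R)` and `N(R, R)`, that is, between the
outputs of a Gaussian mechanism with information `R` (sensitivity one, noise variance `1 / R`). -/
noncomputable def hockeyStick (R : ℝ≥0) (c : ℝ) : ℝ≥0∞ :=
  ∫⁻ w, ENNReal.ofReal (1 - c * Real.exp (w - R / 2)) ∂gaussianReal 0 R

lemma measurable_hockeyStick (R : ℝ≥0) : Measurable (hockeyStick R) := by
  unfold hockeyStick
  refine Measurable.lintegral_prod_right' (f := fun p : ℝ × ℝ =>
    ENNReal.ofReal (1 - p.1 * Real.exp (p.2 - R / 2))) ?_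
  fun_prop

/-- Centred Gaussians convolve by adding variances, and log-likelihood ratios add. This exact
semigroup identity is what makes adaptive composition lossless. -/
lemma lintegral_hockeyStick (r R : ℝ≥0) (c : ℝ) :
    ∫⁻ w, hockeyStick R (c * Real.exp (w - r / 2)) ∂gaussianReal 0 r = hockeyStick (r + R) c := by
  have h : gaussianReal 0 (r + R) = gaussianReal 0 r ∗ gaussianReal 0 R := by
    rw [gaussianReal_conv_gaussianReal, add_zero]
  unfold hockeyStick
  rw [h, Measure.lintegral_conv (by fun_prop)]
  refine lintegral_congr fun x => lintegral_congr fun y => ?_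
  rw [mul_assoc, ← Real.exp_add]
  congr 4
  push_cast
  ring

lemma hockeyStick_anti (R : ℝ≥0) {c c' : ℝ} (h : c ≤ c') : hockeyStick R c' ≤ hockeyStick R c :=
  lintegral_mono fun w => ENNReal.ofReal_le_ofReal (by gcongr)

lemma integral_exp_gaussianReal (r : ℝ≥0) :
    ∫ w, Real.exp (w - r / 2) ∂gaussianReal 0 r = 1 := by
  have h := congrFun (mgf_fun_id_gaussianReal (μ := 0) (v := r)) 1
  simp only [mgf, one_mul, zero_add, one_pow, mul_one] at h
  simp_rw [Real.exp_sub]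
  rw [integral_div, h, div_self (Real.exp_ne_zero _)]

lemma integrable_exp_gaussianReal (r : ℝ≥0) :
    Integrable (fun w => Real.exp (w - r / 2)) (gaussianReal 0 r) := by
  simp_rw [Real.exp_sub]
  have := integrable_exp_mul_gaussianReal (μ := 0) (v := r) 1
  simp only [one_mul] at this
  exact this.div_const _

/-- Jensen's inequality for the positive part: the extra factor `exp (x - r / 2)` has mean one. -/
lemma hockeyStick_le_add (R r : ℝ≥0) (c : ℝ) : hockeyStick R c ≤ hockeyStick (R + r) c := by
  rw [← lintegral_hockeyStick]
  refine lintegral_mono fun w => ?_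
  simp only
  set b := c * Real.exp (w - R / 2)
  have h : (1 - b : ℝ) = ∫ x, (1 - b * Real.exp (x - r / 2)) ∂gaussianReal 0 r := by
    rw [integral_sub (integrable_const _) ((integrable_exp_gaussianReal r).const_mul _),
      integral_const_mul, integral_exp_gaussianReal]
    simp
  have hi : Integrable (fun x => 1 - b * Real.exp (x - r / 2)) (gaussianReal 0 r) :=
    (integrable_const _).sub ((integrable_exp_gaussianReal r).const_mul _)
  rw [h]
  calc ENNReal.ofReal (∫ x, (1 - b * Real.exp (x - r / 2)) ∂gaussianReal 0 r)
      ≤ ENNReal.ofReal (∫ x, max (1 - b * Real.exp (x - r / 2)) 0 ∂gaussianReal 0 r) :=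
        ENNReal.ofReal_le_ofReal (integral_mono hi hi.pos_part fun x => le_max_left _ _)
    _ = hockeyStick r b := by
        rw [ofReal_integral_eq_lintegral_ofReal hi.pos_part (.of_forall fun x => le_max_right _ _)]
        simp [hockeyStick]

lemma hockeyStick_mono {R R' : ℝ≥0} (h : R ≤ R') (c : ℝ) : hockeyStick R c ≤ hockeyStick R' c := by
  obtain ⟨r, rfl⟩ := exists_add_of_le h
  exact hockeyStick_le_add R r c

lemma hockeyStick_zero {c : ℝ} (hc : 1 ≤ c) : hockeyStick 0 c = 0 := by
  simp [hockeyStick, gaussianReal_zero_var, hc]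

/-- Sequential composition. -/
lemma hockeyStick_add_mul_le (R₁ R₂ : ℝ≥0) {c₁ c₂ : ℝ} (h₁ : 0 ≤ c₁) (h₂ : 0 ≤ c₂) :
    hockeyStick (R₁ + R₂) (c₁ * c₂) ≤ hockeyStick R₁ c₁ + hockeyStick R₂ c₂ := by
  rw [← lintegral_hockeyStick]
  calc ∫⁻ w, hockeyStick R₂ (c₁ * c₂ * Real.exp (w - R₁ / 2)) ∂gaussianReal 0 R₁
      ≤ ∫⁻ w, (ENNReal.ofReal (1 - c₁ * Real.exp (w - R₁ / 2)) + hockeyStick R₂ c₂)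
          ∂gaussianReal 0 R₁ := by
        refine lintegral_mono fun w => ?_
        simp only
        set a := c₁ * Real.exp (w - R₁ / 2) with ha
        have ha0 : 0 ≤ a := by positivity
        have hc : ENNReal.ofReal (1 - a) = ∫⁻ _, ENNReal.ofReal (1 - a) ∂gaussianReal 0 R₂ := by
          simp
        unfold hockeyStick
        rw [hc, ← lintegral_add_left measurable_const]
        refine lintegral_mono fun x => ?_
        simp only
        rw [show c₁ * c₂ * Real.exp (w - R₁ / 2) = a * c₂ by rw [ha]; ring, mul_assoc]
        set b := c₂ * Real.exp (x - R₂ / 2)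
        have hb0 : 0 ≤ b := by positivity
        -- Pointwise, `(1 - a * b)⁺ ≤ (1 - a)⁺ + (1 - b)⁺` for `a, b ≥ 0`; if both are at most one,
        -- this is `(1 - a) * (1 - b) ≥ 0`.
        rcases le_total 1 a with h | h
        · rw [ENNReal.ofReal_of_nonpos (by linarith : 1 - a ≤ 0), zero_add]
          exact ENNReal.ofReal_le_ofReal (by nlinarith)
        · rcases le_total 1 b with h' | h'
          · rw [ENNReal.ofReal_of_nonpos (by linarith : 1 - b ≤ 0), add_zero]
            exact ENNReal.ofReal_le_ofReal (by nlinarith)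
          · rw [← ENNReal.ofReal_add (by linarith) (by linarith)]
            exact ENNReal.ofReal_le_ofReal (by nlinarith)
    _ = _ := by
        rw [lintegral_add_right _ measurable_const]
        simp [hockeyStick]

lemma hockeyStick_add_exp_le {R₁ R₂ : ℝ≥0} {ε₁ ε₂ δ₁ δ₂ : ℝ} (hδ₁ : 0 ≤ δ₁) (hδ₂ : 0 ≤ δ₂)
    (h₁ : hockeyStick R₁ (Real.exp ε₁) ≤ ENNReal.ofReal δ₁)
    (h₂ : hockeyStick R₂ (Real.exp ε₂) ≤ ENNReal.ofReal δ₂) :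
    hockeyStick (R₁ + R₂) (Real.exp (ε₁ + ε₂)) ≤ ENNReal.ofReal (δ₁ + δ₂) := by
  rw [Real.exp_add, ENNReal.ofReal_add hδ₁ hδ₂]
  exact (hockeyStick_add_mul_le _ _ (by positivity) (by positivity)).trans (add_le_add h₁ h₂)

/-- Rescaling to a fixed standard normal law moves the dependence on the information into the
integrand, where dominated convergence applies. -/
lemma hockeyStick_eq_sq (u : ℝ) (c : ℝ) : hockeyStick (Real.toNNReal (u ^ 2)) c =
    ∫⁻ x, ENNReal.ofReal (1 - c * Real.exp (u * x - u ^ 2 / 2)) ∂gaussianReal 0 1 := by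
  have h := gaussianReal_map_const_mul (μ := 0) (v := 1) u
  have h' : gaussianReal 0 (Real.toNNReal (u ^ 2)) = (gaussianReal 0 1).map (u * ·) := by
    rw [h, mul_zero, mul_one]
    congr 1
    ext
    simp [sq_nonneg]
  unfold hockeyStick
  rw [h', lintegral_map (by fun_prop) (by fun_prop), Real.coe_toNNReal _ (sq_nonneg u)]

lemma continuous_hockeyStick_sq (c : ℝ) (hc : 0 ≤ c) :
    Continuous fun u : ℝ => hockeyStick (Real.toNNReal (u ^ 2)) c := by
  simp_rw [hockeyStick_eq_sq]
  rw [continuous_iff_continuousAt]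
  intro u
  refine tendsto_lintegral_filter_of_dominated_convergence (fun _ => 1)
    (.of_forall fun u => by fun_prop) (.of_forall fun u => .of_forall fun x => ?_) (by simp)
    (.of_forall fun x => ?_)
  · rw [ENNReal.ofReal_le_one]
    have : 0 ≤ c * Real.exp (u * x - u ^ 2 / 2) := by positivity
    linarith
  · refine Continuous.tendsto (f := fun u =>
      ENNReal.ofReal (1 - c * Real.exp (u * x - u ^ 2 / 2))) ?_ u
    exact ENNReal.continuous_ofReal.comp (by fun_prop)

lemma tendsto_hockeyStick_sq (c : ℝ) (hc : 0 ≤ c) :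
    Filter.Tendsto (fun u : ℝ => hockeyStick (Real.toNNReal (u ^ 2)) c) Filter.atTop (nhds 1) := by
  simp_rw [hockeyStick_eq_sq]
  have : (1 : ℝ≥0∞) = ∫⁻ _, 1 ∂gaussianReal 0 1 := by simp
  rw [this]
  refine tendsto_lintegral_filter_of_dominated_convergence (fun _ => 1)
    (.of_forall fun u => by fun_prop) (.of_forall fun u => .of_forall fun x => ?_) (by simp)
    (.of_forall fun x => ?_)
  · rw [ENNReal.ofReal_le_one]
    have : 0 ≤ c * Real.exp (u * x - u ^ 2 / 2) := by positivity
    linarith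
  -- For fixed `x` the exponent `u * x - u ^ 2 / 2` tends to `-∞`, so the integrand tends to one.
  · have h1 : Filter.Tendsto (fun u : ℝ => u * (u / 2 - x)) Filter.atTop Filter.atTop :=
      Filter.tendsto_id.atTop_mul_atTop₀
        (Filter.tendsto_atTop_add_const_right _ (-x) (Filter.tendsto_id.atTop_div_const two_pos))
    have h2 : Filter.Tendsto (fun u : ℝ => 1 - c * Real.exp (-(u * (u / 2 - x)))) Filter.atTop
        (nhds (1 - c * 0)) :=
      ((Real.tendsto_exp_neg_atTop_nhds_zero.comp h1).const_mul c).const_sub 1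
    have h3 := (ENNReal.continuous_ofReal.tendsto _).comp h2
    simp only [mul_zero, sub_zero, ENNReal.ofReal_one] at h3
    refine h3.congr fun u => ?_
    simp only [Function.comp]
    congr 4
    ring

/-- The values of the information for which the Gaussian mechanism is `(log c, δ)`-private form an
interval. -/
lemma exists_maximal_information {c δ : ℝ} (hc : 1 ≤ c) (hδ : δ < 1) :
    ∃ Rm : ℝ≥0, ∀ R, hockeyStick R c ≤ ENNReal.ofReal δ ↔ R ≤ Rm := by
  have hc0 : 0 ≤ c := by linarith
  -- The parameter is `u = √R`. The set is closed by continuity, contains zero because `1 ≤ c`, and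
  -- is bounded because the divergence tends to `1 > δ`; its maximum squared is the threshold.
  set U := {u : ℝ | 0 ≤ u ∧ hockeyStick (Real.toNNReal (u ^ 2)) c ≤ ENNReal.ofReal δ}
  have hcl : IsClosed U := (isClosed_le continuous_const continuous_id).inter
    (isClosed_le (continuous_hockeyStick_sq c hc0) continuous_const)
  have hne : U.Nonempty := ⟨0, le_rfl, by simp [hockeyStick_zero hc]⟩
  have hlt : ENNReal.ofReal δ < 1 := by rwa [ENNReal.ofReal_lt_one]
  have hbdd : BddAbove U := by
    obtain ⟨B, hB⟩ := ((tendsto_hockeyStick_sq c hc0).eventually_const_lt hlt).exists_forall_of_atTop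
    exact ⟨B, fun u hu => by
      by_contra! h
      exact absurd hu.2 (not_le.mpr (hB u h.le))⟩
  have hg := hcl.isGreatest_csSup hne hbdd
  set u₀ := sSup U
  refine ⟨Real.toNNReal (u₀ ^ 2), fun R => ⟨fun h => ?_, fun h => ?_⟩⟩
  · have : √(R : ℝ) ∈ U := ⟨Real.sqrt_nonneg _, by simpa using h⟩
    rw [Real.le_toNNReal_iff_coe_le (sq_nonneg _)]
    calc (R : ℝ) = √(R : ℝ) ^ 2 := by simp
      _ ≤ u₀ ^ 2 := by gcongr; exact hg.2 this
  · exact (hockeyStick_mono h c).trans hg.1.2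

lemma exists_information_pos {c δ : ℝ} (hc : 1 ≤ c) (hδ0 : 0 < δ) :
    ∃ R : ℝ≥0, 0 < R ∧ hockeyStick R c ≤ ENNReal.ofReal δ := by
  have h := (continuous_hockeyStick_sq c (by linarith)).tendsto 0
  simp only [ne_eq, OfNat.ofNat_ne_zero, not_false_eq_true, zero_pow, Real.toNNReal_zero,
    hockeyStick_zero hc] at h
  have h' : ∀ᶠ u in nhdsWithin (0 : ℝ) (Set.Ioi 0),
      hockeyStick (Real.toNNReal (u ^ 2)) c < ENNReal.ofReal δ :=
    (h.mono_left nhdsWithin_le_nhds).eventually_lt_const (by simpa using hδ0)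
  obtain ⟨u, hu, hu0⟩ := (h'.and self_mem_nhdsWithin).exists
  have : (0 : ℝ) < u := hu0
  exact ⟨_, by simp; positivity, hu.le⟩

/-! ### The noise level of the analytic Gaussian mechanism -/

/-- The one-dimensional Cameron–Martin formula, by completing the square. -/
lemma gaussianReal_eq_withDensity (h : ℝ) : gaussianReal h 1 =
    (gaussianReal 0 1).withDensity fun x => ENNReal.ofReal (Real.exp (h * x - h ^ 2 / 2)) := by
  rw [gaussianReal_of_var_ne_zero _ one_ne_zero, gaussianReal_of_var_ne_zero _ one_ne_zero,
    ← withDensity_mul _ (measurable_gaussianPDF _ _) (by fun_prop)]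
  congr 1
  ext x
  simp only [gaussianPDF, Pi.mul_apply, gaussianPDFReal]
  rw [← ENNReal.ofReal_mul (by positivity), mul_assoc _ (Real.exp _) (Real.exp _),
    ← Real.exp_add]
  congr 3
  push_cast
  ring

/-- With `u = 1 / σ`, the integrand is positive only where `ε + u * x - u ^ 2 / 2 < 0`, that is, for
`x < a`. On this half-line the constant contributes `Φ(a)`, and the exponential, a density of the
law shifted by `u`, contributes `exp ε * Φ(a - u)`. -/
lemma hockeyStick_exp_eq {σ : ℝ} (hσ : 0 < σ) (ε : ℝ) :
    hockeyStick (Real.toNNReal (σ⁻¹ ^ 2)) (Real.exp ε) =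
      ENNReal.ofReal (stdNormalCdf (1 / (2 * σ) - ε * σ / 1)
        - Real.exp ε * stdNormalCdf (-(1 / (2 * σ)) - ε * σ / 1)) := by
  rw [hockeyStick_eq_sq]
  set u := σ⁻¹ with hu
  have hu0 : 0 < u := by positivity
  set a := 1 / (2 * σ) - ε * σ / 1 with ha
  have ha' : u * a = u ^ 2 / 2 - ε := by rw [ha, hu]; field_simp
  have ha2 : -(1 / (2 * σ)) - ε * σ / 1 + u = a := by rw [ha, hu]; field_simp; ring
  set E : ℝ → ℝ≥0∞ := fun x => ENNReal.ofReal (Real.exp (u * x - u ^ 2 / 2)) with hE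
  have hEm : Measurable E := by fun_prop
  have h1 : ∀ x, ENNReal.ofReal (1 - Real.exp ε * Real.exp (u * x - u ^ 2 / 2)) =
      (Set.Iic a).indicator (fun x => 1 - ENNReal.ofReal (Real.exp ε) * E x) x := by
    intro x
    by_cases hx : x ≤ a
    · rw [Set.indicator_of_mem (by exact hx), ENNReal.ofReal_sub _ (by positivity),
        ENNReal.ofReal_one, ENNReal.ofReal_mul (by positivity)]
    · rw [Set.indicator_of_notMem (by exact hx), ENNReal.ofReal_eq_zero, ← Real.exp_add]
      have : 0 ≤ ε + (u * x - u ^ 2 / 2) := by nlinarith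
      have := Real.one_le_exp this
      linarith
  have hone : ∀ x ∈ Set.Iic a, ENNReal.ofReal (Real.exp ε) * E x ≤ 1 := by
    intro x hx
    have hx : x ≤ a := hx
    rw [hE, ← ENNReal.ofReal_mul (by positivity), ← Real.exp_add, ENNReal.ofReal_le_one,
      Real.exp_le_one_iff]
    nlinarith
  have hcdf : ∀ y, ENNReal.ofReal (stdNormalCdf y) = gaussianReal 0 1 (Set.Iic y) := fun y => by
    rw [stdNormalCdf, ofReal_cdf]
  have hint : ∫⁻ x in Set.Iic a, E x ∂gaussianReal 0 1
      = ENNReal.ofReal (stdNormalCdf (-(1 / (2 * σ)) - ε * σ / 1)) := by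
    rw [← withDensity_apply _ measurableSet_Iic, ← gaussianReal_eq_withDensity, hcdf]
    have := gaussianReal_map_add_const (μ := 0) (v := 1) u
    rw [zero_add] at this
    rw [← this, Measure.map_apply (by fun_prop) measurableSet_Iic]
    congr 1
    ext x
    simp only [Set.mem_preimage, Set.mem_Iic]
    constructor <;> intro h <;> linarith
  simp_rw [h1]
  rw [lintegral_indicator measurableSet_Iic, lintegral_sub (by fun_prop),
    lintegral_const_mul _ hEm, hint, ENNReal.ofReal_sub, ENNReal.ofReal_mul (by positivity), hcdf a]
  · simp
  · exact mul_nonneg (by positivity) (cdf_nonneg _ _)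
  · rw [lintegral_const_mul _ hEm, hint]
    exact ENNReal.mul_ne_top (by simp) (by simp)
  · exact (ae_restrict_mem measurableSet_Iic).mono hone

/-- In terms of `R = 1 / σ²` the analytic Gaussian condition reads `R ≤ Rm`, so the admissible `σ`
form a closed ray and the infimum is attained. -/
lemma analyticGM_eq {ε δ : ℝ} (hε : 0 ≤ ε) (hδ : 0 < δ) {Rm : ℝ≥0}
    (hR : ∀ R, hockeyStick R (Real.exp ε) ≤ ENNReal.ofReal δ ↔ R ≤ Rm) :
    0 < Rm ∧ analyticGM ε δ 1 = (√(Rm : ℝ))⁻¹ := by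
  have hpos : 0 < Rm := by
    obtain ⟨R, h0, h⟩ := exists_information_pos (Real.one_le_exp hε) hδ
    exact h0.trans_le ((hR R).1 h)
  refine ⟨hpos, ?_⟩
  have hsq : 0 < √(Rm : ℝ) := Real.sqrt_pos.2 (by exact_mod_cast hpos)
  have : {σ : ℝ | 0 < σ ∧ stdNormalCdf (1 / (2 * σ) - ε * σ / 1)
      - Real.exp ε * stdNormalCdf (-(1 / (2 * σ)) - ε * σ / 1) ≤ δ} = Set.Ici (√(Rm : ℝ))⁻¹ := by
    ext σ
    simp only [Set.mem_ofPred_eq, Set.mem_Ici]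
    have key : 0 < σ → ((stdNormalCdf (1 / (2 * σ) - ε * σ / 1)
        - Real.exp ε * stdNormalCdf (-(1 / (2 * σ)) - ε * σ / 1) ≤ δ) ↔ (√(Rm : ℝ))⁻¹ ≤ σ) := by
      intro hσ
      rw [← ENNReal.ofReal_le_ofReal_iff hδ.le, ← hockeyStick_exp_eq hσ, hR,
        ← NNReal.coe_le_coe, Real.coe_toNNReal _ (sq_nonneg _), inv_le_comm₀ hsq hσ,
        Real.le_sqrt (by positivity) (by positivity)]
    constructor
    · rintro ⟨h0, h⟩
      exact (key h0).1 h
    · intro h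
      have h0 : 0 < σ := lt_of_lt_of_le (by positivity) h
      exact ⟨h0, (key h0).2 h⟩
  rw [analyticGM, this, csInf_Ici]

lemma analyticGM_pos {ε δ : ℝ} (hε : 0 ≤ ε) (hδ : 0 < δ) (hδ1 : δ < 1) :
    0 < analyticGM ε δ 1 := by
  obtain ⟨Rm, hR⟩ := exists_maximal_information (Real.one_le_exp hε) hδ1
  obtain ⟨h, h'⟩ := analyticGM_eq hε hδ hR
  rw [h']
  have : 0 < √(Rm : ℝ) := Real.sqrt_pos.2 (by exact_mod_cast h)
  positivity

lemma hockeyStick_analyticGM {ε δ : ℝ} (hε : 0 ≤ ε) (hδ : 0 < δ) (hδ1 : δ < 1) :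
    hockeyStick (Real.toNNReal (analyticGM ε δ 1 ^ 2)⁻¹) (Real.exp ε) ≤ ENNReal.ofReal δ := by
  obtain ⟨Rm, hR⟩ := exists_maximal_information (Real.one_le_exp hε) hδ1
  obtain ⟨h, h'⟩ := analyticGM_eq hε hδ hR
  rw [hR, h']
  simp

lemma analyticGM_anti {ε ε' δ : ℝ} (hε : 0 ≤ ε) (hεε' : ε ≤ ε') (hδ : 0 < δ) (hδ1 : δ < 1) :
    analyticGM ε' δ 1 ≤ analyticGM ε δ 1 := by
  obtain ⟨R, hR⟩ := exists_maximal_information (Real.one_le_exp hε) hδ1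
  obtain ⟨R', hR'⟩ := exists_maximal_information (Real.one_le_exp (hε.trans hεε')) hδ1
  obtain ⟨h, h1⟩ := analyticGM_eq hε hδ hR
  obtain ⟨-, h2⟩ := analyticGM_eq (hε.trans hεε') hδ hR'
  rw [h1, h2]
  have hle : R ≤ R' := (hR' R).1
    ((hockeyStick_anti R (Real.exp_le_exp.2 hεε')).trans ((hR R).2 le_rfl))
  have : 0 < √(R : ℝ) := Real.sqrt_pos.2 (by exact_mod_cast h)
  gcongr

lemma measurable_analyticGM {δ : ℝ} (hδ : 0 ≤ δ) : Measurable fun ε : ℝ => analyticGM ε δ 1 := by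
  classical
  set A : ℝ → Set ℝ := fun ε => {σ : ℝ | 0 < σ ∧ stdNormalCdf (1 / (2 * σ) - ε * σ / 1)
      - Real.exp ε * stdNormalCdf (-(1 / (2 * σ)) - ε * σ / 1) ≤ δ}
  have hA : ∀ ε ε', ε ≤ ε' → A ε ⊆ A ε' := by
    rintro ε ε' h σ ⟨hσ, h1⟩
    refine ⟨hσ, ?_⟩
    rw [← ENNReal.ofReal_le_ofReal_iff hδ, ← hockeyStick_exp_eq hσ] at h1 ⊢
    exact (hockeyStick_anti _ (Real.exp_le_exp.2 h)).trans h1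
  have hbdd : ∀ ε, BddBelow (A ε) := fun ε => ⟨0, fun σ hσ => hσ.1.le⟩
  -- Measurability is needed for all real budgets, and for negative ones the set can be empty. There
  -- the convention `sInf ∅ = 0` would spoil monotonicity; the value `⊤` keeps `g` antitone, and
  -- `toReal` returns it to zero.
  set g : ℝ → ℝ≥0∞ := fun ε => if (A ε).Nonempty then ENNReal.ofReal (sInf (A ε)) else ⊤
  have hg : Antitone g := by
    intro ε ε' h
    by_cases hne : (A ε).Nonempty
    · simp only [g, if_pos hne, if_pos (hne.mono (hA _ _ h))]
      exact ENNReal.ofReal_le_ofReal (csInf_le_csInf (hbdd _) hne (hA _ _ h))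
    · simp only [g, if_neg hne, le_top]
  have hfg : (fun ε : ℝ => analyticGM ε δ 1) = fun ε => (g ε).toReal := by
    funext ε
    by_cases hne : (A ε).Nonempty
    · simp only [g, if_pos hne]
      rw [ENNReal.toReal_ofReal (le_csInf hne fun σ hσ => hσ.1.le)]
      rfl
    · simp only [g, if_neg hne, ENNReal.toReal_top]
      have h0 : A ε = ∅ := Set.not_nonempty_iff_eq_empty.1 hne
      have : analyticGM ε δ 1 = sInf (A ε) := rfl
      rw [this, h0, Real.sInf_empty]
  rw [hfg]
  exact hg.measurable.ennreal_toReal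

/-! ### Product measures and standard normal vectors -/

/-- Resampling one coordinate of a product of probability measures does not change the law. -/
lemma lintegral_pi_update {δ : Type*} [Fintype δ] [DecidableEq δ] {X : δ → Type*}
    [∀ i, MeasurableSpace (X i)] (μ : (i : δ) → Measure (X i)) [∀ i, IsProbabilityMeasure (μ i)]
    (j : δ) {f : (∀ i, X i) → ℝ≥0∞} (hf : Measurable f) :
    ∫⁻ x, f x ∂Measure.pi μ = ∫⁻ x, ∫⁻ y, f (Function.update x j y) ∂μ j ∂Measure.pi μ := by
  have hg : Measurable fun x : ∀ i, X i => ∫⁻ y, f (Function.update x j y) ∂μ j := by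
    refine Measurable.lintegral_prod_right'
      (f := fun p : (∀ i, X i) × X j => f (Function.update p.1 j p.2)) (hf.comp ?_)
    exact measurable_update'
  obtain ⟨x₀⟩ := nonempty_of_isProbabilityMeasure (Measure.pi μ)
  rw [lintegral_eq_lmarginal_univ x₀, lintegral_eq_lmarginal_univ x₀,
    lmarginal_erase' _ hf (Finset.mem_univ j), lmarginal_erase' _ hg (Finset.mem_univ j)]
  simp

/-- The law of a standard normal vector. -/
noncomputable abbrev stdGauss (ι : Type*) [Fintype ι] : Measure (ι → ℝ) :=
  Measure.pi fun _ => gaussianReal 0 1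

section

variable {ι : Type*} [Fintype ι]

/-- Cameron–Martin in one direction: resampling the coordinate `b` reduces it to the one-dimensional
formula. -/
lemma lintegral_stdGauss_add_single [DecidableEq ι] (b : ι) (h : ℝ) {f : (ι → ℝ) → ℝ≥0∞}
    (hf : Measurable f) :
    ∫⁻ x, f (x + Pi.single b h) ∂stdGauss ι =
      ∫⁻ x, ENNReal.ofReal (Real.exp (h * x b - h ^ 2 / 2)) * f x ∂stdGauss ι := by
  rw [lintegral_pi_update _ b (by fun_prop),
    lintegral_pi_update _ b (f := fun x => ENNReal.ofReal (Real.exp (h * x b - h ^ 2 / 2)) * f x)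
      (by fun_prop)]
  refine lintegral_congr fun x => ?_
  have hfu : Measurable fun y => f (Function.update x b y) := hf.comp (measurable_update x)
  have h1 : ∀ y, f (Function.update x b y + Pi.single b h) = f (Function.update x b (y + h)) := by
    intro y
    congr 1
    ext i
    by_cases hi : i = b
    · subst hi; simp
    · simp [hi]
  simp_rw [h1, Function.update_self]
  have h2 := gaussianReal_map_add_const (μ := 0) (v := 1) h
  rw [zero_add] at h2
  rw [← lintegral_map (f := fun y => f (Function.update x b y)) (g := fun y => y + h) hfu
    (by fun_prop), h2, gaussianReal_eq_withDensity,
    lintegral_withDensity_eq_lintegral_mul _ (by fun_prop) hfu]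
  rfl

lemma map_mul_eval_stdGauss (b : ι) (h : ℝ) :
    (stdGauss ι).map (fun x => h * x b) = gaussianReal 0 (Real.toNNReal (h ^ 2)) := by
  have h1 := (measurePreserving_eval (fun _ : ι => gaussianReal 0 1) b).map_eq
  have h2 : (fun x : ι → ℝ => h * x b) = (h * ·) ∘ Function.eval b := rfl
  rw [h2, ← Measure.map_map (by fun_prop) (by fun_prop), h1, gaussianReal_map_const_mul, mul_zero,
    mul_one]
  congr 1
  ext
  simp [sq_nonneg]

instance isGaussian_stdGauss : IsGaussian (stdGauss ι) := by
  have h : HasGaussianLaw (fun x : ι → ℝ => fun i => x i) (stdGauss ι) := by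
    refine iIndepFun.hasGaussianLaw (X := fun i (x : ι → ℝ) => x i) (fun i => ⟨?_⟩)
      (iIndepFun_pi (X := fun _ => id) fun _ => aemeasurable_id)
    have := (measurePreserving_eval (fun _ : ι => gaussianReal 0 1) i).map_eq
    change IsGaussian ((stdGauss ι).map (Function.eval i))
    rw [this]
    infer_instance
  have := h.isGaussian_map
  simpa using this

lemma integral_stdGauss : ∫ x, id x ∂stdGauss ι = 0 := by
  ext i
  have hi : Integrable (fun x : ι → ℝ => id x) (stdGauss ι) := IsGaussian.integrable_id
  rw [eval_integral (fun j => hi.eval j)]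
  simp [integral_eval]

/-- A pair of independent copies of a centred Gaussian law is invariant under rotation. The two
lemmas on combining and on reversing Gaussian vectors are instances with suitable angles. -/
lemma lintegral_stdGauss_rotate {c s : ℝ} (h : c ^ 2 + s ^ 2 = 1) {f : (ι → ℝ) × (ι → ℝ) → ℝ≥0∞}
    (hf : Measurable f) :
    ∫⁻ x, ∫⁻ y, f (c • x + s • y, -s • x + c • y) ∂stdGauss ι ∂stdGauss ι =
      ∫⁻ x, ∫⁻ y, f (x, y) ∂stdGauss ι ∂stdGauss ι := by
  obtain ⟨θ, hc, hs⟩ : ∃ θ : ℝ, Real.cos θ = c ∧ Real.sin θ = s := by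
    have hn : ‖(⟨c, s⟩ : ℂ)‖ = 1 := by
      rw [Complex.norm_def, Complex.normSq_mk, ← sq, ← sq, h, Real.sqrt_one]
    refine ⟨Complex.arg ⟨c, s⟩, ?_, ?_⟩
    · rw [Complex.cos_arg (by rw [← norm_pos_iff, hn]; exact one_pos), hn, div_one]
    · rw [Complex.sin_arg, hn, div_one]
  rw [← lintegral_prod _ hf.aemeasurable,
    ← IsGaussian.map_rotation_eq_self (μ := stdGauss ι) integral_stdGauss θ,
    lintegral_map hf (by fun_prop), lintegral_prod]
  · simp only [ContinuousLinearMap.rotation_apply, hc, hs]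
  · exact (hf.comp (by fun_prop)).aemeasurable

/-- The sum of two independent centered Gaussian vectors. -/
lemma lintegral_stdGauss_combine (p q : ℝ) {f : (ι → ℝ) → ℝ≥0∞} (hf : Measurable f) :
    ∫⁻ x, ∫⁻ y, f (p • x + q • y) ∂stdGauss ι ∂stdGauss ι =
      ∫⁻ x, f (√(p ^ 2 + q ^ 2) • x) ∂stdGauss ι := by
  set r := √(p ^ 2 + q ^ 2) with hr
  rcases eq_or_ne r 0 with h0 | h0
  · have h1 : p ^ 2 + q ^ 2 = 0 := by
      rw [hr, Real.sqrt_eq_zero (by positivity)] at h0; exact h0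
    have hp : p = 0 := by nlinarith [sq_nonneg p, sq_nonneg q]
    have hq : q = 0 := by nlinarith [sq_nonneg p, sq_nonneg q]
    simp [h0, hp, hq]
  · have hsq : r ^ 2 = p ^ 2 + q ^ 2 := Real.sq_sqrt (by positivity)
    -- This rotation makes the normalised sum the first coordinate; the second is integrated out.
    have := lintegral_stdGauss_rotate (ι := ι) (c := p / r) (s := q / r) (by
      field_simp; exact hsq.symm) (f := fun z => f (r • z.1)) (by fun_prop)
    simp only [smul_add, smul_smul, mul_div_cancel₀ _ h0, lintegral_const, measure_univ,
      mul_one] at this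
    exact this

/-- Reversal of the order of sampling: a centered Gaussian vector and a noisy version of it. -/
lemma lintegral_stdGauss_posterior {A l : ℝ} (hA : 0 ≤ A) (hl : 0 ≤ l)
    {f : (ι → ℝ) × (ι → ℝ) → ℝ≥0∞} (hf : Measurable f) :
    ∫⁻ x, ∫⁻ z, f (√A • x, √A • x + √l • z) ∂stdGauss ι ∂stdGauss ι =
      ∫⁻ y, ∫⁻ x, f ((A / (A + l) * √(A + l)) • y + √(A * l / (A + l)) • x, √(A + l) • y)
        ∂stdGauss ι ∂stdGauss ι := by
  rcases (add_nonneg hA hl).eq_or_lt with h0 | h0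
  · have hA0 : A = 0 := by linarith
    have hl0 : l = 0 := by linarith
    simp [hA0, hl0]
  -- The angle is chosen so that the noisy vector `√A • x + √l • z` becomes a multiple of one
  -- rotated coordinate. The other coordinate is then the independent residual, with variance `A * l
  -- / (A + l)`.
  · have h1 : (√(l / (A + l))) ^ 2 + (√(A / (A + l))) ^ 2 = 1 := by
      rw [Real.sq_sqrt (by positivity), Real.sq_sqrt (by positivity)]
      field_simp
      ring
    rw [← lintegral_stdGauss_rotate h1 (f := fun p => f (√A • p.1, √A • p.1 + √l • p.2))
      (by fun_prop), lintegral_lintegral_swap]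
    · refine lintegral_congr fun y => lintegral_congr fun x => ?_
      have hr : 0 < √(A + l) := Real.sqrt_pos.2 h0
      have e1 : √A * √(l / (A + l)) = √(A * l / (A + l)) := by
        rw [← Real.sqrt_mul hA, mul_div_assoc]
      have e2 : √A * √(A / (A + l)) = A / (A + l) * √(A + l) := by
        rw [Real.sqrt_div hA, mul_div_assoc', Real.mul_self_sqrt hA, div_mul_eq_mul_div,
          div_eq_div_iff hr.ne' h0.ne', mul_assoc, Real.mul_self_sqrt h0.le]
      have e3 : √l * √(l / (A + l)) + √A * √(A / (A + l)) = √(A + l) := by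
        rw [Real.sqrt_div hl, Real.sqrt_div hA, mul_div_assoc', mul_div_assoc',
          Real.mul_self_sqrt hA, Real.mul_self_sqrt hl, ← add_div, div_eq_iff hr.ne',
          Real.mul_self_sqrt h0.le]
        ring
      have e4 : √A * √(l / (A + l)) = √l * √(A / (A + l)) := by
        rw [Real.sqrt_div hl, Real.sqrt_div hA]; ring
      congr 2
      · rw [smul_add, smul_smul, smul_smul, e1, e2, add_comm]
      · rw [← e3]
        simp only [smul_add, smul_smul, add_smul, neg_smul, smul_neg, e4]
        abel
    · fun_prop

end

/-! ### Running the system from an arbitrary state -/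

section Run

variable {𝒮 : Schema} {m n : ℕ} {𝒱 : Fin n → HistView 𝒮}

/-- The policy that remains after the first response `r`. -/
def Policy.shift (π : Policy m 𝒱) (r : Response m 𝒱) : Policy m 𝒱 := fun t h =>
  π (t + 1) (Fin.cons (α := fun _ => Response m 𝒱) r h)

open Classical in
/-- `T` rounds of the system started in the state `s`, by recursion on the first round. -/
noncomputable def runFrom (M : Mechanism m 𝒱) (D : Database 𝒮) :
    (T : ℕ) → M.State → Policy m 𝒱 → (Fin T → Draw 𝒱) → M.State × (Fin T → Response m 𝒱)
  | 0, s, _, _ => (s, Fin.elim0)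
  | T + 1, s, π, ω =>
    let q := π 0 Fin.elim0
    if M.constraintCheck s q then
      let res := M.run D (ω 0) s q
      let r : Response m 𝒱 := Response.release q.1 q.2.1 res.2
      let rest := runFrom M D T res.1 (π.shift r) fun t => ω t.succ
      (rest.1, Fin.cons (α := fun _ => Response m 𝒱) r rest.2)
    else
      let rest := runFrom M D T s (π.shift Response.reject) fun t => ω t.succ
      (rest.1, Fin.cons (α := fun _ => Response m 𝒱) Response.reject rest.2)

open Classical in
/-- One round of the system, as a function of the state, the earlier responses and the request. -/
noncomputable def stepLast (M : Mechanism m 𝒱) (D : Database 𝒮) {T : ℕ} (z : Draw 𝒱)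
    (past : M.State × (Fin T → Response m 𝒱)) (q : Request m n) :
    M.State × (Fin (T + 1) → Response m 𝒱) :=
  if M.constraintCheck past.1 q then
    ((M.run D z past.1 q).1, Fin.snoc (α := fun _ => Response m 𝒱) past.2
      (Response.release q.1 q.2.1 (M.run D z past.1 q).2))
  else (past.1, Fin.snoc (α := fun _ => Response m 𝒱) past.2 Response.reject)

lemma runFrom_succ_of_check {M : Mechanism m 𝒱} {s : M.State} {π : Policy m 𝒱} {i : Fin m}
    {j : Fin n} {ε : ℝ} (hq : π 0 Fin.elim0 = (i, j, ε)) (h : M.constraintCheck s (i, j, ε))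
    (D : Database 𝒮) (T : ℕ) (ω : Fin (T + 1) → Draw 𝒱) :
    (runFrom M D (T + 1) s π ω).2 = Fin.cons (α := fun _ => Response m 𝒱)
      (Response.release i j (M.run D (ω 0) s (i, j, ε)).2)
      (runFrom M D T (M.run D (ω 0) s (i, j, ε)).1
        (π.shift (Response.release i j (M.run D (ω 0) s (i, j, ε)).2)) fun t => ω t.succ).2 := by
  rw [runFrom]
  generalize π 0 Fin.elim0 = q at hq
  subst hq
  simp only
  rw [if_pos h]

lemma runFrom_succ_of_not_check {M : Mechanism m 𝒱} {s : M.State} {π : Policy m 𝒱}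
    (h : ¬ M.constraintCheck s (π 0 Fin.elim0)) (D : Database 𝒮) (T : ℕ)
    (ω : Fin (T + 1) → Draw 𝒱) :
    (runFrom M D (T + 1) s π ω).2 = Fin.cons (α := fun _ => Response m 𝒱) Response.reject
      (runFrom M D T s (π.shift Response.reject) fun t => ω t.succ).2 := by
  rw [runFrom]
  simp only
  rw [if_neg h]

lemma stepLast_cons (M : Mechanism m 𝒱) (D : Database 𝒮) {T : ℕ} (z : Draw 𝒱) (s : M.State)
    (r : Response m 𝒱) (h : Fin T → Response m 𝒱) (q : Request m n) :
    stepLast M D z (s, (Fin.cons (α := fun _ => Response m 𝒱) r h : Fin (T + 1) → Response m 𝒱)) q =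
      ((stepLast M D z (s, h) q).1,
        Fin.cons (α := fun _ => Response m 𝒱) r (stepLast M D z (s, h) q).2) := by
  unfold stepLast
  simp only
  split_ifs
  · exact Prod.ext rfl (Fin.cons_snoc_eq_snoc_cons _ _ _).symm
  · exact Prod.ext rfl (Fin.cons_snoc_eq_snoc_cons _ _ _).symm

lemma cons_elim0_eq_snoc (r : Response m 𝒱) :
    (Fin.cons (α := fun _ => Response m 𝒱) r Fin.elim0 : Fin (0 + 1) → Response m 𝒱) =
      Fin.snoc (α := fun _ => Response m 𝒱) Fin.elim0 r := by
  ext1 t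
  obtain rfl : t = Fin.last 0 := Subsingleton.elim (α := Fin 1) t _
  rw [Fin.snoc_last]
  rfl

/-- Peeling off the last round instead of the first links this recursion to `exec`. The privacy
induction needs the first round, measurability the last one. -/
lemma runFrom_succ_last (M : Mechanism m 𝒱) (D : Database 𝒮) (T : ℕ) (s : M.State)
    (π : Policy m 𝒱) (ω : Fin (T + 1) → Draw 𝒱) :
    runFrom M D (T + 1) s π ω =
      stepLast M D (ω (Fin.last T)) (runFrom M D T s π fun t => ω t.castSucc)
        (π T (runFrom M D T s π fun t => ω t.castSucc).2) := by
  induction T generalizing s π with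
  | zero =>
    simp only [runFrom, cons_elim0_eq_snoc]
    rfl
  | succ T ih =>
    rw [runFrom]
    conv_rhs => rw [runFrom]
    simp only
    split_ifs with h
    · rw [ih, stepLast_cons]
      rfl
    · rw [ih, stepLast_cons]
      rfl

lemma exec_eq_runFrom (M : Mechanism m 𝒱) (π : Policy m 𝒱) (D : Database 𝒮) (T : ℕ)
    (ω : Fin T → Draw 𝒱) : exec M π D T ω = runFrom M D T M.init π ω := by
  induction T with
  | zero => rfl
  | succ T ih =>
    rw [runFrom_succ_last, ← ih]
    rfl

end Run

/-! ### Measurability -/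

section Measurability

variable {𝒮 : Schema} {m n : ℕ} {𝒱 : Fin n → HistView 𝒮}

lemma measurable_fin_snoc {T : ℕ} {α : Type*} [MeasurableSpace α] :
    Measurable fun p : (Fin T → α) × α => (Fin.snoc (α := fun _ => α) p.1 p.2 : Fin (T + 1) → α) := by
  refine measurable_pi_iff.2 fun t => ?_
  refine Fin.lastCases ?_ (fun t => ?_) t
  · simpa using measurable_snd
  · simp only [Fin.snoc_castSucc]
    fun_prop

lemma measurable_fin_cons {T : ℕ} {α : Type*} [MeasurableSpace α] :
    Measurable fun p : α × (Fin T → α) => (Fin.cons (α := fun _ => α) p.1 p.2 : Fin (T + 1) → α) := by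
  refine measurable_pi_iff.2 fun t => ?_
  refine Fin.cases ?_ (fun t => ?_) t
  · simpa using measurable_fst
  · simp only [Fin.cons_succ]
    fun_prop

lemma measurable_sigmaMk {α : Type*} {β : α → Type*} [∀ a, MeasurableSpace (β a)] (a : α) :
    Measurable (Sigma.mk a : β a → Sigma β) := fun _ hs => (MeasurableSpace.measurableSet_iInf.1 hs) a

lemma measurable_of_sigma {α γ : Type*} {β : α → Type*} [∀ a, MeasurableSpace (β a)]
    [MeasurableSpace γ] {f : Sigma β → γ} (hf : ∀ a, Measurable fun b => f ⟨a, b⟩) :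
    Measurable f := fun _ hs => MeasurableSpace.measurableSet_iInf.2 fun a => hf a hs

/-- A mechanism whose check and whose responses are measurable. -/
structure Mechanism.IsMeasurable (M : Mechanism m 𝒱) [MeasurableSpace M.State] : Prop where
  check : MeasurableSet {p : M.State × Request m n | M.constraintCheck p.1 p.2}
  run : ∀ D, Measurable fun p : Draw 𝒱 × M.State × Request m n =>
    ((M.run D p.1 p.2.1 p.2.2).1,
      (Response.release p.2.2.1 p.2.2.2.1 (M.run D p.1 p.2.1 p.2.2).2 : Response m 𝒱))

/-- State and policy depend on a parameter because, after one round, both are random. Recursion on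
the last round keeps the policy unchanged in the induction. -/
lemma measurable_runFrom {M : Mechanism m 𝒱} [MeasurableSpace M.State] (hM : M.IsMeasurable)
    (D : Database 𝒮) {X : Type*} [MeasurableSpace X] {s : X → M.State} (hs : Measurable s)
    {p : X → Policy m 𝒱}
    (hp : ∀ t, Measurable fun z : X × (Fin t → Response m 𝒱) => p z.1 t z.2) (T : ℕ) :
    Measurable fun z : X × (Fin T → Draw 𝒱) => runFrom M D T (s z.1) (p z.1) z.2 := by
  induction T with
  | zero => exact (hs.comp measurable_fst).prodMk measurable_const
  | succ T ih =>
    simp_rw [runFrom_succ_last]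
    have hpast : Measurable fun z : X × (Fin (T + 1) → Draw 𝒱) =>
        runFrom M D T (s z.1) (p z.1) fun t => z.2 t.castSucc :=
      ih.comp (measurable_fst.prodMk (measurable_pi_iff.2 fun t =>
        (measurable_pi_apply t.castSucc).comp measurable_snd))
    have hq : Measurable fun z : X × (Fin (T + 1) → Draw 𝒱) =>
        p z.1 T (runFrom M D T (s z.1) (p z.1) fun t => z.2 t.castSucc).2 :=
      (hp T).comp (measurable_fst.prodMk (measurable_snd.comp hpast))
    have hrun := (hM.run D).comp ((((measurable_pi_apply (Fin.last T)).comp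
      (measurable_snd (α := X) (β := Fin (T + 1) → Draw 𝒱)))).prodMk
        ((measurable_fst.comp hpast).prodMk hq))
    unfold stepLast
    refine Measurable.ite (hM.check.preimage ((measurable_fst.comp hpast).prodMk hq)) ?_ ?_
    · exact (measurable_fst.comp hrun).prodMk
        (measurable_fin_snoc.comp ((measurable_snd.comp hpast).prodMk (measurable_snd.comp hrun)))
    · exact (measurable_fst.comp hpast).prodMk
        (measurable_fin_snoc.comp ((measurable_snd.comp hpast).prodMk measurable_const))

/-- What an observer sees of one response. -/
noncomputable def observeOne (S : Set (Fin m × Fin n)) (r : Response m 𝒱) : Response m 𝒱 :=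
  observe S (fun _ : Fin 1 => r) 0

lemma observe_apply (S : Set (Fin m × Fin n)) {T : ℕ} (h : Fin T → Response m 𝒱) (t : Fin T) :
    observe S h t = observeOne S (h t) := rfl

lemma observe_cons (S : Set (Fin m × Fin n)) {T : ℕ} (r : Response m 𝒱)
    (h : Fin T → Response m 𝒱) :
    observe S (Fin.cons (α := fun _ => Response m 𝒱) r h) =
      Fin.cons (α := fun _ => Response m 𝒱) (observeOne S r) (observe S h) := by
  ext1 t
  refine Fin.cases ?_ (fun t => ?_) t <;> simp [observe_apply]

lemma observeOne_reject (S : Set (Fin m × Fin n)) :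
    observeOne S (Response.reject : Response m 𝒱) = Response.reject := rfl

lemma observeOne_release_of_mem {S : Set (Fin m × Fin n)} {i : Fin m} {j : Fin n} (h : (i, j) ∈ S)
    (y : Synopsis 𝒱 j) :
    observeOne S (Response.release i j y) = Response.release i j y := by
  simp [observeOne, observe, h]

lemma observeOne_release_of_notMem {S : Set (Fin m × Fin n)} {i : Fin m} {j : Fin n}
    (h : (i, j) ∉ S) (y : Synopsis 𝒱 j) :
    observeOne S (Response.release i j y) = Response.reject := by
  simp [observeOne, observe, h]

lemma measurable_observeOne (S : Set (Fin m × Fin n)) :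
    Measurable (observeOne S : Response m 𝒱 → Response m 𝒱) := by
  refine measurable_fun_sum measurable_const (measurable_of_sigma fun p => ?_)
  by_cases h : p ∈ S
  · have : (fun y => (observeOne S ∘ Sum.inr) ⟨p, y⟩) =
        fun y : Synopsis 𝒱 p.2 => (Sum.inr ⟨p, y⟩ : Response m 𝒱) :=
      funext fun y => observeOne_release_of_mem h y
    rw [this]
    exact measurable_inr.comp (measurable_sigmaMk p)
  · have : (fun y => (observeOne S ∘ Sum.inr) ⟨p, y⟩) =
        fun _ : Synopsis 𝒱 p.2 => (Response.reject : Response m 𝒱) :=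
      funext fun y => observeOne_release_of_notMem h y
    rw [this]
    exact measurable_const

lemma measurable_observe (S : Set (Fin m × Fin n)) (T : ℕ) :
    Measurable (observe S : (Fin T → Response m 𝒱) → Fin T → Response m 𝒱) :=
  measurable_pi_iff.2 fun t => (measurable_observeOne S).comp (measurable_pi_apply t)

end Measurability

/-! ### A filter for adaptively composed Gaussian mechanisms -/

section Filter

variable {𝒮 : Schema} {m n : ℕ} {𝒱 : Fin n → HistView 𝒮}

instance (𝒱 : Fin n → HistView 𝒮) : IsProbabilityMeasure (drawLaw 𝒱) := by
  unfold drawLaw; infer_instance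

instance (𝒱 : Fin n → HistView 𝒮) (T : ℕ) : IsProbabilityMeasure (noiseLaw 𝒱 T) := by
  unfold noiseLaw; infer_instance

lemma noiseLaw_succ_apply (T : ℕ) {A : Set (Draw 𝒱 × (Fin T → Draw 𝒱))} (hA : MeasurableSet A) :
    noiseLaw 𝒱 (T + 1) {ω | (ω 0, fun t : Fin T => ω t.succ) ∈ A} =
      ∫⁻ z, noiseLaw 𝒱 T {ω | (z, ω) ∈ A} ∂drawLaw 𝒱 := by
  have h := measurePreserving_piFinSuccAbove (fun _ : Fin (T + 1) => drawLaw 𝒱) 0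
  have h' := h.measure_preimage hA.nullMeasurableSet
  rw [Measure.prod_apply hA] at h'
  exact h'

/-- The probability that an observer of `S` sees an outcome in `O`, when the system is started in
the state `s`. -/
noncomputable def outProb (M : Mechanism m 𝒱) (S : Set (Fin m × Fin n)) (D : Database 𝒮) (T : ℕ)
    (π : Policy m 𝒱) (O : Set (Fin T → Response m 𝒱)) (s : M.State) : ℝ≥0∞ :=
  noiseLaw 𝒱 T {ω | observe S (runFrom M D T s π ω).2 ∈ O}

variable {M : Mechanism m 𝒱} [MeasurableSpace M.State]

lemma measurableSet_outcome (hM : M.IsMeasurable) (S : Set (Fin m × Fin n)) (D : Database 𝒮)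
    (T : ℕ) {X : Type*} [MeasurableSpace X] {s : X → M.State} (hs : Measurable s)
    {p : X → Policy m 𝒱}
    (hp : ∀ t, Measurable fun z : X × (Fin t → Response m 𝒱) => p z.1 t z.2)
    {O : Set (X × (Fin T → Response m 𝒱))} (hO : MeasurableSet O) :
    MeasurableSet {z : X × (Fin T → Draw 𝒱) |
      (z.1, observe S (runFrom M D T (s z.1) (p z.1) z.2).2) ∈ O} :=
  hO.preimage (measurable_fst.prodMk ((measurable_observe S T).comp
    (measurable_snd.comp (measurable_runFrom hM D hs hp T))))

lemma measurable_outProb (hM : M.IsMeasurable) (S : Set (Fin m × Fin n)) (D : Database 𝒮)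
    (T : ℕ) {X : Type*} [MeasurableSpace X] {s : X → M.State} (hs : Measurable s)
    {p : X → Policy m 𝒱}
    (hp : ∀ t, Measurable fun z : X × (Fin t → Response m 𝒱) => p z.1 t z.2)
    {O : Set (X × (Fin T → Response m 𝒱))} (hO : MeasurableSet O) :
    Measurable fun x => outProb M S D T (p x) {h | (x, h) ∈ O} (s x) :=
  measurable_measure_prodMk_left (measurableSet_outcome hM S D T hs hp hO)

lemma measurable_shift {π : Policy m 𝒱} (hπ : ∀ t, Measurable (π t)) {X : Type*}
    [MeasurableSpace X] {r : X → Response m 𝒱} (hr : Measurable r) (t : ℕ) :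
    Measurable fun z : X × (Fin t → Response m 𝒱) => π.shift (r z.1) t z.2 :=
  (hπ (t + 1)).comp (measurable_fin_cons.comp ((hr.comp measurable_fst).prodMk measurable_snd))

lemma measurableSet_cons {T : ℕ} {O : Set (Fin (T + 1) → Response m 𝒱)} (hO : MeasurableSet O)
    {X : Type*} [MeasurableSpace X] {r : X → Response m 𝒱} (hr : Measurable r) :
    MeasurableSet {z : X × (Fin T → Response m 𝒱) |
      Fin.cons (α := fun _ => Response m 𝒱) (r z.1) z.2 ∈ O} :=
  hO.preimage (measurable_fin_cons.comp ((hr.comp measurable_fst).prodMk measurable_snd))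

lemma measurable_shift_apply {π : Policy m 𝒱} (hπ : ∀ t, Measurable (π t)) (r : Response m 𝒱)
    (t : ℕ) : Measurable (π.shift r t) :=
  (hπ (t + 1)).comp (measurable_fin_cons.comp (measurable_const.prodMk measurable_id))

lemma measurableSet_cons_apply {T : ℕ} {O : Set (Fin (T + 1) → Response m 𝒱)}
    (hO : MeasurableSet O) (r : Response m 𝒱) :
    MeasurableSet {h : Fin T → Response m 𝒱 | Fin.cons (α := fun _ => Response m 𝒱) r h ∈ O} :=
  hO.preimage (measurable_fin_cons.comp (measurable_const.prodMk measurable_id))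

lemma outProb_succ_of_not_check (hM : M.IsMeasurable) (S : Set (Fin m × Fin n)) (D : Database 𝒮)
    (T : ℕ) {π : Policy m 𝒱} (hπ : ∀ t, Measurable (π t)) {O : Set (Fin (T + 1) → Response m 𝒱)}
    (hO : MeasurableSet O) {s : M.State} (h : ¬ M.constraintCheck s (π 0 Fin.elim0)) :
    outProb M S D (T + 1) π O s = outProb M S D T (π.shift Response.reject)
      {h | Fin.cons (α := fun _ => Response m 𝒱) Response.reject h ∈ O} s := by
  have hA := measurableSet_outcome hM S D T (X := Draw 𝒱) (s := fun _ => s) measurable_const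
    (p := fun _ => π.shift Response.reject) (measurable_shift hπ measurable_const)
    (measurableSet_cons hO (r := fun _ => Response.reject) measurable_const)
  have := noiseLaw_succ_apply T hA
  simp only [lintegral_const, measure_univ, mul_one, Set.mem_ofPred_eq] at this
  simp only [outProb, runFrom_succ_of_not_check h, observe_cons, observeOne_reject,
    Set.mem_ofPred_eq]
  exact this

lemma outProb_succ_of_check (hM : M.IsMeasurable) (S : Set (Fin m × Fin n)) (D : Database 𝒮)
    (T : ℕ) {π : Policy m 𝒱} (hπ : ∀ t, Measurable (π t)) {O : Set (Fin (T + 1) → Response m 𝒱)}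
    (hO : MeasurableSet O) {s : M.State} {i : Fin m} {j : Fin n} {ε : ℝ}
    (hq : π 0 Fin.elim0 = (i, j, ε)) (h : M.constraintCheck s (i, j, ε)) :
    outProb M S D (T + 1) π O s = ∫⁻ z,
      outProb M S D T (π.shift (Response.release i j (M.run D z s (i, j, ε)).2))
        {h | Fin.cons (α := fun _ => Response m 𝒱)
          (observeOne S (Response.release i j (M.run D z s (i, j, ε)).2)) h ∈ O}
        (M.run D z s (i, j, ε)).1 ∂drawLaw 𝒱 := by
  have hrun := (hM.run D).comp ((measurable_id (α := Draw 𝒱)).prodMk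
    (measurable_const (a := ((s, (i, j, ε)) : M.State × Request m n))))
  have hr := measurable_snd.comp hrun
  have hA := measurableSet_outcome hM S D T (X := Draw 𝒱) (measurable_fst.comp hrun)
    (p := fun z => π.shift (Response.release i j (M.run D z s (i, j, ε)).2))
    (measurable_shift hπ hr) (measurableSet_cons hO ((measurable_observeOne S).comp hr))
  have := noiseLaw_succ_apply T hA
  simp only [outProb, runFrom_succ_of_check hq h, observe_cons, Set.mem_ofPred_eq]
  exact this

/-- A description of what an observer of the requests in `S` knows about the state of `M`. A belief
`b` stands for the random state `st E b ζ`, with `ζ` drawn from `ν`, if the database is `E`. On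
rounds that the observer does not see, the belief changes deterministically; a response that he
sees is a Gaussian vector, which adds at least `h` to the information of the belief, where `h` is
the variance of its log-likelihood ratio with respect to the databases `D` and `D'`. -/
structure IsBeliefSystem (M : Mechanism m 𝒱) [MeasurableSpace M.State] (S : Set (Fin m × Fin n))
    (D D' : Database 𝒮) {Z : Type} [MeasurableSpace Z] (ν : Measure Z) {B : Type}
    (st : Database 𝒮 → B → Z → M.State) (Good : B → Prop) (info : B → ℝ≥0) : Prop where
  check : ∀ E E' b ζ ζ' q, M.constraintCheck (st E b ζ) q → M.constraintCheck (st E' b ζ') q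
  hidden : ∀ b i j ε, Good b → (∀ E ζ, M.constraintCheck (st E b ζ) (i, j, ε)) → (i, j) ∉ S →
    ∃ b', Good b' ∧ info b ≤ info b' ∧ ∀ E, ∀ F : M.State → ℝ≥0∞, Measurable F →
      ∫⁻ ζ, ∫⁻ z, F (M.run E z (st E b ζ) (i, j, ε)).1 ∂drawLaw 𝒱 ∂ν = ∫⁻ ζ, F (st E b' ζ) ∂ν
  visible : ∀ b i j ε, Good b → (∀ E ζ, M.constraintCheck (st E b ζ) (i, j, ε)) → (i, j) ∈ S →
    ∃ (b' : Synopsis 𝒱 j → B) (y : Synopsis 𝒱 j → Synopsis 𝒱 j) (l : Synopsis 𝒱 j → ℝ) (h : ℝ≥0),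
      Measurable l ∧ (stdGauss (𝒱 j).Bin).map l = gaussianReal 0 h ∧
      (∀ ξ, Good (b' ξ) ∧ info b + h ≤ info (b' ξ)) ∧
      (∀ F : M.State × Synopsis 𝒱 j → ℝ≥0∞, Measurable F →
        ∫⁻ ζ, ∫⁻ z, F (M.run D z (st D b ζ) (i, j, ε)) ∂drawLaw 𝒱 ∂ν =
          ∫⁻ ξ, ∫⁻ ζ, F (st D (b' ξ) ζ, y ξ) ∂ν ∂stdGauss (𝒱 j).Bin) ∧
      (∀ F : M.State × Synopsis 𝒱 j → ℝ≥0∞, Measurable F →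
        ∫⁻ ζ, ∫⁻ z, F (M.run D' z (st D' b ζ) (i, j, ε)) ∂drawLaw 𝒱 ∂ν =
          ∫⁻ ξ, ENNReal.ofReal (Real.exp (l ξ - h / 2)) *
            ∫⁻ ζ, F (st D' (b' ξ) ζ, y ξ) ∂ν ∂stdGauss (𝒱 j).Bin)

lemma Policy.shift_dependsOnlyOn {S : Set (Fin m × Fin n)} {π : Policy m 𝒱}
    (hπ : π.DependsOnlyOn (fun h => observe S h)) (r : Response m 𝒱) :
    (π.shift r).DependsOnlyOn (fun h => observe S h) := by
  intro t h h' hh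
  refine hπ _ _ _ ?_
  simp only [observe_cons]
  rw [show observe S h = observe S h' from hh]

/-- A release that the observer does not see therefore leads to the same further requests as a
rejection, which makes the belief change deterministic on hidden rounds. -/
lemma Policy.shift_eq_of_observeOne_eq {S : Set (Fin m × Fin n)} {π : Policy m 𝒱}
    (hπ : π.DependsOnlyOn (fun h => observe S h)) {r r' : Response m 𝒱}
    (h : observeOne S r = observeOne S r') : π.shift r = π.shift r' := by
  funext t x
  refine hπ _ _ _ ?_
  simp only [observe_cons, h]

lemma measurable_release (i : Fin m) (j : Fin n) :
    Measurable (Response.release i j : Synopsis 𝒱 j → Response m 𝒱) :=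
  measurable_inr.comp (measurable_sigmaMk (β := fun p : Fin m × Fin n => Synopsis 𝒱 p.2) (i, j))

/-- If the information of a belief system never exceeds `Rm`, what the observer sees is as private
as a Gaussian mechanism with information `Rm`. -/
theorem IsBeliefSystem.lintegral_outProb_le (hM : M.IsMeasurable) {S : Set (Fin m × Fin n)}
    {D D' : Database 𝒮} {Z : Type} [MeasurableSpace Z] {ν : Measure Z} [IsProbabilityMeasure ν]
    {B : Type} {st : Database 𝒮 → B → Z → M.State} {Good : B → Prop} {info : B → ℝ≥0} {Rm : ℝ≥0}
    (hB : IsBeliefSystem M S D D' ν st Good info) (hinfo : ∀ b, Good b → info b ≤ Rm) (T : ℕ)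
    {π : Policy m 𝒱} (hπ : ∀ t, Measurable (π t)) (hπS : π.DependsOnlyOn (fun h => observe S h))
    {O : Set (Fin T → Response m 𝒱)} (hO : MeasurableSet O) {b : B} (hb : Good b) {c : ℝ}
    (hc : 0 ≤ c) :
    ∫⁻ ζ, outProb M S D T π O (st D b ζ) ∂ν ≤
      ENNReal.ofReal c * ∫⁻ ζ, outProb M S D' T π O (st D' b ζ) ∂ν +
        hockeyStick (Rm - info b) c := by
  induction T generalizing π b c with
  | zero =>
    have hconst : ∀ E ζ, outProb M S E 0 π O (st E b ζ) = O.indicator 1 Fin.elim0 := by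
      intro E ζ
      have : ∀ ω, observe S (runFrom M E 0 (st E b ζ) π ω).2 = Fin.elim0 :=
        fun ω => Subsingleton.elim _ _
      simp only [outProb, this]
      by_cases h : (Fin.elim0 : Fin 0 → Response m 𝒱) ∈ O <;> simp [h]
    simp only [hconst, lintegral_const, measure_univ, mul_one]
    by_cases h : (Fin.elim0 : Fin 0 → Response m 𝒱) ∈ O
    · simp only [h, Set.indicator_of_mem, Pi.one_apply, mul_one]
      -- With no rounds left both probabilities equal one, and `1 ≤ c + (1 - c)⁺`, where the last
      -- term is the divergence at zero information.
      calc (1 : ℝ≥0∞) = ENNReal.ofReal (c + (1 - c)) := by simp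
        _ ≤ ENNReal.ofReal c + ENNReal.ofReal (1 - c) := ENNReal.ofReal_add_le
        _ = ENNReal.ofReal c + hockeyStick 0 c := by simp [hockeyStick, gaussianReal_zero_var]
        _ ≤ _ := by gcongr; exact hockeyStick_mono zero_le c
    · simp [h]
  | succ T ih =>
    obtain ⟨ζ₀⟩ := nonempty_of_isProbabilityMeasure ν
    obtain ⟨i, j, ε, hq⟩ : ∃ i j ε, π 0 Fin.elim0 = (i, j, ε) := ⟨_, _, _, rfl⟩
    -- The check depends neither on the database nor on the hidden noise, so a single sample decides
    -- it.
    by_cases hcheck : M.constraintCheck (st D b ζ₀) (i, j, ε)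
    · have hch : ∀ E ζ, M.constraintCheck (st E b ζ) (i, j, ε) :=
        fun E ζ => hB.check _ _ _ _ _ _ hcheck
      by_cases hS : (i, j) ∈ S
      · obtain ⟨b', y, l, h, hl, hlaw, hgood, hD, hD'⟩ := hB.visible b i j ε hb hch hS
        set F : Database 𝒮 → M.State × Synopsis 𝒱 j → ℝ≥0∞ := fun E p =>
          outProb M S E T (π.shift (Response.release i j p.2))
            {x | Fin.cons (α := fun _ => Response m 𝒱) (Response.release i j p.2) x ∈ O} p.1
          with hF
        have hrel : Measurable fun p : M.State × Synopsis 𝒱 j =>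
            (Response.release i j p.2 : Response m 𝒱) := (measurable_release i j).comp measurable_snd
        have hFm : ∀ E, Measurable (F E) := fun E =>
          measurable_outProb hM S E T (p := fun p => π.shift (Response.release i j p.2))
            measurable_fst (measurable_shift hπ hrel)
            (measurableSet_cons hO hrel)
        have hstep : ∀ E, ∫⁻ ζ, outProb M S E (T + 1) π O (st E b ζ) ∂ν =
            ∫⁻ ζ, ∫⁻ z, F E (M.run E z (st E b ζ) (i, j, ε)) ∂drawLaw 𝒱 ∂ν := by
          intro E
          refine lintegral_congr fun ζ => ?_
          rw [outProb_succ_of_check hM S E T hπ hO hq (hch E ζ)]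
          simp only [observeOne_release_of_mem hS, hF]
        rw [hstep, hstep, hD _ (hFm D), hD' _ (hFm D')]
        -- The induction hypothesis is applied at the random level `c * exp (l ξ - h / 2)`, which
        -- absorbs the likelihood ratio between `D'` and `D` of the response just seen.
        have hIH : ∀ ξ, ∫⁻ ζ, F D (st D (b' ξ) ζ, y ξ) ∂ν ≤
            ENNReal.ofReal c * (ENNReal.ofReal (Real.exp (l ξ - h / 2)) *
              ∫⁻ ζ, F D' (st D' (b' ξ) ζ, y ξ) ∂ν) +
            hockeyStick (Rm - info b - h) (c * Real.exp (l ξ - h / 2)) := by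
          intro ξ
          have := ih (measurable_shift_apply hπ (Response.release i j (y ξ)))
            (Policy.shift_dependsOnlyOn hπS (Response.release i j (y ξ)))
            (measurableSet_cons_apply hO (Response.release i j (y ξ)))
            (hgood ξ).1 (c := c * Real.exp (l ξ - h / 2)) (by positivity)
          refine this.trans ?_
          rw [ENNReal.ofReal_mul hc, mul_assoc]
          refine add_le_add le_rfl (hockeyStick_mono ?_ _)
          rw [tsub_tsub]
          exact tsub_le_tsub_left (hgood ξ).2 _
        have hhm : Measurable fun ξ => hockeyStick (Rm - info b - h) (c * Real.exp (l ξ - h / 2)) :=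
          (measurable_hockeyStick _).comp (by fun_prop)
        refine (lintegral_mono hIH).trans ?_
        rw [lintegral_add_right _ hhm, lintegral_const_mul' _ _ ENNReal.ofReal_ne_top]
        gcongr
        have hm2 : Measurable fun w =>
            hockeyStick (Rm - info b - h) (c * Real.exp (w - h / 2)) :=
          (measurable_hockeyStick _).comp (by fun_prop)
        -- Averaging over the response restores the level `c` and gives back the information `h`, by
        -- the semigroup identity.
        rw [← lintegral_map (f := fun w => hockeyStick (Rm - info b - h)
          (c * Real.exp (w - h / 2))) hm2 hl, hlaw, lintegral_hockeyStick]
        refine hockeyStick_mono (le_of_eq ?_) _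
        -- Any one response shows that `info b + h ≤ Rm`; hence the truncated subtraction loses
        -- nothing.
        have h1 := (hgood 0).2.trans (hinfo _ (hgood 0).1)
        exact add_tsub_cancel_of_le (le_tsub_of_add_le_left h1)
      · obtain ⟨b', hgood, hle, hE⟩ := hB.hidden b i j ε hb hch hS
        set F : Database 𝒮 → M.State → ℝ≥0∞ := fun E s =>
          outProb M S E T (π.shift Response.reject)
            {x | Fin.cons (α := fun _ => Response m 𝒱) Response.reject x ∈ O} s with hF
        have hFm : ∀ E, Measurable (F E) := fun E =>
          measurable_outProb hM S E T (p := fun _ => π.shift Response.reject) measurable_id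
            (measurable_shift hπ measurable_const)
            (measurableSet_cons hO measurable_const)
        have hstep : ∀ E, ∫⁻ ζ, outProb M S E (T + 1) π O (st E b ζ) ∂ν =
            ∫⁻ ζ, ∫⁻ z, F E (M.run E z (st E b ζ) (i, j, ε)).1 ∂drawLaw 𝒱 ∂ν := by
          intro E
          refine lintegral_congr fun ζ => ?_
          rw [outProb_succ_of_check hM S E T hπ hO hq (hch E ζ)]
          refine lintegral_congr fun z => ?_
          simp only [observeOne_release_of_notMem hS, hF]
          rw [Policy.shift_eq_of_observeOne_eq hπS (r' := Response.reject)
            (by rw [observeOne_release_of_notMem hS, observeOne_reject])]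
        rw [hstep, hstep, hE _ _ (hFm D), hE _ _ (hFm D')]
        refine (ih (measurable_shift_apply hπ _) (Policy.shift_dependsOnlyOn hπS _)
          (measurableSet_cons_apply hO _) hgood hc).trans ?_
        exact add_le_add le_rfl (hockeyStick_mono (tsub_le_tsub_left hle _) _)
    · have hch : ∀ E ζ, ¬ M.constraintCheck (st E b ζ) (π 0 Fin.elim0) := fun E ζ h =>
        hcheck (hB.check _ _ _ _ _ _ (hq ▸ h))
      simp only [fun E ζ => outProb_succ_of_not_check hM S E T hπ hO (hch E ζ)]
      exact ih (measurable_shift_apply hπ _) (Policy.shift_dependsOnlyOn hπS _)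
          (measurableSet_cons_apply hO _) hb hc

end Filter

/-! ### Histogram views of neighbouring databases -/

section Views

variable {𝒮 : Schema}

/-- The vectors `u` and `u'` agree, or differ by one in one coordinate. -/
def UnitShift {ι : Type*} (u u' : ι → ℝ) : Prop :=
  u' = u ∨ ∃ (b : ι) (t : ℝ), t ^ 2 = 1 ∧ u' b = u b + t ∧ ∀ x, x ≠ b → u' x = u x

lemma UnitShift.symm {ι : Type*} {u u' : ι → ℝ} (h : UnitShift u u') : UnitShift u' u := by
  rcases h with h | ⟨b, t, ht, hb, hx⟩
  · exact Or.inl h.symm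
  · exact Or.inr ⟨b, -t, by rw [neg_sq, ht], by linarith, fun x h => (hx x h).symm⟩

/-- A tuple of the relation of `V` lies in exactly one bin, given by its restricted attribute
values; a tuple of another relation lies in none. -/
lemma HistView.unitShift_cons (V : HistView 𝒮) (t : Tuple 𝒮) (D : Database 𝒮) :
    UnitShift (V.eval D) (V.eval (t ::ₘ D)) := by
  classical
  obtain ⟨r, t⟩ := t
  by_cases hr : r = V.rel
  · subst hr
    refine Or.inr ⟨fun a => t a, 1, one_pow 2, ?_, fun x hx => ?_⟩
    · simp only [HistView.eval]
      rw [Multiset.countP_cons_of_pos _ ⟨t, rfl, fun a => rfl⟩]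
      push_cast
      ring
    · simp only [HistView.eval]
      rw [Multiset.countP_cons_of_neg]
      rintro ⟨t', ht', hx'⟩
      refine hx (funext fun a => ?_)
      obtain rfl : t = t' := by simpa using ht'
      exact (hx' a).symm
  · left
    funext b
    simp only [HistView.eval]
    rw [Multiset.countP_cons_of_neg]
    rintro ⟨t', ht', -⟩
    exact hr (congrArg Sigma.fst ht')

lemma Neighbour.unitShift {D D' : Database 𝒮} (h : Neighbour D D') (V : HistView 𝒮) :
    UnitShift (V.eval D) (V.eval D') := by
  obtain ⟨t, rfl | rfl⟩ := h
  · exact V.unitShift_cons t D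
  · exact (V.unitShift_cons t D').symm

/-- The laws of Gaussian vectors whose means differ by `α` in one coordinate have a log-likelihood
ratio that is again Gaussian. -/
lemma UnitShift.exists_logLikelihood {ι : Type*} [Fintype ι] {u u' : ι → ℝ} (hu : UnitShift u u')
    (a : ι → ℝ) {α s : ℝ} (hs : α ≠ 0 → s ≠ 0) :
    ∃ (l : (ι → ℝ) → ℝ) (h : ℝ≥0), Measurable l ∧ (stdGauss ι).map l = gaussianReal 0 h ∧
      (h : ℝ) ≤ α ^ 2 / s ^ 2 ∧ ∀ F : (ι → ℝ) → ℝ≥0∞, Measurable F →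
        ∫⁻ ξ, F (a + α • u' + s • ξ) ∂stdGauss ι =
          ∫⁻ ξ, ENNReal.ofReal (Real.exp (l ξ - h / 2)) * F (a + α • u + s • ξ) ∂stdGauss ι := by
  classical
  -- If the means coincide, the likelihood ratio is one and carries no information. This includes `α
  -- = 0`, where the noise may vanish.
  have htriv : α • u' = α • u → ∃ (l : (ι → ℝ) → ℝ) (h : ℝ≥0), Measurable l ∧
      (stdGauss ι).map l = gaussianReal 0 h ∧
      (h : ℝ) ≤ α ^ 2 / s ^ 2 ∧ ∀ F : (ι → ℝ) → ℝ≥0∞, Measurable F →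
        ∫⁻ ξ, F (a + α • u' + s • ξ) ∂stdGauss ι =
          ∫⁻ ξ, ENNReal.ofReal (Real.exp (l ξ - h / 2)) * F (a + α • u + s • ξ) ∂stdGauss ι := by
    intro h
    refine ⟨fun _ => 0, 0, measurable_const, ?_, by simp; positivity, fun F _ => ?_⟩
    · rw [Measure.map_const, gaussianReal_zero_var]
      simp
    · simp [h]
  by_cases hα : α = 0
  · exact htriv (by simp [hα])
  rcases hu with h | ⟨b, t, ht, hb, hx⟩
  · exact htriv (by rw [h])
  have hs0 := hs hα
  -- In units of the noise, the means differ by `α * t / s` in bin `b`; as `t ^ 2 = 1`, the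
  -- information is `α ^ 2 / s ^ 2`.
  refine ⟨fun ξ => α * t / s * ξ b, Real.toNNReal ((α * t / s) ^ 2), by fun_prop,
    map_mul_eval_stdGauss b _, ?_, fun F hF => ?_⟩
  · rw [Real.coe_toNNReal _ (sq_nonneg _), div_pow, mul_pow, ht, mul_one]
  · rw [Real.coe_toNNReal _ (sq_nonneg _), ← lintegral_stdGauss_add_single b
      (α * t / s) (f := fun ξ => F (a + α • u + s • ξ)) (by fun_prop)]
    refine lintegral_congr fun ξ => ?_
    congr 1
    ext x
    simp only [Pi.add_apply, Pi.smul_apply, smul_eq_mul]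
    by_cases hxb : x = b
    · subst hxb
      rw [hb, Pi.single_eq_same]
      field_simp
      ring
    · rw [hx x hxb, Pi.single_eq_of_ne hxb, add_zero]

end Views

/-! ### Integrals over one round's draw and measurability in the request -/

section Draws

variable {𝒮 : Schema} {m n : ℕ} {𝒱 : Fin n → HistView 𝒮}

lemma lintegral_drawLaw (j : Fin n) {f : Synopsis 𝒱 j × Synopsis 𝒱 j → ℝ≥0∞} (hf : Measurable f) :
    ∫⁻ z, f (z.1 j, z.2 j) ∂drawLaw 𝒱 =
      ∫⁻ x, ∫⁻ y, f (x, y) ∂stdGauss (𝒱 j).Bin ∂stdGauss (𝒱 j).Bin := by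
  have h := (measurePreserving_eval (fun l : Fin n => stdGauss (𝒱 l).Bin) j).prod
    (measurePreserving_eval (fun l : Fin n => stdGauss (𝒱 l).Bin) j)
  rw [← lintegral_prod _ hf.aemeasurable, ← h.lintegral_comp hf]
  rfl

lemma lintegral_drawLaw_fst (j : Fin n) {f : Synopsis 𝒱 j → ℝ≥0∞} (hf : Measurable f) :
    ∫⁻ z, f (z.1 j) ∂drawLaw 𝒱 = ∫⁻ x, f x ∂stdGauss (𝒱 j).Bin := by
  rw [lintegral_drawLaw j (f := fun p => f p.1) (by fun_prop)]
  simp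

/-- The analyst and the view range over a finite discrete set, so only the budget matters. -/
lemma measurable_of_request {X Y : Type*} [MeasurableSpace X] [MeasurableSpace Y]
    {f : X × Request m n → Y} (hf : ∀ i j, Measurable fun p : X × ℝ => f (p.1, (i, j, p.2))) :
    Measurable f := by
  have h : Measurable fun p : (X × ℝ) × (Fin m × Fin n) => f (p.1.1, (p.2.1, p.2.2, p.1.2)) :=
    measurable_from_prod_countable_left fun q => hf q.1 q.2
  exact h.comp (f := fun p : X × Request m n => ((p.1, p.2.2.2), (p.2.1, p.2.2.1))) (by fun_prop)

lemma measurableSet_of_request {X : Type*} [MeasurableSpace X] {A : Set (X × Request m n)}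
    (hA : ∀ i j, MeasurableSet {p : X × ℝ | (p.1, ((i, j, p.2) : Request m n)) ∈ A}) :
    MeasurableSet A := by
  have : Measurable fun p => p ∈ A :=
    measurable_of_request fun i j => measurableSet_setOfPred.1 (hA i j)
  exact measurableSet_setOfPred.2 this

end Draws

lemma isDP_of_one_le {𝒮 : Schema} {Ω O : Type*} [MeasurableSpace Ω] [MeasurableSpace O]
    {μ : Measure Ω} [IsProbabilityMeasure μ] {ε δ : ℝ} (hδ : 1 ≤ δ) (M : Database 𝒮 → Ω → O) :
    IsDP μ M ε δ := fun _ _ _ _ _ =>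
  prob_le_one.trans ((ENNReal.one_le_ofReal.2 hδ).trans le_add_self)

/-- A belief system that starts at the initial state and whose information stays below that of a
private Gaussian mechanism shows differential privacy. -/
theorem isDP_of_isBeliefSystem {𝒮 : Schema} {m n : ℕ} {𝒱 : Fin n → HistView 𝒮}
    {M : Mechanism m 𝒱} [MeasurableSpace M.State] (hM : M.IsMeasurable) {S : Set (Fin m × Fin n)}
    {Z : Type} [MeasurableSpace Z] {ν : Measure Z} [IsProbabilityMeasure ν]
    {B : Type} {st : Database 𝒮 → B → Z → M.State} {Good : B → Prop} {info : B → ℝ≥0} {Rm : ℝ≥0}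
    (hB : ∀ D D', Neighbour D D' → IsBeliefSystem M S D D' ν st Good info)
    (hinfo : ∀ b, Good b → info b ≤ Rm) {b₀ : B} (hb₀ : Good b₀) (hst : ∀ E ζ, st E b₀ ζ = M.init)
    {ψ δ : ℝ} (hRm : hockeyStick Rm (Real.exp ψ) ≤ ENNReal.ofReal δ) {T : ℕ}
    {π : Policy m 𝒱} (hπ : ∀ t, Measurable (π t)) (hπS : π.DependsOnlyOn (fun h => observe S h)) :
    IsDP (noiseLaw 𝒱 T) (fun D ω => observe S (transcript M π T D ω)) ψ δ := by
  intro D D' hDD' O hO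
  have h := (hB D D' hDD').lintegral_outProb_le hM hinfo T hπ hπS hO hb₀ (Real.exp_nonneg ψ)
  simp only [hst, lintegral_const, measure_univ, mul_one, outProb, ← exec_eq_runFrom] at h
  exact h.trans (add_le_add le_rfl ((hockeyStick_mono tsub_le_self _).trans hRm))

/-! ### The vanilla approach -/

section Vanilla

variable {𝒮 : Schema} {m n : ℕ} {𝒱 : Fin n → HistView 𝒮}

instance : MeasurableSpace (VanillaState m n) :=
  MeasurableSpace.comap (fun s => (s.P, s.N)) inferInstance

lemma measurable_vanillaState : Measurable fun s : VanillaState m n => (s.P, s.N) :=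
  comap_measurable _

lemma VanillaState.measurable_P (i : Fin m) (j : Fin n) :
    Measurable fun s : VanillaState m n => s.P i j :=
  (measurable_pi_apply j).comp ((measurable_pi_apply i).comp
    (measurable_fst.comp measurable_vanillaState))

lemma VanillaState.measurable_N (i : Fin m) (j : Fin n) :
    Measurable fun s : VanillaState m n => s.N i j :=
  (measurable_pi_apply j).comp ((measurable_pi_apply i).comp
    (measurable_snd.comp measurable_vanillaState))

instance (Ψ : Constraints m n) (δ₀ : ℝ) : MeasurableSpace (vanilla 𝒱 Ψ δ₀).State :=
  inferInstanceAs (MeasurableSpace (VanillaState m n))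

lemma measurableSet_and {X : Type*} [MeasurableSpace X] {p q : X → Prop}
    (hp : MeasurableSet {x | p x}) (hq : MeasurableSet {x | q x}) :
    MeasurableSet {x | p x ∧ q x} := hp.inter hq

lemma measurable_update_matrix {X α : Type*} [MeasurableSpace X] [MeasurableSpace α]
    {f : X → Fin m → Fin n → α} (hf : ∀ a v, Measurable fun x => f x a v) (i : Fin m) (j : Fin n)
    {g : X → α} (hg : Measurable g) :
    Measurable fun x => Function.update (f x) i (Function.update (f x i) j (g x)) := by
  refine measurable_pi_iff.2 fun a => measurable_pi_iff.2 fun v => ?_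
  by_cases ha : a = i
  · subst ha
    by_cases hv : v = j
    · subst hv; simpa using hg
    · simpa [hv] using hf a v
  · simpa [ha] using hf a v

lemma vanilla_isMeasurable (Ψ : Constraints m n) {δ₀ : ℝ} (hδ₀ : 0 ≤ δ₀) :
    (vanilla 𝒱 Ψ δ₀).IsMeasurable where
  check := by
    refine measurableSet_of_request fun i j => ?_
    have hP : ∀ a v, Measurable fun p : VanillaState m n × ℝ => p.1.P a v :=
      fun a v => (VanillaState.measurable_P a v).comp measurable_fst
    have hN : ∀ a v, Measurable fun p : VanillaState m n × ℝ => (p.1.N a v : ℝ) :=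
      fun a v => measurable_from_top.comp ((VanillaState.measurable_N a v).comp measurable_fst)
    change MeasurableSet {p : VanillaState m n × ℝ | 0 < p.2 ∧
      (∑ a, ∑ v, p.1.P a v) + p.2 ≤ Ψ.ψP ∧ (∑ v, p.1.P i v) + p.2 ≤ Ψ.ψA i ∧
      (∑ a, p.1.P a j) + p.2 ≤ Ψ.ψV j ∧ ((∑ a, ∑ v, p.1.N a v : ℕ) + 1) * δ₀ ≤ Ψ.δP ∧
      ((∑ v, p.1.N i v : ℕ) + 1) * δ₀ ≤ Ψ.δA i ∧ ((∑ a, p.1.N a j : ℕ) + 1) * δ₀ ≤ Ψ.δV j}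
    push_cast
    refine measurableSet_and (measurableSet_lt measurable_const measurable_snd)
      (measurableSet_and (measurableSet_le ?_ measurable_const)
      (measurableSet_and (measurableSet_le ?_ measurable_const)
      (measurableSet_and (measurableSet_le ?_ measurable_const)
      (measurableSet_and (measurableSet_le ?_ measurable_const)
      (measurableSet_and (measurableSet_le ?_ measurable_const)
      (measurableSet_le ?_ measurable_const)))))) <;> fun_prop
  run := fun D => by
    have key : ∀ i j, Measurable fun p : (Draw 𝒱 × VanillaState m n) × ℝ =>
        (((vanilla 𝒱 Ψ δ₀).run D p.1.1 p.1.2 (i, j, p.2)).1,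
          (Response.release i j ((vanilla 𝒱 Ψ δ₀).run D p.1.1 p.1.2 (i, j, p.2)).2 :
            Response m 𝒱)) := by
      intro i j
      have hP : ∀ a v, Measurable fun p : (Draw 𝒱 × VanillaState m n) × ℝ => p.1.2.P a v :=
        fun a v => (VanillaState.measurable_P a v).comp (measurable_snd.comp measurable_fst)
      have hN : ∀ a v, Measurable fun p : (Draw 𝒱 × VanillaState m n) × ℝ => p.1.2.N a v :=
        fun a v => (VanillaState.measurable_N a v).comp (measurable_snd.comp measurable_fst)
      refine Measurable.prodMk ?_ ((measurable_release i j).comp ?_)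
      · refine measurable_comap_iff.2 (Measurable.prodMk ?_ ?_)
        · exact measurable_update_matrix hP i j ((hP i j).add measurable_snd)
        · exact measurable_update_matrix hN i j ((hN i j).add measurable_const)
      · refine measurable_const.add (Measurable.smul
          ((measurable_analyticGM hδ₀).comp measurable_snd) ?_)
        exact (measurable_pi_apply j).comp (measurable_fst.comp (measurable_fst.comp measurable_fst))
    exact (measurable_of_request (X := Draw 𝒱 × VanillaState m n) (f := fun p =>
      (((vanilla 𝒱 Ψ δ₀).run D p.1.1 p.1.2 p.2).1,
        (Response.release p.2.1 p.2.2.1 ((vanilla 𝒱 Ψ δ₀).run D p.1.1 p.1.2 p.2).2 :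
          Response m 𝒱))) key).comp
      (f := fun p : Draw 𝒱 × VanillaState m n × Request m n => ((p.1, p.2.1), p.2.2)) (by fun_prop)

/-! ### The vanilla approach: losses at observed positions and privacy -/

open Classical in
/-- The sum of the entries of a matrix at the positions in `S`. -/
noncomputable def sumOn {α : Type*} [AddCommMonoid α] (S : Set (Fin m × Fin n))
    (f : Fin m → Fin n → α) : α := ∑ p : Fin m × Fin n with p ∈ S, f p.1 p.2

section

variable {α : Type*} [AddCommMonoid α]

lemma update_update_add_apply (f : Fin m → Fin n → α) (i : Fin m) (j : Fin n) (x : α)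
    (p : Fin m × Fin n) :
    Function.update f i (Function.update (f i) j (f i j + x)) p.1 p.2 =
      f p.1 p.2 + if p = (i, j) then x else 0 := by
  obtain ⟨a, v⟩ := p
  by_cases ha : a = i
  · subst ha
    by_cases hv : v = j
    · subst hv; simp
    · simp [hv]
  · simp [ha]

lemma sumOn_update_of_mem {S : Set (Fin m × Fin n)} (f : Fin m → Fin n → α) {i : Fin m} {j : Fin n}
    (h : (i, j) ∈ S) (x : α) :
    sumOn S (Function.update f i (Function.update (f i) j (f i j + x))) = sumOn S f + x := by
  simp only [sumOn, update_update_add_apply, Finset.sum_add_distrib]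
  simp [h]

lemma sumOn_update_of_notMem {S : Set (Fin m × Fin n)} (f : Fin m → Fin n → α) {i : Fin m}
    {j : Fin n} (h : (i, j) ∉ S) (x : α) :
    sumOn S (Function.update f i (Function.update (f i) j (f i j + x))) = sumOn S f := by
  simp only [sumOn, update_update_add_apply, Finset.sum_add_distrib]
  simp [h]

lemma sumOn_univ (f : Fin m → Fin n → α) : sumOn Set.univ f = ∑ a, ∑ v, f a v := by
  simp [sumOn, Fintype.sum_prod_type]

lemma sumOn_row (f : Fin m → Fin n → α) (i : Fin m) : sumOn {p | p.1 = i} f = ∑ v, f i v := by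
  simp only [sumOn, Set.mem_ofPred_eq, Finset.sum_filter, Fintype.sum_prod_type]
  rw [Finset.sum_comm]
  simp

lemma sumOn_column (f : Fin m → Fin n → α) (j : Fin n) : sumOn {p | p.2 = j} f = ∑ a, f a j := by
  simp only [sumOn, Set.mem_ofPred_eq, Finset.sum_filter, Fintype.sum_prod_type]
  simp

end

/-- Invariant of the vanilla approach: `R` is the information of the synopses released at the
positions in `S`. -/
structure VanillaGood (δ₀ : ℝ) (S : Set (Fin m × Fin n)) (Rm : ℝ≥0)
    (b : VanillaState m n × ℝ≥0) : Prop where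
  nonneg : ∀ a v, 0 ≤ b.1.P a v
  private_bound : hockeyStick b.2 (Real.exp (sumOn S b.1.P)) ≤ ENNReal.ofReal (sumOn S b.1.N * δ₀)
  le_max : b.2 ≤ Rm

/-- Nothing is hidden here, so the noise law is a point mass and a belief is the table together with
the accumulated information. A visible synopsis is credited with `1 / σ(ε)²`, which is `(ε,
δ₀)`-private by the choice of `σ`; sequential composition matches this with the increase of the two
sums over `S`. -/
theorem vanilla_isBeliefSystem {Ψ : Constraints m n} {δ₀ : ℝ} (hδ₀ : 0 < δ₀) (hδ₀' : δ₀ < 1)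
    {S : Set (Fin m × Fin n)} {ψ δ : ℝ} {Rm : ℝ≥0}
    (hψ : ∀ (s : VanillaState m n) i j ε, (∀ a v, 0 ≤ s.P a v) →
      (vanilla 𝒱 Ψ δ₀).constraintCheck s (i, j, ε) → (i, j) ∈ S →
        sumOn S s.P + ε ≤ ψ ∧ ((sumOn S s.N : ℕ) + 1) * δ₀ ≤ δ)
    (hRm : ∀ R, hockeyStick R (Real.exp ψ) ≤ ENNReal.ofReal δ → R ≤ Rm)
    {D D' : Database 𝒮} (hDD' : Neighbour D D') :
    IsBeliefSystem (vanilla 𝒱 Ψ δ₀) S D D' (Measure.dirac ())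
      (fun _ (b : VanillaState m n × ℝ≥0) _ => b.1) (VanillaGood δ₀ S Rm) Prod.snd where
  check := fun _ _ _ _ _ _ h => h
  hidden := fun b i j ε hb hch hS => by
    have hε : 0 < ε := (hch 0 ()).1
    refine ⟨(((vanilla 𝒱 Ψ δ₀).run 0 0 b.1 (i, j, ε)).1, b.2), ⟨fun a v => ?_, ?_, hb.le_max⟩,
      le_rfl, fun E F hF => by simp [vanilla]⟩
    · simp only [vanilla]
      rw [update_update_add_apply b.1.P i j ε (a, v)]
      have := hb.nonneg a v
      split_ifs <;> linarith
    · simp only [vanilla]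
      rw [sumOn_update_of_notMem _ hS, sumOn_update_of_notMem _ hS]
      exact hb.private_bound
  visible := fun b i j ε hb hch hS => by
    have hε : 0 < ε := (hch 0 ()).1
    have hσ : 0 < analyticGM ε δ₀ 1 := analyticGM_pos hε.le hδ₀ hδ₀'
    obtain ⟨l, h, hl, hlaw, hh, hF⟩ := (hDD'.unitShift (𝒱 j)).exists_logLikelihood 0 (α := 1)
      (s := analyticGM ε δ₀ 1) (fun _ => hσ.ne')
    simp only [zero_add, one_smul, one_pow, one_div] at hF hh
    set R' := b.2 + Real.toNNReal (analyticGM ε δ₀ 1 ^ 2)⁻¹ with hR'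
    set s' := ((vanilla 𝒱 Ψ δ₀).run 0 0 b.1 (i, j, ε)).1 with hs'
    have hbound : hockeyStick R' (Real.exp (sumOn S b.1.P + ε)) ≤
        ENNReal.ofReal (((sumOn S b.1.N : ℕ) + 1) * δ₀) := by
      rw [add_mul, one_mul]
      exact hockeyStick_add_exp_le (by positivity) hδ₀.le hb.private_bound
        (hockeyStick_analyticGM hε.le hδ₀ hδ₀')
    obtain ⟨hψ1, hψ2⟩ := hψ b.1 i j ε hb.nonneg (hch 0 ()) hS
    refine ⟨fun _ => (s', R'), fun ξ => (𝒱 j).eval D + analyticGM ε δ₀ 1 • ξ, l, h, hl, hlaw,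
      fun ξ => ⟨⟨fun a v => ?_, ?_, hRm _ ?_⟩, ?_⟩, fun F hFm => ?_, fun F hFm => ?_⟩
    · simp only [hs', vanilla]
      rw [update_update_add_apply b.1.P i j ε (a, v)]
      have := hb.nonneg a v
      split_ifs <;> linarith
    · simp only [hs', vanilla]
      rw [sumOn_update_of_mem _ hS, sumOn_update_of_mem _ hS]
      exact_mod_cast hbound
    · exact (hockeyStick_anti _ (Real.exp_le_exp.2 hψ1)).trans
        (hbound.trans (ENNReal.ofReal_le_ofReal hψ2))
    · simp only [hR']
      gcongr
      rwa [Real.le_toNNReal_iff_coe_le (by positivity)]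
    · have hFm' : Measurable fun y => F (s', y) := hFm.comp measurable_prodMk_left
      simp only [lintegral_dirac]
      exact lintegral_drawLaw_fst j (f := fun x => F (s', (𝒱 j).eval D + analyticGM ε δ₀ 1 • x))
        (by fun_prop)
    · have hFm' : Measurable fun y => F (s', y) := hFm.comp measurable_prodMk_left
      simp only [lintegral_dirac]
      rw [← hF (fun y => F (s', y)) hFm']
      exact lintegral_drawLaw_fst j (f := fun x => F (s', (𝒱 j).eval D' + analyticGM ε δ₀ 1 • x))
        (by fun_prop)

/-- Privacy of the vanilla approach towards an observer of the positions in `S`, if every accepted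
request at such a position keeps the total loss at these positions within `(ψ, δ)`. -/
theorem vanilla_isDP {Ψ : Constraints m n} {δ₀ : ℝ} (hδ₀ : 0 < δ₀) (hδ₀' : δ₀ < 1)
    {S : Set (Fin m × Fin n)} {ψ δ : ℝ} (hψ0 : 0 ≤ ψ)
    (hψ : ∀ (s : VanillaState m n) i j ε, (∀ a v, 0 ≤ s.P a v) →
      (vanilla 𝒱 Ψ δ₀).constraintCheck s (i, j, ε) → (i, j) ∈ S →
        sumOn S s.P + ε ≤ ψ ∧ ((sumOn S s.N : ℕ) + 1) * δ₀ ≤ δ) {T : ℕ}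
    {π : Policy m 𝒱} (hπ : ∀ t, Measurable (π t)) (hπS : π.DependsOnlyOn (fun h => observe S h)) :
    IsDP (noiseLaw 𝒱 T) (fun D ω => observe S (transcript (vanilla 𝒱 Ψ δ₀) π T D ω)) ψ δ := by
  -- A largest admissible information exists only for `δ < 1`; for `δ ≥ 1` privacy is trivial.
  rcases lt_or_ge δ 1 with hδ | hδ
  · obtain ⟨Rm, hRm⟩ := exists_maximal_information (Real.one_le_exp hψ0) hδ
    exact isDP_of_isBeliefSystem (vanilla_isMeasurable Ψ hδ₀.le)
      (fun D D' h => vanilla_isBeliefSystem hδ₀ hδ₀' hψ (fun R => (hRm R).1) h)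
      (fun b hb => hb.le_max) (b₀ := (⟨fun _ _ => 0, fun _ _ => 0⟩, 0))
      ⟨fun _ _ => le_rfl, by simp [sumOn, hockeyStick_zero], zero_le⟩ (fun _ _ => rfl)
      ((hRm Rm).2 le_rfl) hπ hπS
  · exact isDP_of_one_le hδ _

end Vanilla

/-! ### The additive Gaussian approach: measurability -/

section AdditiveMeasurable

variable {𝒮 : Schema} {m n : ℕ} {𝒱 : Fin n → HistView 𝒮}

namespace AdditiveState

instance : MeasurableSpace (AdditiveState m 𝒱) :=
  MeasurableSpace.comap (fun s => (s.P, s.N, s.ε, s.k, s.v, s.G)) inferInstance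

lemma measurable_components :
    Measurable fun s : AdditiveState m 𝒱 => (s.P, s.N, s.ε, s.k, s.v, s.G) :=
  comap_measurable _

@[fun_prop]
lemma measurable_P : Measurable fun s : AdditiveState m 𝒱 => s.P :=
  measurable_fst.comp measurable_components

@[fun_prop]
lemma measurable_N : Measurable fun s : AdditiveState m 𝒱 => s.N :=
  (by fun_prop : Measurable fun p : (Fin m → Fin n → ℝ) × (Fin m → Fin n → ℕ) × (Fin n → ℝ) ×
    (Fin n → ℕ) × (Fin n → ℝ) × ((j : Fin n) → Synopsis 𝒱 j) => p.2.1).comp measurable_components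

@[fun_prop]
lemma measurable_ε : Measurable fun s : AdditiveState m 𝒱 => s.ε :=
  (by fun_prop : Measurable fun p : (Fin m → Fin n → ℝ) × (Fin m → Fin n → ℕ) × (Fin n → ℝ) ×
    (Fin n → ℕ) × (Fin n → ℝ) × ((j : Fin n) → Synopsis 𝒱 j) => p.2.2.1).comp measurable_components

@[fun_prop]
lemma measurable_k : Measurable fun s : AdditiveState m 𝒱 => s.k :=
  (by fun_prop : Measurable fun p : (Fin m → Fin n → ℝ) × (Fin m → Fin n → ℕ) × (Fin n → ℝ) ×
    (Fin n → ℕ) × (Fin n → ℝ) × ((j : Fin n) → Synopsis 𝒱 j) => p.2.2.2.1).comp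
      measurable_components

@[fun_prop]
lemma measurable_v : Measurable fun s : AdditiveState m 𝒱 => s.v :=
  (by fun_prop : Measurable fun p : (Fin m → Fin n → ℝ) × (Fin m → Fin n → ℕ) × (Fin n → ℝ) ×
    (Fin n → ℕ) × (Fin n → ℝ) × ((j : Fin n) → Synopsis 𝒱 j) => p.2.2.2.2.1).comp
      measurable_components

@[fun_prop]
lemma measurable_G : Measurable fun s : AdditiveState m 𝒱 => s.G :=
  (by fun_prop : Measurable fun p : (Fin m → Fin n → ℝ) × (Fin m → Fin n → ℕ) × (Fin n → ℝ) ×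
    (Fin n → ℕ) × (Fin n → ℝ) × ((j : Fin n) → Synopsis 𝒱 j) => p.2.2.2.2.2).comp
      measurable_components

lemma measurable_mk {X : Type*} [MeasurableSpace X] {P : X → Fin m → Fin n → ℝ}
    {N : X → Fin m → Fin n → ℕ} {ε : X → Fin n → ℝ} {k : X → Fin n → ℕ} {v : X → Fin n → ℝ}
    {G : X → (j : Fin n) → Synopsis 𝒱 j} (hP : Measurable P) (hN : Measurable N)
    (hε : Measurable ε) (hk : Measurable k) (hv : Measurable v) (hG : Measurable G) :
    Measurable fun x => (⟨P x, N x, ε x, k x, v x, G x⟩ : AdditiveState m 𝒱) :=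
  measurable_comap_iff.2 (hP.prodMk (hN.prodMk (hε.prodMk (hk.prodMk (hv.prodMk hG)))))

variable {X : Type*} [MeasurableSpace X] {s : X → AdditiveState m 𝒱} {e : X → ℝ}

lemma measurable_newBudget (hs : Measurable s) (he : Measurable e) (j : Fin n) :
    Measurable fun x => (s x).newBudget j (e x) := by
  unfold newBudget
  exact ((measurable_pi_apply j).comp (measurable_ε.comp hs)).max he

lemma measurableSet_budget_lt (hs : Measurable s) (he : Measurable e) (j : Fin n) :
    MeasurableSet {x | (s x).ε j < e x} :=
  measurableSet_lt ((measurable_pi_apply j).comp (measurable_ε.comp hs)) he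

lemma measurable_newCount (hs : Measurable s) (he : Measurable e) (j : Fin n) :
    Measurable fun x => (s x).newCount j (e x) := by
  have hk : Measurable fun x => (s x).k j := (measurable_pi_apply j).comp (measurable_k.comp hs)
  exact Measurable.ite (measurableSet_budget_lt hs he j) (hk.add measurable_const) hk

lemma measurable_newP (hs : Measurable s) (he : Measurable e) (i : Fin m) (j : Fin n) :
    Measurable fun x => (s x).newP i j (e x) := by
  have hP : Measurable fun x => (s x).P i j :=
    (measurable_pi_apply j).comp ((measurable_pi_apply i).comp (measurable_P.comp hs))
  exact (measurable_newBudget hs he j).min (hP.add he)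

lemma measurable_newN (hs : Measurable s) (he : Measurable e) (i : Fin m) (j : Fin n) :
    Measurable fun x => (s x).newN i j (e x) := by
  have hP : Measurable fun x => (s x).P i j :=
    (measurable_pi_apply j).comp ((measurable_pi_apply i).comp (measurable_P.comp hs))
  have hN : Measurable fun x => (s x).N i j :=
    (measurable_pi_apply j).comp ((measurable_pi_apply i).comp (measurable_N.comp hs))
  exact Measurable.ite (measurableSet_le (measurable_newBudget hs he j) (hP.add he))
    (measurable_newCount hs he j) (hN.add measurable_const)

lemma measurable_missingNoise {δ₀ : ℝ} (hδ₀ : 0 ≤ δ₀) (hs : Measurable s) (he : Measurable e)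
    (j : Fin n) : Measurable fun x => analyticGM (e x - (s x).ε j) δ₀ 1 :=
  (measurable_analyticGM hδ₀).comp
    (he.sub ((measurable_pi_apply j).comp (measurable_ε.comp hs)))

lemma measurable_weight {δ₀ : ℝ} (hδ₀ : 0 ≤ δ₀) (hs : Measurable s) (he : Measurable e)
    (j : Fin n) : Measurable fun x => (s x).weight δ₀ j (e x) := by
  have hk : Measurable fun x => (s x).k j := (measurable_pi_apply j).comp (measurable_k.comp hs)
  have hv : Measurable fun x => (s x).v j := (measurable_pi_apply j).comp (measurable_v.comp hs)
  exact Measurable.ite (hk (measurableSet_singleton 0)) measurable_const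
    (hv.div (((measurable_missingNoise hδ₀ hs he j).pow_const 2).add hv))

lemma measurable_newVar {δ₀ : ℝ} (hδ₀ : 0 ≤ δ₀) (hs : Measurable s) (he : Measurable e)
    (j : Fin n) : Measurable fun x => (s x).newVar δ₀ j (e x) := by
  have hv : Measurable fun x => (s x).v j := (measurable_pi_apply j).comp (measurable_v.comp hs)
  have hw := measurable_weight hδ₀ hs he j
  exact Measurable.ite (measurableSet_budget_lt hs he j)
    ((((measurable_const.sub hw).pow_const 2).mul hv).add
      ((hw.pow_const 2).mul ((measurable_missingNoise hδ₀ hs he j).pow_const 2))) hv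

lemma measurable_newGlobal {δ₀ : ℝ} (hδ₀ : 0 ≤ δ₀) (D : Database 𝒮) (hs : Measurable s)
    (he : Measurable e) (j : Fin n) {ξ : X → Synopsis 𝒱 j} (hξ : Measurable ξ) :
    Measurable fun x => (s x).newGlobal δ₀ D j (e x) (ξ x) := by
  have hG : Measurable fun x => (s x).G j := (measurable_pi_apply j).comp (measurable_G.comp hs)
  have hw := measurable_weight hδ₀ hs he j
  exact Measurable.ite (measurableSet_budget_lt hs he j)
    (((measurable_const.sub hw).smul hG).add
      (hw.smul (measurable_const.add ((measurable_missingNoise hδ₀ hs he j).smul hξ)))) hG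

lemma measurable_localVar {δ₀ : ℝ} (hδ₀ : 0 ≤ δ₀) (hs : Measurable s) (he : Measurable e)
    (j : Fin n) : Measurable fun x => (s x).localVar δ₀ j (e x) :=
  (((measurable_analyticGM hδ₀).comp he).pow_const 2).sub ((measurable_newVar hδ₀ hs he j).min
    (((measurable_analyticGM hδ₀).comp (measurable_newBudget hs he j)).pow_const 2))

end AdditiveState

instance (Ψ : Constraints m n) (δ₀ : ℝ) : MeasurableSpace (additiveGaussian 𝒱 Ψ δ₀).State :=
  inferInstanceAs (MeasurableSpace (AdditiveState m 𝒱))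

lemma measurable_update_apply {X : Type*} [MeasurableSpace X] {α : Fin n → Type*}
    [∀ j, MeasurableSpace (α j)] {f : X → (j : Fin n) → α j} (hf : Measurable f) (j : Fin n)
    {g : X → α j} (hg : Measurable g) : Measurable fun x => Function.update (f x) j (g x) :=
  measurable_update'.comp (hf.prodMk hg)

lemma additiveGaussian_isMeasurable (Ψ : Constraints m n) {δ₀ : ℝ} (hδ₀ : 0 ≤ δ₀) :
    (additiveGaussian 𝒱 Ψ δ₀).IsMeasurable where
  check := by
    refine measurableSet_of_request fun i j => ?_
    change MeasurableSet {p : AdditiveState m 𝒱 × ℝ | 0 < p.2 ∧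
      (⨆ a, p.1.P a j) + (p.1.newP i j p.2 - p.1.P i j) ≤ Ψ.ψV j ∧
      (∑ v, ⨆ a, p.1.P a v) + (p.1.newP i j p.2 - p.1.P i j) ≤ Ψ.ψP ∧
      (∑ v, p.1.P i v) + (p.1.newP i j p.2 - p.1.P i j) ≤ Ψ.ψA i ∧
      p.1.newCount j p.2 * δ₀ ≤ Ψ.δV j ∧
      (∑ v, Function.update p.1.k j (p.1.newCount j p.2) v : ℕ) * δ₀ ≤ Ψ.δP ∧
      (∑ v, Function.update (p.1.N i) j (p.1.newN i j p.2) v : ℕ) * δ₀ ≤ Ψ.δA i}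
    have hs : Measurable fun p : AdditiveState m 𝒱 × ℝ => p.1 := measurable_fst
    have he : Measurable fun p : AdditiveState m 𝒱 × ℝ => p.2 := measurable_snd
    have hP : ∀ a v, Measurable fun p : AdditiveState m 𝒱 × ℝ => p.1.P a v := fun a v =>
      (measurable_pi_apply v).comp ((measurable_pi_apply a).comp (AdditiveState.measurable_P.comp hs))
    have hsup : ∀ v, Measurable fun p : AdditiveState m 𝒱 × ℝ => ⨆ a, p.1.P a v := fun v =>
      Measurable.iSup fun a => hP a v
    have hcost : Measurable fun p : AdditiveState m 𝒱 × ℝ => p.1.newP i j p.2 - p.1.P i j :=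
      (AdditiveState.measurable_newP hs he i j).sub (hP i j)
    have hnat : ∀ {f : AdditiveState m 𝒱 × ℝ → ℕ}, Measurable f →
        Measurable fun p => (f p : ℝ) * δ₀ :=
      fun hf => (measurable_from_top.comp hf).mul_const _
    have hk := measurable_update_apply (AdditiveState.measurable_k.comp hs) j
      (AdditiveState.measurable_newCount hs he j)
    have hN := measurable_update_apply
      ((measurable_pi_apply i).comp (AdditiveState.measurable_N.comp hs)) j
      (AdditiveState.measurable_newN hs he i j)
    refine measurableSet_and (measurableSet_lt measurable_const measurable_snd)
      (measurableSet_and (measurableSet_le ((hsup j).add hcost) measurable_const)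
      (measurableSet_and (measurableSet_le
        ((Finset.measurable_sum _ fun v _ => hsup v).add hcost) measurable_const)
      (measurableSet_and (measurableSet_le
        ((Finset.measurable_sum _ fun v _ => hP i v).add hcost) measurable_const)
      (measurableSet_and (measurableSet_le
        (hnat (AdditiveState.measurable_newCount hs he j)) measurable_const)
      (measurableSet_and (measurableSet_le (hnat (Finset.measurable_sum _ fun v _ =>
        (measurable_pi_apply v).comp hk)) measurable_const)
      (measurableSet_le (hnat (Finset.measurable_sum _ fun v _ =>
        (measurable_pi_apply v).comp hN)) measurable_const))))))
  run := fun D => by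
    have key : ∀ i j, Measurable fun p : (Draw 𝒱 × AdditiveState m 𝒱) × ℝ =>
        (((additiveGaussian 𝒱 Ψ δ₀).run D p.1.1 p.1.2 (i, j, p.2)).1,
          (Response.release i j ((additiveGaussian 𝒱 Ψ δ₀).run D p.1.1 p.1.2 (i, j, p.2)).2 :
            Response m 𝒱)) := by
      intro i j
      have hs : Measurable fun p : (Draw 𝒱 × AdditiveState m 𝒱) × ℝ => p.1.2 :=
        measurable_snd.comp measurable_fst
      have he : Measurable fun p : (Draw 𝒱 × AdditiveState m 𝒱) × ℝ => p.2 := measurable_snd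
      have hz1 : Measurable fun p : (Draw 𝒱 × AdditiveState m 𝒱) × ℝ => p.1.1.1 j :=
        (measurable_pi_apply j).comp (measurable_fst.comp (measurable_fst.comp measurable_fst))
      have hz2 : Measurable fun p : (Draw 𝒱 × AdditiveState m 𝒱) × ℝ => p.1.1.2 j :=
        (measurable_pi_apply j).comp (measurable_snd.comp (measurable_fst.comp measurable_fst))
      have hP : ∀ a v, Measurable fun p : (Draw 𝒱 × AdditiveState m 𝒱) × ℝ => p.1.2.P a v :=
        fun a v => (measurable_pi_apply v).comp
          ((measurable_pi_apply a).comp (AdditiveState.measurable_P.comp hs))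
      have hN : ∀ a v, Measurable fun p : (Draw 𝒱 × AdditiveState m 𝒱) × ℝ => p.1.2.N a v :=
        fun a v => (measurable_pi_apply v).comp
          ((measurable_pi_apply a).comp (AdditiveState.measurable_N.comp hs))
      have hG := AdditiveState.measurable_newGlobal hδ₀ D hs he j hz1
      refine Measurable.prodMk (AdditiveState.measurable_mk
        (measurable_update_matrix hP i j (AdditiveState.measurable_newP hs he i j))
        (measurable_update_matrix hN i j (AdditiveState.measurable_newN hs he i j))
        (measurable_update_apply (AdditiveState.measurable_ε.comp hs) j
          (AdditiveState.measurable_newBudget hs he j))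
        (measurable_update_apply (AdditiveState.measurable_k.comp hs) j
          (AdditiveState.measurable_newCount hs he j))
        (measurable_update_apply (AdditiveState.measurable_v.comp hs) j
          (AdditiveState.measurable_newVar hδ₀ hs he j))
        (measurable_update_apply (AdditiveState.measurable_G.comp hs) j hG))
        ((measurable_release i j).comp (hG.add
          ((AdditiveState.measurable_localVar hδ₀ hs he j).sqrt.smul hz2)))
    exact (measurable_of_request (X := Draw 𝒱 × AdditiveState m 𝒱) (f := fun p =>
      (((additiveGaussian 𝒱 Ψ δ₀).run D p.1.1 p.1.2 p.2).1,
        (Response.release p.2.1 p.2.2.1 ((additiveGaussian 𝒱 Ψ δ₀).run D p.1.1 p.1.2 p.2).2 :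
          Response m 𝒱))) key).comp
      (f := fun p : Draw 𝒱 × AdditiveState m 𝒱 × Request m n => ((p.1, p.2.1), p.2.2))
      (by fun_prop)

end AdditiveMeasurable

/-! ### The additive Gaussian approach: beliefs about the hidden global synopses -/

section AdditiveBelief

variable {𝒮 : Schema} {m n : ℕ} {𝒱 : Fin n → HistView 𝒮}

/-- The state after a request `(i, j, ε)` is served, if the new global synopsis of view `j` is
`g`. -/
noncomputable def AdditiveState.next (s : AdditiveState m 𝒱) (δ₀ : ℝ) (i : Fin m) (j : Fin n)
    (ε : ℝ) (g : Synopsis 𝒱 j) : AdditiveState m 𝒱 where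
  P := Function.update s.P i (Function.update (s.P i) j (s.newP i j ε))
  N := Function.update s.N i (Function.update (s.N i) j (s.newN i j ε))
  ε := Function.update s.ε j (s.newBudget j ε)
  k := Function.update s.k j (s.newCount j ε)
  v := Function.update s.v j (s.newVar δ₀ j ε)
  G := Function.update s.G j g

/-- What an observer knows: the state `s` except for the global synopses, where, given the responses
that the observer has seen, the global synopsis of view `j` is normally distributed with mean
`s.G j + β j • V_j(D)` and variance `β j * s.v j` in every bin; `I j` is the information about
`V_j(D)` in these responses. -/
structure AdditiveBelief (m : ℕ) (𝒱 : Fin n → HistView 𝒮) where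
  s : AdditiveState m 𝒱
  β : Fin n → ℝ
  I : Fin n → ℝ≥0

namespace AdditiveBelief

/-- The global synopses, if the database is `E`. -/
noncomputable def globals (E : Database 𝒮) (b : AdditiveBelief m 𝒱)
    (ζ : (j : Fin n) → Synopsis 𝒱 j) (j : Fin n) : Synopsis 𝒱 j :=
  b.s.G j + b.β j • (𝒱 j).eval E + √(b.β j * b.s.v j) • ζ j

/-- The random state that a belief stands for. -/
noncomputable def state (E : Database 𝒮) (b : AdditiveBelief m 𝒱)
    (ζ : (j : Fin n) → Synopsis 𝒱 j) : AdditiveState m 𝒱 :=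
  { b.s with G := b.globals E ζ }

/-- The total information. -/
noncomputable def info (b : AdditiveBelief m 𝒱) : ℝ≥0 := ∑ j, b.I j

/-- The belief after a request `(i, j, ε)` is served. -/
noncomputable def next (b : AdditiveBelief m 𝒱) (δ₀ : ℝ) (i : Fin m) (j : Fin n) (ε : ℝ)
    (a : Synopsis 𝒱 j) (β : ℝ) (I : ℝ≥0) : AdditiveBelief m 𝒱 where
  s := b.s.next δ₀ i j ε a
  β := Function.update b.β j β
  I := Function.update b.I j I

/-- The law of the noise in the global synopses. -/
noncomputable abbrev noise (𝒱 : Fin n → HistView 𝒮) : Measure ((j : Fin n) → Synopsis 𝒱 j) :=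
  Measure.pi fun j => stdGauss (𝒱 j).Bin

lemma measurable_globals (E : Database 𝒮) (b : AdditiveBelief m 𝒱) : Measurable (b.globals E) := by
  refine measurable_pi_iff.2 fun j => ?_
  unfold globals
  fun_prop

lemma measurable_state (E : Database 𝒮) (b : AdditiveBelief m 𝒱) : Measurable (b.state E) :=
  AdditiveState.measurable_mk measurable_const measurable_const measurable_const measurable_const
    measurable_const (b.measurable_globals E)

lemma state_next_update (E : Database 𝒮) (b : AdditiveBelief m 𝒱) (δ₀ : ℝ) (i : Fin m) (j : Fin n)
    (ε : ℝ) (a : Synopsis 𝒱 j) (β : ℝ) (I : ℝ≥0) (ζ : (j : Fin n) → Synopsis 𝒱 j)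
    (x : Synopsis 𝒱 j) :
    (b.next δ₀ i j ε a β I).state E (Function.update ζ j x) =
      (b.state E ζ).next δ₀ i j ε
        (a + β • (𝒱 j).eval E + √(β * b.s.newVar δ₀ j ε) • x) := by
  have hG : (b.next δ₀ i j ε a β I).globals E (Function.update ζ j x) =
      Function.update (b.globals E ζ) j
        (a + β • (𝒱 j).eval E + √(β * b.s.newVar δ₀ j ε) • x) := by
    funext l
    by_cases hl : l = j
    · subst hl
      simp [globals, next, AdditiveState.next]
    · simp [globals, next, AdditiveState.next, hl]
  unfold state
  rw [hG]
  rfl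

lemma state_next_eq (E : Database 𝒮) (b : AdditiveBelief m 𝒱) (δ₀ : ℝ) (i : Fin m) (j : Fin n)
    (ε : ℝ) (g : Synopsis 𝒱 j) (ζ : (j : Fin n) → Synopsis 𝒱 j) :
    (b.state E ζ).next δ₀ i j ε g =
      { b.s.next δ₀ i j ε g with G := Function.update (b.globals E ζ) j g } := rfl

/-- The update overwrites the global synopsis of view `j`, so its old noise survives only through
`g`. -/
lemma state_next_congr (E : Database 𝒮) (b : AdditiveBelief m 𝒱) (δ₀ : ℝ) (i : Fin m) (j : Fin n)
    (ε : ℝ) (g : Synopsis 𝒱 j) (ζ : (j : Fin n) → Synopsis 𝒱 j) (x : Synopsis 𝒱 j) :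
    (b.state E (Function.update ζ j x)).next δ₀ i j ε g = (b.state E ζ).next δ₀ i j ε g := by
  have hG : Function.update (b.globals E (Function.update ζ j x)) j g =
      Function.update (b.globals E ζ) j g := by
    funext l
    by_cases hl : l = j
    · subst hl; simp
    · simp [globals, hl]
  rw [state_next_eq, state_next_eq, hG]

lemma measurable_state_next (E : Database 𝒮) (b : AdditiveBelief m 𝒱) (δ₀ : ℝ) (i : Fin m)
    (j : Fin n) (ε : ℝ) :
    Measurable fun p : ((j : Fin n) → Synopsis 𝒱 j) × Synopsis 𝒱 j =>
      (b.state E p.1).next δ₀ i j ε p.2 := by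
  simp only [state_next_eq]
  exact AdditiveState.measurable_mk measurable_const measurable_const measurable_const measurable_const
    measurable_const (measurable_update_apply ((b.measurable_globals E).comp measurable_fst) j
      measurable_snd)

/-- The integral over a belief after a request, by resampling the noise of view `j`. -/
lemma lintegral_state_next (E : Database 𝒮) (b : AdditiveBelief m 𝒱) (δ₀ : ℝ) (i : Fin m)
    (j : Fin n) (ε : ℝ) (a : Synopsis 𝒱 j) (β : ℝ) (I : ℝ≥0) {F : AdditiveState m 𝒱 → ℝ≥0∞}
    (hF : Measurable F) :
    ∫⁻ ζ, F ((b.next δ₀ i j ε a β I).state E ζ) ∂noise 𝒱 =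
      ∫⁻ ζ, ∫⁻ x, F ((b.state E ζ).next δ₀ i j ε
        (a + β • (𝒱 j).eval E + √(β * b.s.newVar δ₀ j ε) • x)) ∂stdGauss (𝒱 j).Bin ∂noise 𝒱 := by
  rw [lintegral_pi_update _ j (f := fun ζ => F ((b.next δ₀ i j ε a β I).state E ζ))
    (hF.comp (measurable_state E _))]
  simp only [state_next_update]

/-- The new global synopsis, given the noise `x` in the old one and the noise `ξ` in the fresh
intermediate one. -/
noncomputable def newGlobal (E : Database 𝒮) (b : AdditiveBelief m 𝒱) (δ₀ : ℝ) (j : Fin n) (ε : ℝ)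
    (x ξ : Synopsis 𝒱 j) : Synopsis 𝒱 j :=
  if b.s.ε j < ε then
    (1 - b.s.weight δ₀ j ε) • (b.s.G j + b.β j • (𝒱 j).eval E + √(b.β j * b.s.v j) • x) +
      b.s.weight δ₀ j ε • ((𝒱 j).eval E + analyticGM (ε - b.s.ε j) δ₀ 1 • ξ)
  else b.s.G j + b.β j • (𝒱 j).eval E + √(b.β j * b.s.v j) • x

/-- The coefficient of the exact answer in the new global synopsis. -/
noncomputable def newCoeff (b : AdditiveBelief m 𝒱) (δ₀ : ℝ) (j : Fin n) (ε : ℝ) : ℝ :=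
  if b.s.ε j < ε then (1 - b.s.weight δ₀ j ε) * b.β j + b.s.weight δ₀ j ε else b.β j

/-- The known part of the mean of the new global synopsis. -/
noncomputable def newOffset (b : AdditiveBelief m 𝒱) (δ₀ : ℝ) (j : Fin n) (ε : ℝ) :
    Synopsis 𝒱 j :=
  if b.s.ε j < ε then (1 - b.s.weight δ₀ j ε) • b.s.G j else b.s.G j

/-- The distribution of the state and the response after a request. -/
lemma lintegral_run (E : Database 𝒮) (Ψ : Constraints m n) (b : AdditiveBelief m 𝒱) (δ₀ : ℝ)
    (i : Fin m) (j : Fin n) (ε : ℝ) {F : AdditiveState m 𝒱 × Synopsis 𝒱 j → ℝ≥0∞}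
    (hF : Measurable F) :
    ∫⁻ ζ, ∫⁻ z, F ((additiveGaussian 𝒱 Ψ δ₀).run E z (b.state E ζ) (i, j, ε)) ∂drawLaw 𝒱 ∂noise 𝒱 =
      ∫⁻ ζ, ∫⁻ x, ∫⁻ ξ, ∫⁻ w, F ((b.state E ζ).next δ₀ i j ε (b.newGlobal E δ₀ j ε x ξ),
        b.newGlobal E δ₀ j ε x ξ + √(b.s.localVar δ₀ j ε) • w)
        ∂stdGauss (𝒱 j).Bin ∂stdGauss (𝒱 j).Bin ∂stdGauss (𝒱 j).Bin ∂noise 𝒱 := by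
  have hg : Measurable fun p : Synopsis 𝒱 j × Synopsis 𝒱 j => b.newGlobal E δ₀ j ε p.1 p.2 := by
    unfold newGlobal
    split_ifs <;> fun_prop
  have hn := b.measurable_state_next E δ₀ i j ε
  set H : ((j : Fin n) → Synopsis 𝒱 j) × Synopsis 𝒱 j × Synopsis 𝒱 j × Synopsis 𝒱 j → ℝ≥0∞ :=
    fun p => F ((b.state E p.1).next δ₀ i j ε (b.newGlobal E δ₀ j ε p.2.1 p.2.2.1),
      b.newGlobal E δ₀ j ε p.2.1 p.2.2.1 + √(b.s.localVar δ₀ j ε) • p.2.2.2) with hH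
  have hg' : Measurable fun p : ((j : Fin n) → Synopsis 𝒱 j) × Synopsis 𝒱 j × Synopsis 𝒱 j ×
      Synopsis 𝒱 j => b.newGlobal E δ₀ j ε p.2.1 p.2.2.1 :=
    hg.comp (by fun_prop : Measurable fun p : ((j : Fin n) → Synopsis 𝒱 j) × Synopsis 𝒱 j ×
      Synopsis 𝒱 j × Synopsis 𝒱 j => (p.2.1, p.2.2.1))
  have hHm : Measurable H := hF.comp ((hn.comp (measurable_fst.prodMk hg')).prodMk
    (hg'.add (by fun_prop)))
  -- All bookkeeping quantities ignore the hidden synopses, hence agree for `b.s` and for the random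
  -- state.
  have hrun : ∀ ζ z, F ((additiveGaussian 𝒱 Ψ δ₀).run E z (b.state E ζ) (i, j, ε)) =
      H (ζ, ζ j, z.1 j, z.2 j) := fun ζ z => rfl
  have hstep : ∀ ζ, ∫⁻ z, F ((additiveGaussian 𝒱 Ψ δ₀).run E z (b.state E ζ) (i, j, ε))
      ∂drawLaw 𝒱 = ∫⁻ ξ, ∫⁻ w, H (ζ, ζ j, ξ, w) ∂stdGauss (𝒱 j).Bin ∂stdGauss (𝒱 j).Bin := by
    intro ζ
    simp only [hrun]
    exact lintegral_drawLaw j (f := fun p => H (ζ, ζ j, p.1, p.2)) (by fun_prop)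
  simp only [hstep]
  -- Resampling separates the old noise of view `j` from that of the other views.
  rw [lintegral_pi_update _ j]
  · refine lintegral_congr fun ζ => lintegral_congr fun x => lintegral_congr fun ξ =>
      lintegral_congr fun w => ?_
    simp only [hH, Function.update_self, state_next_congr]
  · refine Measurable.lintegral_prod_right (f := fun (ζ : (j : Fin n) → Synopsis 𝒱 j)
      (ξ : Synopsis 𝒱 j) => ∫⁻ w, H (ζ, ζ j, ξ, w) ∂stdGauss (𝒱 j).Bin) ?_
    refine Measurable.lintegral_prod_right (f := fun (p : ((j : Fin n) → Synopsis 𝒱 j) ×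
      Synopsis 𝒱 j) (w : Synopsis 𝒱 j) => H (p.1, p.1 j, p.2, w)) ?_
    exact hHm.comp (f := fun p : (((j : Fin n) → Synopsis 𝒱 j) × Synopsis 𝒱 j) × Synopsis 𝒱 j =>
      (p.1.1, p.1.1 j, p.1.2, p.2)) (by fun_prop)

end AdditiveBelief

end AdditiveBelief

/-! ### The additive Gaussian approach: the invariant of a belief -/

section AdditiveInvariant

variable {𝒮 : Schema} {m n : ℕ} {𝒱 : Fin n → HistView 𝒮}

namespace AdditiveBelief

/-- Invariant of the additive Gaussian approach, for an observer of the positions in `S`. -/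
structure Inv (δ₀ : ℝ) (S : Set (Fin m × Fin n)) (b : AdditiveBelief m 𝒱) : Prop where
  P_nonneg : ∀ a l, 0 ≤ b.s.P a l
  P_le : ∀ a l, b.s.P a l ≤ b.s.ε l
  iSup_P : ∀ l, ⨆ a, b.s.P a l = b.s.ε l
  -- Either there is no global synopsis yet, or its information `1 / v` is the sum of the revealed
  -- part `I` and of what it retains given the responses, `β ^ 2 / (β * v) = β / v` when `β ≠ 0`.
  coeff : ∀ l, (b.s.k l = 0 ∧ b.s.ε l = 0 ∧ b.s.v l = 0 ∧ b.β l = 0 ∧ b.I l = 0) ∨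
    (b.s.k l ≠ 0 ∧ 0 < b.s.v l ∧ 0 ≤ b.β l ∧ b.β l = 1 - b.s.v l * b.I l)
  global_bound : ∀ l, hockeyStick (Real.toNNReal (b.s.v l)⁻¹) (Real.exp (b.s.ε l)) ≤
    ENNReal.ofReal (b.s.k l * δ₀)
  local_bound : ∀ i, S = {p | p.1 = i} → ∀ l,
    hockeyStick (b.I l) (Real.exp (b.s.P i l)) ≤ ENNReal.ofReal (b.s.N i l * δ₀)
  unseen : ∀ j, S = {p | p.2 = j} → ∀ l, l ≠ j → b.I l = 0

variable {δ₀ : ℝ} {S : Set (Fin m × Fin n)} {b : AdditiveBelief m 𝒱} {i : Fin m} {j : Fin n} {ε : ℝ}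

lemma Inv.ε_nonneg (hb : b.Inv δ₀ S) (l : Fin n) : 0 ≤ b.s.ε l := by
  rw [← hb.iSup_P l]
  exact Real.iSup_nonneg fun a => hb.P_nonneg a l

/-- The slope `β = 1 - v * I` is nonnegative: responses cannot reveal more than the global synopsis
contains. -/
lemma Inv.I_le (hb : b.Inv δ₀ S) (l : Fin n) : b.I l ≤ Real.toNNReal (b.s.v l)⁻¹ := by
  rcases hb.coeff l with ⟨-, -, -, -, h⟩ | ⟨-, hv, hβ, h⟩
  · simp [h]
  · rw [Real.le_toNNReal_iff_coe_le (by positivity), inv_eq_one_div, le_div_iff₀ hv]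
    linarith

/-- The case in which the global synopsis is not changed. -/
lemma Inv.count_ne_zero (hb : b.Inv δ₀ S) (hε : 0 < ε) (h : ¬ b.s.ε j < ε) : b.s.k j ≠ 0 := by
  intro hk
  rcases hb.coeff j with ⟨-, h0, -⟩ | ⟨h0, -⟩
  · exact h (h0 ▸ hε)
  · exact h0 hk

/-- The case in which a fresh intermediate synopsis is combined with the global one. -/
lemma Inv.combine (hb : b.Inv δ₀ S) (hδ₀ : 0 < δ₀) (hδ₀' : δ₀ < 1) (h : b.s.ε j < ε) :
    0 < b.s.newVar δ₀ j ε ∧ 0 ≤ b.newCoeff δ₀ j ε ∧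
      b.newCoeff δ₀ j ε = 1 - b.s.newVar δ₀ j ε * b.I j ∧
      (b.s.newVar δ₀ j ε)⁻¹ = (b.s.v j)⁻¹ + (analyticGM (ε - b.s.ε j) δ₀ 1 ^ 2)⁻¹ ∧
      (1 - b.s.weight δ₀ j ε) ^ 2 * (b.β j * b.s.v j) +
        b.s.weight δ₀ j ε ^ 2 * analyticGM (ε - b.s.ε j) δ₀ 1 ^ 2 =
          b.newCoeff δ₀ j ε * b.s.newVar δ₀ j ε := by
  have hσ : 0 < analyticGM (ε - b.s.ε j) δ₀ 1 := analyticGM_pos (by linarith) hδ₀ hδ₀'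
  simp only [newCoeff, AdditiveState.newVar, if_pos h, AdditiveState.weight]
  set V := analyticGM (ε - b.s.ε j) δ₀ 1 ^ 2 with hV
  have hV0 : 0 < V := by positivity
  rcases hb.coeff j with ⟨hk, -, hv, hβ, hI⟩ | ⟨hk, hv, hβ, hI⟩
  -- For a first synopsis the weight is one, and the stored variance zero contributes no precision
  -- because `0⁻¹ = 0`.
  · simp [hk, hv, hβ, hI, hV0]
  · rw [if_neg hk]
    generalize b.s.v j = v at hv hI ⊢
    generalize b.β j = β at hβ hI ⊢
    -- Inverse-variance weighting gives the variance `V * v / (V + v)`, so precisions add.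
    have hw : 1 - v / (V + v) = V / (V + v) := by field_simp; ring
    have hvar : (1 - v / (V + v)) ^ 2 * v + (v / (V + v)) ^ 2 * V = V * v / (V + v) := by
      rw [hw]; field_simp
    rw [hvar, hw]
    refine ⟨by positivity, by positivity, ?_, ?_, ?_⟩
    · rw [hI]; field_simp; ring
    · field_simp
    · field_simp

lemma Inv.newCoeff_spec (hb : b.Inv δ₀ S) (hδ₀ : 0 < δ₀) (hδ₀' : δ₀ < 1) (hε : 0 < ε) :
    0 < b.s.newVar δ₀ j ε ∧ 0 ≤ b.newCoeff δ₀ j ε ∧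
      b.newCoeff δ₀ j ε = 1 - b.s.newVar δ₀ j ε * b.I j := by
  by_cases h : b.s.ε j < ε
  · obtain ⟨h1, h2, h3, -⟩ := hb.combine hδ₀ hδ₀' h
    exact ⟨h1, h2, h3⟩
  · have hk := hb.count_ne_zero hε h
    simp only [newCoeff, AdditiveState.newVar, if_neg h]
    rcases hb.coeff j with ⟨h0, -⟩ | ⟨-, h1, h2, h3⟩
    · exact absurd h0 hk
    · exact ⟨h1, h2, h3⟩

lemma Inv.newCount_ne_zero (hb : b.Inv δ₀ S) (hε : 0 < ε) : b.s.newCount j ε ≠ 0 := by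
  unfold AdditiveState.newCount
  split_ifs with h
  · exact Nat.succ_ne_zero _
  · exact hb.count_ne_zero hε h

/-- A fresh intermediate synopsis adds its precision to that of the global one, its budget `ε - ε_j`
to the global budget and one to the count; sequential composition fits all three. -/
lemma Inv.new_global_bound (hb : b.Inv δ₀ S) (hδ₀ : 0 < δ₀) (hδ₀' : δ₀ < 1) :
    hockeyStick (Real.toNNReal (b.s.newVar δ₀ j ε)⁻¹) (Real.exp (b.s.newBudget j ε)) ≤
      ENNReal.ofReal (b.s.newCount j ε * δ₀) := by
  by_cases h : b.s.ε j < ε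
  · obtain ⟨-, -, -, hinv, -⟩ := hb.combine hδ₀ hδ₀' h
    have hv : 0 ≤ b.s.v j := by
      rcases hb.coeff j with ⟨-, -, hv, -⟩ | ⟨-, hv, -⟩
      · exact hv.ge
      · exact hv.le
    have hε' : b.s.newBudget j ε = b.s.ε j + (ε - b.s.ε j) := by
      rw [AdditiveState.newBudget, max_eq_right h.le]; ring
    rw [hinv, hε', Real.toNNReal_add (by positivity) (by positivity), AdditiveState.newCount,
      if_pos h, Nat.cast_add, Nat.cast_one, add_mul, one_mul]
    exact hockeyStick_add_exp_le (by positivity) hδ₀.le (hb.global_bound j)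
      (hockeyStick_analyticGM (by linarith) hδ₀ hδ₀')
  · rw [AdditiveState.newBudget, max_eq_left (not_lt.1 h), AdditiveState.newCount, if_neg h,
      AdditiveState.newVar, if_neg h]
    exact hb.global_bound j

lemma Inv.lintegral_newGlobal (hb : b.Inv δ₀ S) (hδ₀ : 0 < δ₀) (hδ₀' : δ₀ < 1) (E : Database 𝒮)
    {f : Synopsis 𝒱 j → ℝ≥0∞} (hf : Measurable f) :
    ∫⁻ x, ∫⁻ ξ, f (b.newGlobal E δ₀ j ε x ξ) ∂stdGauss (𝒱 j).Bin ∂stdGauss (𝒱 j).Bin =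
      ∫⁻ x, f (b.newOffset δ₀ j ε + b.newCoeff δ₀ j ε • (𝒱 j).eval E +
        √(b.newCoeff δ₀ j ε * b.s.newVar δ₀ j ε) • x) ∂stdGauss (𝒱 j).Bin := by
  by_cases h : b.s.ε j < ε
  · obtain ⟨-, -, -, -, hvar⟩ := hb.combine hδ₀ hδ₀' h
    have hβv : 0 ≤ b.β j * b.s.v j := by
      rcases hb.coeff j with ⟨-, -, -, hβ, -⟩ | ⟨-, hv, hβ, -⟩
      · simp [hβ]
      · positivity
    rw [← hvar]
    have hc := lintegral_stdGauss_combine ((1 - b.s.weight δ₀ j ε) * √(b.β j * b.s.v j))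
      (b.s.weight δ₀ j ε * analyticGM (ε - b.s.ε j) δ₀ 1)
      (f := fun x => f (b.newOffset δ₀ j ε + b.newCoeff δ₀ j ε • (𝒱 j).eval E + x)) (by fun_prop)
    rw [mul_pow, mul_pow, Real.sq_sqrt hβv] at hc
    rw [← hc]
    refine lintegral_congr fun x => lintegral_congr fun ξ => ?_
    congr 1
    simp only [newGlobal, newOffset, newCoeff, if_pos h]
    module
  · simp only [newGlobal, newOffset, newCoeff, AdditiveState.newVar, if_neg h, lintegral_const,
      measure_univ, mul_one]

/-- Since `σ` decreases in the budget, subtracting at most `σ(newBudget)²` leaves a genuine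
variance; subtracting at most `newVar` keeps the total noise of a response at `σ(ε)²` or more. -/
lemma localVar_spec (b : AdditiveBelief m 𝒱) (j : Fin n) (hδ₀ : 0 < δ₀) (hδ₀' : δ₀ < 1) (hε : 0 < ε) :
    0 ≤ b.s.localVar δ₀ j ε ∧
      analyticGM ε δ₀ 1 ^ 2 ≤ b.s.newVar δ₀ j ε + b.s.localVar δ₀ j ε := by
  have h0 : 0 ≤ analyticGM (b.s.newBudget j ε) δ₀ 1 :=
    (analyticGM_pos (hε.le.trans (le_max_right _ _)) hδ₀ hδ₀').le
  have h1 : analyticGM (b.s.newBudget j ε) δ₀ 1 ≤ analyticGM ε δ₀ 1 :=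
    analyticGM_anti hε.le (le_max_right _ _) hδ₀ hδ₀'
  have h2 : analyticGM (b.s.newBudget j ε) δ₀ 1 ^ 2 ≤ analyticGM ε δ₀ 1 ^ 2 := by gcongr
  unfold AdditiveState.localVar
  have h3 := min_le_left (b.s.newVar δ₀ j ε) (analyticGM (b.s.newBudget j ε) δ₀ 1 ^ 2)
  have h4 := min_le_right (b.s.newVar δ₀ j ε) (analyticGM (b.s.newBudget j ε) δ₀ 1 ^ 2)
  constructor <;> linarith

lemma Inv.P_le_newP (hb : b.Inv δ₀ S) (hε : 0 < ε) : b.s.P i j ≤ b.s.newP i j ε :=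
  le_min ((hb.P_le i j).trans (le_max_left _ _)) (by linarith)

/-- Whoever raises the global budget is charged up to all of it. This keeps the maximum of each
column equal to the global budget. -/
lemma Inv.newP_of_lt (hb : b.Inv δ₀ S) (h : b.s.ε j < ε) :
    b.s.newP i j ε = b.s.newBudget j ε := by
  have := hb.P_nonneg i j
  rw [AdditiveState.newP, AdditiveState.newBudget, max_eq_right h.le, min_eq_left (by linarith)]

lemma update_matrix_apply {α : Type*} (f : Fin m → Fin n → α) (i : Fin m) (j : Fin n) (x : α)
    (a : Fin m) (l : Fin n) : Function.update f i (Function.update (f i) j x) a l =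
      if a = i ∧ l = j then x else f a l := by
  by_cases ha : a = i
  · subst ha
    by_cases hl : l = j
    · subst hl; simp
    · simp [hl]
  · simp [ha]

/-- The bookkeeping common to hidden and visible requests, which differ only in the new slope `β`
and information `I` of view `j`. -/
lemma Inv.next (hb : b.Inv δ₀ S) (hδ₀ : 0 < δ₀) (hδ₀' : δ₀ < 1) (hε : 0 < ε) (a : Synopsis 𝒱 j)
    {β : ℝ} {I : ℝ≥0} (hβ0 : 0 ≤ β) (hβ : β = 1 - b.s.newVar δ₀ j ε * I)
    (hloc : ∀ i', S = {p | p.1 = i'} → (i' ≠ i → I = b.I j) ∧ (i' = i →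
      hockeyStick I (Real.exp (b.s.newP i j ε)) ≤ ENNReal.ofReal (b.s.newN i j ε * δ₀)))
    (hun : ∀ j', S = {p | p.2 = j'} → j ≠ j' → I = 0) :
    (b.next δ₀ i j ε a β I).Inv δ₀ S := by
  have hnewP0 : 0 ≤ b.s.newP i j ε := (hb.P_nonneg i j).trans (hb.P_le_newP hε)
  have hPle : ∀ a' l, (b.next δ₀ i j ε a β I).s.P a' l ≤ (b.next δ₀ i j ε a β I).s.ε l := by
    intro a' l
    simp only [AdditiveBelief.next, AdditiveState.next, update_matrix_apply]
    by_cases hl : l = j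
    · subst hl
      rw [Function.update_self]
      split_ifs
      · exact min_le_left _ _
      · exact (hb.P_le a' l).trans (le_max_left _ _)
    · simp only [hl, and_false, if_false, ne_eq, not_false_eq_true, Function.update_of_ne]
      exact hb.P_le a' l
  refine ⟨fun a' l => ?_, hPle, fun l => ?_, fun l => ?_, fun l => ?_, fun i' hS l => ?_,
    fun j' hS l hl => ?_⟩
  · simp only [AdditiveBelief.next, AdditiveState.next, update_matrix_apply]
    split_ifs
    · exact hnewP0
    · exact hb.P_nonneg a' l
  · have : Nonempty (Fin m) := ⟨i⟩
    refine le_antisymm (ciSup_le fun a' => hPle a' l) ?_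
    have hbdd : BddAbove (Set.range fun a' => (b.next δ₀ i j ε a β I).s.P a' l) :=
      (Set.finite_range _).bddAbove
    have hold : b.s.ε l ≤ ⨆ a', (b.next δ₀ i j ε a β I).s.P a' l := by
      rw [← hb.iSup_P l]
      refine ciSup_mono hbdd fun a' => ?_
      simp only [AdditiveBelief.next, AdditiveState.next, update_matrix_apply]
      split_ifs with h
      · obtain ⟨rfl, rfl⟩ := h
        exact hb.P_le_newP hε
      · exact le_rfl
    by_cases hl : l = j
    · subst hl
      by_cases h : b.s.ε l < ε
      · refine le_trans (le_of_eq ?_) (le_ciSup hbdd i)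
        simp only [AdditiveBelief.next, AdditiveState.next, Function.update_self]
        exact (hb.newP_of_lt h).symm
      · refine le_trans (le_of_eq ?_) hold
        simp only [AdditiveBelief.next, AdditiveState.next, Function.update_self,
          AdditiveState.newBudget, max_eq_left (not_lt.1 h)]
    · refine le_trans (le_of_eq ?_) hold
      simp [AdditiveBelief.next, AdditiveState.next, hl]
  · by_cases hl : l = j
    · subst hl
      right
      simp only [AdditiveBelief.next, AdditiveState.next, Function.update_self]
      exact ⟨hb.newCount_ne_zero hε, (hb.newCoeff_spec hδ₀ hδ₀' hε).1, hβ0, hβ⟩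
    · simpa [AdditiveBelief.next, AdditiveState.next, hl] using hb.coeff l
  · by_cases hl : l = j
    · subst hl
      simp only [AdditiveBelief.next, AdditiveState.next, Function.update_self]
      exact hb.new_global_bound hδ₀ hδ₀'
    · simpa [AdditiveBelief.next, AdditiveState.next, hl] using hb.global_bound l
  · simp only [AdditiveBelief.next, AdditiveState.next, update_matrix_apply]
    obtain ⟨h1, h2⟩ := hloc i' hS
    by_cases hl : l = j
    · subst hl
      by_cases hi : i' = i
      · simp only [hi, and_self, if_true, Function.update_self]
        exact h2 hi
      · simp only [hi, false_and, if_false, Function.update_self, h1 hi]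
        exact hb.local_bound i' hS l
    · simp only [hl, and_false, if_false, ne_eq, not_false_eq_true, Function.update_of_ne]
      exact hb.local_bound i' hS l
  · simp only [AdditiveBelief.next]
    by_cases hlj : l = j
    · subst hlj
      rw [Function.update_self]
      exact hun j' hS hl
    · rw [Function.update_of_ne hlj]
      exact hb.unseen j' hS l hl

end AdditiveBelief

end AdditiveInvariant

/-! ### The additive Gaussian approach: privacy -/

section AdditivePrivacy

variable {𝒮 : Schema} {m n : ℕ} {𝒱 : Fin n → HistView 𝒮}

namespace AdditiveBelief

variable {δ₀ : ℝ} {S : Set (Fin m × Fin n)} {b : AdditiveBelief m 𝒱} {i : Fin m} {j : Fin n} {ε : ℝ}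

/-- The variance of the response to a request, from the observer's point of view. -/
noncomputable def responseVar (b : AdditiveBelief m 𝒱) (δ₀ : ℝ) (j : Fin n) (ε : ℝ) : ℝ :=
  b.newCoeff δ₀ j ε * b.s.newVar δ₀ j ε + b.s.localVar δ₀ j ε

/-- The regression coefficient of the new global synopsis on the response to a request. -/
noncomputable def gain (b : AdditiveBelief m 𝒱) (δ₀ : ℝ) (j : Fin n) (ε : ℝ) : ℝ :=
  b.newCoeff δ₀ j ε * b.s.newVar δ₀ j ε / b.responseVar δ₀ j ε

/-- The information about the exact answer in the response to a request. -/
noncomputable def newInfo (b : AdditiveBelief m 𝒱) (δ₀ : ℝ) (j : Fin n) (ε : ℝ) : ℝ≥0 :=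
  Real.toNNReal (b.newCoeff δ₀ j ε ^ 2 / b.responseVar δ₀ j ε)

/-- The belief of an observer who sees the response `y` to a request `(i, j, ε)`. -/
noncomputable def posterior (b : AdditiveBelief m 𝒱) (δ₀ : ℝ) (i : Fin m) (j : Fin n) (ε : ℝ)
    (y : Synopsis 𝒱 j) : AdditiveBelief m 𝒱 :=
  b.next δ₀ i j ε ((1 - b.gain δ₀ j ε) • b.newOffset δ₀ j ε + b.gain δ₀ j ε • y)
    ((1 - b.gain δ₀ j ε) * b.newCoeff δ₀ j ε) (b.I j + b.newInfo δ₀ j ε)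

lemma Inv.responseVar_nonneg (hb : b.Inv δ₀ S) (hδ₀ : 0 < δ₀) (hδ₀' : δ₀ < 1) (hε : 0 < ε) :
    0 ≤ b.responseVar δ₀ j ε := by
  obtain ⟨h1, h2, -⟩ := hb.newCoeff_spec (j := j) hδ₀ hδ₀' hε
  obtain ⟨h3, -⟩ := b.localVar_spec j hδ₀ hδ₀' hε
  unfold responseVar
  positivity

lemma Inv.responseVar_pos (hb : b.Inv δ₀ S) (hδ₀ : 0 < δ₀) (hδ₀' : δ₀ < 1) (hε : 0 < ε)
    (hc : b.newCoeff δ₀ j ε ≠ 0) : 0 < b.responseVar δ₀ j ε := by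
  obtain ⟨h1, h2, -⟩ := hb.newCoeff_spec (j := j) hδ₀ hδ₀' hε
  obtain ⟨h3, -⟩ := b.localVar_spec j hδ₀ hδ₀' hε
  have := h2.lt_of_ne' hc
  unfold responseVar
  positivity

/-- The Kalman update: conditioning on the response scales the slope by one minus the gain, and the
relation `β = 1 - v * I` persists when `I` grows by the squared slope over the response variance. -/
lemma Inv.posterior_coeff (hb : b.Inv δ₀ S) (hδ₀ : 0 < δ₀) (hδ₀' : δ₀ < 1) (hε : 0 < ε) :
    0 ≤ (1 - b.gain δ₀ j ε) * b.newCoeff δ₀ j ε ∧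
      (1 - b.gain δ₀ j ε) * b.newCoeff δ₀ j ε =
        1 - b.s.newVar δ₀ j ε * ((b.I j + b.newInfo δ₀ j ε : ℝ≥0) : ℝ) ∧
      (1 - b.gain δ₀ j ε) * b.newCoeff δ₀ j ε * b.s.newVar δ₀ j ε =
        b.newCoeff δ₀ j ε * b.s.newVar δ₀ j ε * b.s.localVar δ₀ j ε / b.responseVar δ₀ j ε := by
  obtain ⟨h1, h2, h3⟩ := hb.newCoeff_spec (j := j) hδ₀ hδ₀' hε
  obtain ⟨h4, -⟩ := b.localVar_spec j hδ₀ hδ₀' hε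
  have hr := hb.responseVar_nonneg (j := j) hδ₀ hδ₀' hε
  have hinfo : ((b.I j + b.newInfo δ₀ j ε : ℝ≥0) : ℝ) =
      b.I j + b.newCoeff δ₀ j ε ^ 2 / b.responseVar δ₀ j ε := by
    rw [NNReal.coe_add, newInfo, Real.coe_toNNReal _ (by positivity)]
  rw [hinfo]
  have hI : b.s.newVar δ₀ j ε * b.I j = 1 - b.newCoeff δ₀ j ε := by linarith
  rw [mul_add, hI]
  unfold gain
  -- At slope zero the response variance may vanish, but gain and new information are then zero as
  -- well.
  by_cases hc : b.newCoeff δ₀ j ε = 0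
  · simp [hc]
  · have hpos := hb.responseVar_pos hδ₀ hδ₀' hε hc
    have hsub : 1 - b.newCoeff δ₀ j ε * b.s.newVar δ₀ j ε / b.responseVar δ₀ j ε =
        b.s.localVar δ₀ j ε / b.responseVar δ₀ j ε := by
      rw [eq_div_iff hpos.ne', sub_mul, div_mul_cancel₀ _ hpos.ne', responseVar]
      ring
    refine ⟨?_, ?_, ?_⟩
    · rw [hsub]; positivity
    · ring
    · rw [hsub]; ring

/-- Earlier responses only diminish what a new one reveals: for slope `c ≤ 1`, `c ^ 2 * (v + l) ≤ c
* v + l`, while `v + l ≥ σ(ε)²`, with `v` the new global and `l` the local variance. -/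
lemma Inv.newInfo_le (hb : b.Inv δ₀ S) (hδ₀ : 0 < δ₀) (hδ₀' : δ₀ < 1) (hε : 0 < ε) :
    b.newInfo δ₀ j ε ≤ Real.toNNReal (analyticGM ε δ₀ 1 ^ 2)⁻¹ := by
  obtain ⟨h1, h2, h3⟩ := hb.newCoeff_spec (j := j) hδ₀ hδ₀' hε
  obtain ⟨h4, h5⟩ := b.localVar_spec j hδ₀ hδ₀' hε
  have hσ := analyticGM_pos hε.le hδ₀ hδ₀'
  refine Real.toNNReal_le_toNNReal ?_
  by_cases hc : b.newCoeff δ₀ j ε = 0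
  · simp only [hc, ne_eq, OfNat.ofNat_ne_zero, not_false_eq_true, zero_pow, zero_div]
    positivity
  · have hpos := hb.responseVar_pos hδ₀ hδ₀' hε hc
    have hc1 : b.newCoeff δ₀ j ε ≤ 1 := by
      have : 0 ≤ b.s.newVar δ₀ j ε * b.I j := by positivity
      linarith
    rw [inv_eq_one_div, div_le_div_iff₀ hpos (by positivity), one_mul, responseVar]
    generalize b.newCoeff δ₀ j ε = c at *
    have hc2 : c ^ 2 ≤ c := by nlinarith
    calc c ^ 2 * analyticGM ε δ₀ 1 ^ 2
        ≤ c ^ 2 * (b.s.newVar δ₀ j ε + b.s.localVar δ₀ j ε) := by gcongr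
      _ ≤ c * b.s.newVar δ₀ j ε + 1 * b.s.localVar δ₀ j ε := by
        rw [mul_add]
        gcongr
        linarith
      _ = _ := by ring

lemma Inv.hidden (hb : b.Inv δ₀ S) (hδ₀ : 0 < δ₀) (hδ₀' : δ₀ < 1) (hε : 0 < ε)
    (hS : (i, j) ∉ S) :
    (b.next δ₀ i j ε (b.newOffset δ₀ j ε) (b.newCoeff δ₀ j ε) (b.I j)).Inv δ₀ S := by
  obtain ⟨-, h2, h3⟩ := hb.newCoeff_spec (j := j) hδ₀ hδ₀' hε
  refine hb.next hδ₀ hδ₀' hε _ h2 h3 (fun i' hi' => ⟨fun _ => rfl, fun h => ?_⟩)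
    fun j' hj' hne => hb.unseen j' hj' j hne
  exact absurd (by rw [hi']; exact h.symm) hS

lemma Inv.posterior (hb : b.Inv δ₀ S) (hδ₀ : 0 < δ₀) (hδ₀' : δ₀ < 1) (hε : 0 < ε)
    (hS : (i, j) ∈ S) (y : Synopsis 𝒱 j) : (b.posterior δ₀ i j ε y).Inv δ₀ S := by
  obtain ⟨h1, h2, -⟩ := hb.posterior_coeff (j := j) hδ₀ hδ₀' hε
  obtain ⟨hv, -⟩ := hb.newCoeff_spec (j := j) hδ₀ hδ₀' hε
  refine hb.next hδ₀ hδ₀' hε _ h1 h2 (fun i' hi' => ⟨fun h => ?_, fun _ => ?_⟩) fun j' hj' hne => ?_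
  · rw [hi'] at hS
    exact absurd hS.symm h
  · have hi : i = i' := by rw [hi'] at hS; exact hS
    subst hi
    -- The two arguments of the minimum correspond to two bounds on the information: that of the
    -- whole global synopsis, or the earlier bound composed with one more `(ε, δ₀)`-private
    -- response.
    by_cases h : b.s.newBudget j ε ≤ b.s.P i j + ε
    · rw [AdditiveState.newP, min_eq_left h, AdditiveState.newN, if_pos h]
      refine (hockeyStick_mono ?_ _).trans (hb.new_global_bound hδ₀ hδ₀')
      rw [Real.le_toNNReal_iff_coe_le (by positivity), inv_eq_one_div, le_div_iff₀ hv]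
      linarith
    · rw [AdditiveState.newP, min_eq_right (not_le.1 h).le, AdditiveState.newN, if_neg h,
        Nat.cast_add, Nat.cast_one, add_mul, one_mul]
      exact hockeyStick_add_exp_le (by positivity) hδ₀.le (hb.local_bound i hi' j)
        ((hockeyStick_mono (hb.newInfo_le hδ₀ hδ₀' hε) _).trans
          (hockeyStick_analyticGM hε.le hδ₀ hδ₀'))
  · rw [hj'] at hS
    exact absurd hS hne

lemma info_next (b : AdditiveBelief m 𝒱) (a : Synopsis 𝒱 j) (β : ℝ) (x : ℝ≥0) :
    (b.next δ₀ i j ε a β (b.I j + x)).info = b.info + x := by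
  simp only [info, next]
  rw [Finset.sum_update_of_mem (Finset.mem_univ j), ← Finset.add_sum_erase _ _ (Finset.mem_univ j),
    Finset.sdiff_singleton_eq_erase]
  ring

/-- The distribution of the state after a request that the observer does not see. -/
lemma Inv.lintegral_run_hidden (hb : b.Inv δ₀ S) (hδ₀ : 0 < δ₀) (hδ₀' : δ₀ < 1)
    (Ψ : Constraints m n) (i : Fin m) (E : Database 𝒮)
    {F : AdditiveState m 𝒱 → ℝ≥0∞} (hF : Measurable F) :
    ∫⁻ ζ, ∫⁻ z, F ((additiveGaussian 𝒱 Ψ δ₀).run E z (b.state E ζ) (i, j, ε)).1 ∂drawLaw 𝒱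
        ∂noise 𝒱 =
      ∫⁻ ζ, F ((b.next δ₀ i j ε (b.newOffset δ₀ j ε) (b.newCoeff δ₀ j ε) (b.I j)).state E ζ)
        ∂noise 𝒱 := by
  rw [lintegral_run E Ψ b δ₀ i j ε (F := fun p => F p.1) (hF.comp measurable_fst),
    lintegral_state_next E b δ₀ i j ε _ _ _ hF]
  refine lintegral_congr fun ζ => ?_
  simp only [lintegral_const, measure_univ, mul_one]
  exact hb.lintegral_newGlobal hδ₀ hδ₀' E (f := fun g => F ((b.state E ζ).next δ₀ i j ε g))
    (hF.comp ((b.measurable_state_next E δ₀ i j ε).comp measurable_prodMk_left))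

lemma measurable_lintegral_posterior (b : AdditiveBelief m 𝒱) (δ₀ : ℝ) (i : Fin m) (j : Fin n)
    (ε : ℝ) (E : Database 𝒮) {F : AdditiveState m 𝒱 × Synopsis 𝒱 j → ℝ≥0∞} (hF : Measurable F) :
    Measurable fun y => ∫⁻ ζ, F ((b.posterior δ₀ i j ε y).state E ζ, y) ∂noise 𝒱 := by
  simp only [posterior]
  simp only [fun y => lintegral_state_next E b δ₀ i j ε
    ((1 - b.gain δ₀ j ε) • b.newOffset δ₀ j ε + b.gain δ₀ j ε • y)
    ((1 - b.gain δ₀ j ε) * b.newCoeff δ₀ j ε) (b.I j + b.newInfo δ₀ j ε)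
    (F := fun s => F (s, y)) (hF.comp measurable_prodMk_right)]
  refine Measurable.lintegral_prod_right (Measurable.lintegral_prod_right ?_)
  refine hF.comp (((b.measurable_state_next E δ₀ i j ε).comp
    ((measurable_snd.comp measurable_fst).prodMk ?_)).prodMk (measurable_fst.comp measurable_fst))
  fun_prop

/-- The distribution of the state and the response after a request that the observer sees. -/
lemma Inv.lintegral_run_visible (hb : b.Inv δ₀ S) (hδ₀ : 0 < δ₀) (hδ₀' : δ₀ < 1) (hε : 0 < ε)
    (Ψ : Constraints m n) (i : Fin m) (E : Database 𝒮)
    {F : AdditiveState m 𝒱 × Synopsis 𝒱 j → ℝ≥0∞} (hF : Measurable F)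
    {Φ : Synopsis 𝒱 j → ℝ≥0∞}
    (hΦ : Φ = fun y => ∫⁻ ζ, F ((b.posterior δ₀ i j ε y).state E ζ, y) ∂noise 𝒱) :
    ∫⁻ ζ, ∫⁻ z, F ((additiveGaussian 𝒱 Ψ δ₀).run E z (b.state E ζ) (i, j, ε)) ∂drawLaw 𝒱
        ∂noise 𝒱 =
      ∫⁻ ξ, Φ (b.newOffset δ₀ j ε + b.newCoeff δ₀ j ε • (𝒱 j).eval E +
        √(b.responseVar δ₀ j ε) • ξ) ∂stdGauss (𝒱 j).Bin := by
  obtain ⟨hv, hc, -⟩ := hb.newCoeff_spec (j := j) hδ₀ hδ₀' hε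
  obtain ⟨hl, -⟩ := b.localVar_spec j hδ₀ hδ₀' hε
  obtain ⟨-, -, hvar⟩ := hb.posterior_coeff (j := j) hδ₀ hδ₀' hε
  set c := b.newOffset δ₀ j ε + b.newCoeff δ₀ j ε • (𝒱 j).eval E with hcdef
  have hn := b.measurable_state_next E δ₀ i j ε
  have hstep : ∀ ζ, ∫⁻ x, ∫⁻ ξ, ∫⁻ w, F ((b.state E ζ).next δ₀ i j ε (b.newGlobal E δ₀ j ε x ξ),
        b.newGlobal E δ₀ j ε x ξ + √(b.s.localVar δ₀ j ε) • w)
        ∂stdGauss (𝒱 j).Bin ∂stdGauss (𝒱 j).Bin ∂stdGauss (𝒱 j).Bin =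
      ∫⁻ y, ∫⁻ x, F ((b.state E ζ).next δ₀ i j ε (c +
          ((b.gain δ₀ j ε * √(b.responseVar δ₀ j ε)) • y +
          √((1 - b.gain δ₀ j ε) * b.newCoeff δ₀ j ε * b.s.newVar δ₀ j ε) • x)),
        c + √(b.responseVar δ₀ j ε) • y) ∂stdGauss (𝒱 j).Bin ∂stdGauss (𝒱 j).Bin := by
    intro ζ
    have hn' : Measurable fun g => (b.state E ζ).next δ₀ i j ε g := hn.comp measurable_prodMk_left
    have h1 := hb.lintegral_newGlobal hδ₀ hδ₀' (ε := ε) E (f := fun g =>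
      ∫⁻ w, F ((b.state E ζ).next δ₀ i j ε g, g + √(b.s.localVar δ₀ j ε) • w)
        ∂stdGauss (𝒱 j).Bin) (Measurable.lintegral_prod_right
          (hF.comp ((hn'.comp measurable_fst).prodMk (by fun_prop))))
    rw [h1, hvar]
    -- Instead of the global synopsis and then its noisy version, the response is sampled first and
    -- the global synopsis from its conditional law.
    have h2 := lintegral_stdGauss_posterior (mul_nonneg hc hv.le) hl
      (f := fun p => F ((b.state E ζ).next δ₀ i j ε (c + p.1), c + p.2))
      (hF.comp ((hn'.comp (by fun_prop)).prodMk (by fun_prop)))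
    simp only [← add_assoc c] at h2 ⊢
    exact h2
  rw [lintegral_run E Ψ b δ₀ i j ε hF]
  simp only [hstep]
  -- The response must be outermost, since the posterior belief depends on it.
  rw [lintegral_lintegral_swap]
  · refine lintegral_congr fun y => ?_
    rw [hΦ]
    simp only [AdditiveBelief.posterior]
    rw [lintegral_state_next E b δ₀ i j ε _ _ _
      (F := fun s => F (s, c + √(b.responseVar δ₀ j ε) • y)) (hF.comp measurable_prodMk_right)]
    refine lintegral_congr fun ζ => lintegral_congr fun x => ?_
    congr 3
    rw [hcdef]
    module
  · refine Measurable.aemeasurable (Measurable.lintegral_prod_right ?_)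
    have hm : Measurable fun a : (((l : Fin n) → Synopsis 𝒱 l) × Synopsis 𝒱 j) × Synopsis 𝒱 j =>
        (a.1.1, c + ((b.gain δ₀ j ε * √(b.responseVar δ₀ j ε)) • a.1.2 +
          √((1 - b.gain δ₀ j ε) * b.newCoeff δ₀ j ε * b.s.newVar δ₀ j ε) • a.2)) := by fun_prop
    exact hF.comp ((hn.comp hm).prodMk (by fun_prop))

end AdditiveBelief

/-- The belief at the beginning. -/
noncomputable def AdditiveBelief.init (m : ℕ) (𝒱 : Fin n → HistView 𝒮) : AdditiveBelief m 𝒱 where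
  s := ⟨fun _ _ => 0, fun _ _ => 0, fun _ => 0, fun _ => 0, fun _ => 0, fun _ => 0⟩
  β := fun _ => 0
  I := fun _ => 0

open AdditiveBelief

/-- To the observer a visible response is Gaussian with slope `newCoeff` and variance `responseVar`,
so the two databases shift its mean in at most one bin. Given the response, the posterior belief has
the same parameters under both; only the law of the response is reweighted. -/
lemma additiveGaussian_isBeliefSystem {Ψ : Constraints m n} {δ₀ : ℝ} (hδ₀ : 0 < δ₀) (hδ₀' : δ₀ < 1)
    {S : Set (Fin m × Fin n)} {Rm : ℝ≥0}
    (hRm : ∀ (b : AdditiveBelief m 𝒱) i j ε y, b.Inv δ₀ S →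
      (additiveGaussian 𝒱 Ψ δ₀).constraintCheck b.s (i, j, ε) → (i, j) ∈ S →
      (b.posterior δ₀ i j ε y).Inv δ₀ S → (b.posterior δ₀ i j ε y).info ≤ Rm)
    {D D' : Database 𝒮} (hDD' : Neighbour D D') :
    IsBeliefSystem (additiveGaussian 𝒱 Ψ δ₀) S D D' (noise 𝒱)
      (fun E (b : AdditiveBelief m 𝒱) ζ => b.state E ζ) (fun b => b.Inv δ₀ S ∧ b.info ≤ Rm)
      info where
  check := fun _ _ _ _ _ _ h => h
  hidden := fun b i j ε hb hch hS => by
    have hε : 0 < ε := (hch 0 0).1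
    have hinfo : (b.next δ₀ i j ε (b.newOffset δ₀ j ε) (b.newCoeff δ₀ j ε) (b.I j)).info =
        b.info := by
      simpa using info_next (i := i) (j := j) (δ₀ := δ₀) (ε := ε) b (b.newOffset δ₀ j ε)
        (b.newCoeff δ₀ j ε) 0
    exact ⟨_, ⟨hb.1.hidden hδ₀ hδ₀' hε hS, hinfo.trans_le hb.2⟩, hinfo.ge,
      fun E F hF => hb.1.lintegral_run_hidden hδ₀ hδ₀' Ψ i E hF⟩
  visible := fun b i j ε hb hch hS => by
    have hε : 0 < ε := (hch 0 0).1
    have hr := hb.1.responseVar_nonneg (j := j) hδ₀ hδ₀' hε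
    obtain ⟨l, h, hl, hlaw, hh, hF⟩ := (hDD'.unitShift (𝒱 j)).exists_logLikelihood
      (b.newOffset δ₀ j ε) (α := b.newCoeff δ₀ j ε) (s := √(b.responseVar δ₀ j ε))
      (fun hc => (Real.sqrt_pos.2 (hb.1.responseVar_pos hδ₀ hδ₀' hε hc)).ne')
    rw [Real.sq_sqrt hr] at hh
    refine ⟨fun ξ => b.posterior δ₀ i j ε (b.newOffset δ₀ j ε +
      b.newCoeff δ₀ j ε • (𝒱 j).eval D + √(b.responseVar δ₀ j ε) • ξ), fun ξ =>
      b.newOffset δ₀ j ε + b.newCoeff δ₀ j ε • (𝒱 j).eval D + √(b.responseVar δ₀ j ε) • ξ,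
      l, h, hl, hlaw, fun ξ => ⟨⟨hb.1.posterior hδ₀ hδ₀' hε hS _,
        hRm b i j ε _ hb.1 (hch 0 0) hS (hb.1.posterior hδ₀ hδ₀' hε hS _)⟩, ?_⟩,
      fun F hFm => hb.1.lintegral_run_visible hδ₀ hδ₀' hε Ψ i D hFm rfl, fun F hFm => ?_⟩
    -- The credited information is the worst case; the actual `h` is smaller, for example, if the
    -- view does not see the added tuple.
    · simp only [AdditiveBelief.posterior, info_next]
      gcongr
      rwa [newInfo, Real.le_toNNReal_iff_coe_le (by positivity)]
    · rw [hb.1.lintegral_run_visible hδ₀ hδ₀' hε Ψ i D' hFm rfl,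
        hF _ (b.measurable_lintegral_posterior δ₀ i j ε D' hFm)]
      rfl

/-- Privacy of the additive Gaussian approach towards an observer of the positions in `S`, if every
accepted request at such a position keeps the information of the observer within `(ψ, δ)`. -/
theorem additiveGaussian_isDP {Ψ : Constraints m n} {δ₀ : ℝ} (hδ₀ : 0 < δ₀) (hδ₀' : δ₀ < 1)
    {S : Set (Fin m × Fin n)} {ψ δ : ℝ} (hψ0 : 0 ≤ ψ)
    (hψ : ∀ (b : AdditiveBelief m 𝒱) i j ε y, b.Inv δ₀ S →
      (additiveGaussian 𝒱 Ψ δ₀).constraintCheck b.s (i, j, ε) → (i, j) ∈ S →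
      (b.posterior δ₀ i j ε y).Inv δ₀ S →
        hockeyStick (b.posterior δ₀ i j ε y).info (Real.exp ψ) ≤ ENNReal.ofReal δ) {T : ℕ}
    {π : Policy m 𝒱} (hπ : ∀ t, Measurable (π t)) (hπS : π.DependsOnlyOn (fun h => observe S h)) :
    IsDP (noiseLaw 𝒱 T) (fun D ω => observe S (transcript (additiveGaussian 𝒱 Ψ δ₀) π T D ω)) ψ
      δ := by
  rcases lt_or_ge δ 1 with hδ | hδ
  · obtain ⟨Rm, hRm⟩ := exists_maximal_information (Real.one_le_exp hψ0) hδ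
    have hinit : (AdditiveBelief.init m 𝒱).Inv δ₀ S := by
      refine ⟨fun _ _ => le_rfl, fun _ _ => le_rfl, fun _ => ?_, fun _ => .inl ?_, fun _ => ?_,
        fun _ _ _ => ?_, fun _ _ _ _ => rfl⟩ <;>
        simp [AdditiveBelief.init, hockeyStick_zero]
    exact isDP_of_isBeliefSystem (additiveGaussian_isMeasurable Ψ hδ₀.le)
      (fun D D' h => additiveGaussian_isBeliefSystem hδ₀ hδ₀'
        (fun b i j ε y h1 h2 h3 h4 => (hRm _).1 (hψ b i j ε y h1 h2 h3 h4)) h)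
      (fun b hb => hb.2) (b₀ := AdditiveBelief.init m 𝒱)
      ⟨hinit, by simp [info, AdditiveBelief.init]⟩
      (fun E ζ => by
        have : (AdditiveBelief.init m 𝒱).globals E ζ = fun _ => 0 := by
          funext l; simp [globals, AdditiveBelief.init]
        rw [state, this]; rfl)
      ((hRm Rm).2 le_rfl) hπ hπS
  · exact isDP_of_one_le hδ _

end AdditivePrivacy

/-! ### The system privacy guarantee -/

section Guarantee

variable {𝒮 : Schema} {m n : ℕ} {𝒱 : Fin n → HistView 𝒮}

lemma hockeyStick_sum_exp_le {ι : Type*} (t : Finset ι) {R : ι → ℝ≥0} {ε δ : ι → ℝ}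
    (hδ : ∀ l, 0 ≤ δ l) (h : ∀ l, hockeyStick (R l) (Real.exp (ε l)) ≤ ENNReal.ofReal (δ l)) :
    hockeyStick (∑ l ∈ t, R l) (Real.exp (∑ l ∈ t, ε l)) ≤ ENNReal.ofReal (∑ l ∈ t, δ l) := by
  classical
  induction t using Finset.induction_on with
  | empty => simp [hockeyStick_zero]
  | insert a t ha ih =>
    rw [Finset.sum_insert ha, Finset.sum_insert ha, Finset.sum_insert ha]
    exact hockeyStick_add_exp_le (hδ a) (Finset.sum_nonneg fun l _ => hδ l) (h a) ih

lemma sum_update_eq_add_sub {ι : Type*} [Fintype ι] [DecidableEq ι] (f : ι → ℝ) (j : ι) (x : ℝ) :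
    ∑ l, Function.update f j x l = ∑ l, f l + (x - f j) := by
  rw [Finset.sum_update_of_mem (Finset.mem_univ j), ← Finset.add_sum_erase _ _ (Finset.mem_univ j),
    Finset.sdiff_singleton_eq_erase]
  ring

/-! ### Row, column and table bounds from the invariant -/

namespace AdditiveBelief

variable {δ₀ : ℝ} {S : Set (Fin m × Fin n)} {b : AdditiveBelief m 𝒱} {i : Fin m} {j : Fin n} {ε : ℝ}

/-- The global budget never grows by more than the charged cost, because the old entry is at most
the old budget. Thus the check on column maxima bounds the new global budgets. -/
lemma Inv.newBudget_le (hb : b.Inv δ₀ S) (hε : 0 < ε) :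
    b.s.newBudget j ε ≤ b.s.ε j + (b.s.newP i j ε - b.s.P i j) := by
  by_cases h : b.s.ε j < ε
  · have := hb.P_le i j
    rw [hb.newP_of_lt h]
    linarith
  · have := hb.P_le_newP (i := i) (j := j) hε
    rw [AdditiveState.newBudget, max_eq_left (not_lt.1 h)]
    linarith

lemma Inv.hockeyStick_info_row (hb : b.Inv δ₀ {p | p.1 = i}) (hδ₀ : 0 < δ₀) :
    hockeyStick b.info (Real.exp (∑ l, b.s.P i l)) ≤
      ENNReal.ofReal ((∑ l, b.s.N i l : ℕ) * δ₀) := by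
  push_cast
  rw [Finset.sum_mul]
  exact hockeyStick_sum_exp_le _ (fun l => by positivity) (hb.local_bound i rfl)

lemma Inv.hockeyStick_info_column (hb : b.Inv δ₀ {p | p.2 = j}) :
    hockeyStick b.info (Real.exp (b.s.ε j)) ≤ ENNReal.ofReal (b.s.k j * δ₀) := by
  have : b.info = b.I j :=
    Finset.sum_eq_single j (fun l _ hl => hb.unseen j rfl l hl) (by simp)
  rw [this]
  exact (hockeyStick_mono (hb.I_le j) _).trans (hb.global_bound j)

lemma Inv.hockeyStick_info (hb : b.Inv δ₀ S) (hδ₀ : 0 < δ₀) :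
    hockeyStick b.info (Real.exp (∑ l, b.s.ε l)) ≤ ENNReal.ofReal ((∑ l, b.s.k l : ℕ) * δ₀) := by
  push_cast
  rw [Finset.sum_mul]
  exact hockeyStick_sum_exp_le _ (fun l => by positivity)
    fun l => (hockeyStick_mono (hb.I_le l) _).trans (hb.global_bound l)

end AdditiveBelief

lemma observe_univ {T : ℕ} (h : Fin T → Response m 𝒱) : observe Set.univ h = h := by
  funext t
  unfold observe
  split <;> simp_all

/-! ### The guarantees for analysts, views and coalitions -/

section

variable {Ψ : Constraints m n} {δ₀ : ℝ} (hδ₀ : 0 < δ₀) (hδ₀' : δ₀ < 1) {π : Policy m 𝒱} {T : ℕ}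
  (hπ : ∀ t, Measurable (π t))

include hδ₀ hδ₀' hπ

theorem vanilla_isDP_toAnalyst (i : Fin m) (h : π.DependsOnlyOn (fun h => toAnalyst h i)) :
    IsDP (noiseLaw 𝒱 T) (fun D ω => toAnalyst (transcript (vanilla 𝒱 Ψ δ₀) π T D ω) i)
      (Ψ.ψA i) (Ψ.δA i) := by
  refine vanilla_isDP hδ₀ hδ₀' (S := {p | p.1 = i}) (NNReal.coe_nonneg _) ?_ hπ h
  rintro s i' j ε - ⟨-, -, h2, -, -, h5, -⟩ hi
  obtain rfl : i' = i := hi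
  rw [sumOn_row, sumOn_row]
  exact ⟨h2, h5⟩

theorem vanilla_isDP_fromView (j : Fin n) (h : π.DependsOnlyOn (fun h => fromView h j)) :
    IsDP (noiseLaw 𝒱 T) (fun D ω => fromView (transcript (vanilla 𝒱 Ψ δ₀) π T D ω) j)
      (min (Ψ.ψV j) Ψ.ψP : ℝ≥0) (min (Ψ.δV j) Ψ.δP : ℝ≥0) := by
  refine vanilla_isDP hδ₀ hδ₀' (S := {p | p.2 = j}) (NNReal.coe_nonneg _) ?_ hπ h
  rintro s i j' ε h0 ⟨-, h1, -, h3, h4, -, h6⟩ hj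
  obtain rfl : j' = j := hj
  rw [sumOn_column, sumOn_column, NNReal.coe_min, NNReal.coe_min]
  have hP : ∑ a, s.P a j' ≤ ∑ a, ∑ v, s.P a v := Finset.sum_le_sum fun a _ =>
    Finset.single_le_sum (fun v _ => h0 a v) (Finset.mem_univ j')
  have hN : ∑ a, s.N a j' ≤ ∑ a, ∑ v, s.N a v := Finset.sum_le_sum fun a _ =>
    Finset.single_le_sum (f := s.N a) (fun _ _ => Nat.zero_le _) (Finset.mem_univ j')
  refine ⟨le_min h3 (by linarith), le_min h6 (le_trans ?_ h4)⟩
  gcongr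

theorem vanilla_isDP_transcript :
    IsDP (noiseLaw 𝒱 T) (transcript (vanilla 𝒱 Ψ δ₀) π T) Ψ.ψP Ψ.δP := by
  have := vanilla_isDP (Ψ := Ψ) hδ₀ hδ₀' (S := Set.univ) (ψ := Ψ.ψP) (δ := Ψ.δP) (T := T)
    (NNReal.coe_nonneg _) ?_ hπ (fun t h h' hh => by simp only [observe_univ] at hh; rw [hh])
  · simpa only [observe_univ] using this
  · rintro s i j ε - ⟨-, h1, -, -, h4, -, -⟩ -
    rw [sumOn_univ, sumOn_univ]
    exact ⟨h1, h4⟩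

theorem additiveGaussian_isDP_toAnalyst (i : Fin m)
    (h : π.DependsOnlyOn (fun h => toAnalyst h i)) :
    IsDP (noiseLaw 𝒱 T) (fun D ω => toAnalyst (transcript (additiveGaussian 𝒱 Ψ δ₀) π T D ω) i)
      (Ψ.ψA i) (Ψ.δA i) := by
  refine additiveGaussian_isDP hδ₀ hδ₀' (S := {p | p.1 = i}) (NNReal.coe_nonneg _) ?_ hπ h
  rintro b i' j ε y - ⟨-, -, -, h3, -, -, h6⟩ hi hb
  obtain rfl : i' = i := hi
  refine (hockeyStick_anti _ (Real.exp_le_exp.2 ?_)).trans ((hb.hockeyStick_info_row hδ₀).trans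
    (ENNReal.ofReal_le_ofReal ?_))
  · simp only [AdditiveBelief.posterior, AdditiveBelief.next, AdditiveState.next,
      Function.update_self]
    rwa [sum_update_eq_add_sub]
  · simp only [AdditiveBelief.posterior, AdditiveBelief.next, AdditiveState.next,
      Function.update_self]
    exact h6

theorem additiveGaussian_isDP_fromView (j : Fin n)
    (h : π.DependsOnlyOn (fun h => fromView h j)) :
    IsDP (noiseLaw 𝒱 T) (fun D ω => fromView (transcript (additiveGaussian 𝒱 Ψ δ₀) π T D ω) j)
      (min (Ψ.ψV j) Ψ.ψP : ℝ≥0) (min (Ψ.δV j) Ψ.δP : ℝ≥0) := by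
  refine additiveGaussian_isDP hδ₀ hδ₀' (S := {p | p.2 = j}) (NNReal.coe_nonneg _) ?_ hπ h
  rintro b i j' ε y hb0 ⟨hε, h1, h2, -, h4, h5, -⟩ hj hb
  obtain rfl : j' = j := hj
  -- The column maxima in the check are the global budgets.
  simp only [hb0.iSup_P] at h1 h2
  have hle := hb0.newBudget_le (i := i) (j := j') hε
  refine (hockeyStick_anti _ (Real.exp_le_exp.2 ?_)).trans (hb.hockeyStick_info_column.trans
    (ENNReal.ofReal_le_ofReal ?_)) <;>
    simp only [AdditiveBelief.posterior, AdditiveBelief.next, AdditiveState.next,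
      Function.update_self, NNReal.coe_min]
  · have : b.s.ε j' ≤ ∑ l, b.s.ε l :=
      Finset.single_le_sum (fun l _ => hb0.ε_nonneg l) (Finset.mem_univ j')
    exact le_min (by linarith) (by linarith)
  · refine le_min h4 (le_trans ?_ h5)
    gcongr
    have := Finset.single_le_sum (f := Function.update b.s.k j' (b.s.newCount j' ε))
      (fun _ _ => Nat.zero_le _) (Finset.mem_univ j')
    rwa [Function.update_self] at this

theorem additiveGaussian_isDP_transcript :
    IsDP (noiseLaw 𝒱 T) (transcript (additiveGaussian 𝒱 Ψ δ₀) π T) Ψ.ψP Ψ.δP := by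
  have := additiveGaussian_isDP (Ψ := Ψ) hδ₀ hδ₀' (S := Set.univ) (ψ := Ψ.ψP) (δ := Ψ.δP) (T := T)
    (NNReal.coe_nonneg _) ?_ hπ (fun t h h' hh => by simp only [observe_univ] at hh; rw [hh])
  · simpa only [observe_univ] using this
  · rintro b i j ε y hb0 ⟨hε, -, h2, -, -, h5, -⟩ - hb
    simp only [hb0.iSup_P] at h2
    have hle := hb0.newBudget_le (i := i) (j := j) hε
    refine (hockeyStick_anti _ (Real.exp_le_exp.2 ?_)).trans ((hb.hockeyStick_info hδ₀).trans
      (ENNReal.ofReal_le_ofReal h5))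
    simp only [AdditiveBelief.posterior, AdditiveBelief.next, AdditiveState.next]
    rw [sum_update_eq_add_sub]
    linarith

end

end Guarantee

end DProv

theorem mainTheorem2 {𝒮 : DProv.Schema} {m n : ℕ} (𝒱 : Fin n → DProv.HistView 𝒮)
    (Ψ : DProv.Constraints m n) (δ₀ : ℝ) (hδ₀ : 0 < δ₀) (hδ₀' : δ₀ < 1)
    (M : DProv.Mechanism m 𝒱)
    (hM : M = DProv.vanilla 𝒱 Ψ δ₀ ∨ M = DProv.additiveGaussian 𝒱 Ψ δ₀) (T : ℕ) :
    -- multi-analyst DP for every sequence of requests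
    (∀ q : ℕ → DProv.Request m n,
      DProv.IsMultiAnalystDP (DProv.noiseLaw 𝒱 T)
        (fun D ω => DProv.toAnalyst (DProv.transcript M (DProv.Policy.fixed q) T D ω))
        (fun i => Ψ.ψA i) (fun i => Ψ.δA i)) ∧
    -- adaptively chosen requests
    ∀ π : DProv.Policy m 𝒱, (∀ t, Measurable (π t)) →
      (∀ i : Fin m, π.DependsOnlyOn (fun h => DProv.toAnalyst h i) →
        DProv.IsDP (DProv.noiseLaw 𝒱 T)
          (fun D ω => DProv.toAnalyst (DProv.transcript M π T D ω) i) (Ψ.ψA i) (Ψ.δA i)) ∧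
      (∀ j : Fin n, π.DependsOnlyOn (fun h => DProv.fromView h j) →
        DProv.IsDP (DProv.noiseLaw 𝒱 T)
          (fun D ω => DProv.fromView (DProv.transcript M π T D ω) j)
          (min (Ψ.ψV j) Ψ.ψP : NNReal) (min (Ψ.δV j) Ψ.δP : NNReal)) ∧
      DProv.IsDP (DProv.noiseLaw 𝒱 T) (DProv.transcript M π T) Ψ.ψP Ψ.δP := by
  have key : ∀ π : DProv.Policy m 𝒱, (∀ t, Measurable (π t)) →
      (∀ i : Fin m, π.DependsOnlyOn (fun h => DProv.toAnalyst h i) →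
        DProv.IsDP (DProv.noiseLaw 𝒱 T)
          (fun D ω => DProv.toAnalyst (DProv.transcript M π T D ω) i) (Ψ.ψA i) (Ψ.δA i)) ∧
      (∀ j : Fin n, π.DependsOnlyOn (fun h => DProv.fromView h j) →
        DProv.IsDP (DProv.noiseLaw 𝒱 T)
          (fun D ω => DProv.fromView (DProv.transcript M π T D ω) j)
          (min (Ψ.ψV j) Ψ.ψP : NNReal) (min (Ψ.δV j) Ψ.δP : NNReal)) ∧
      DProv.IsDP (DProv.noiseLaw 𝒱 T) (DProv.transcript M π T) Ψ.ψP Ψ.δP := by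
    intro π hπ
    rcases hM with rfl | rfl
    · exact ⟨DProv.vanilla_isDP_toAnalyst hδ₀ hδ₀' hπ, DProv.vanilla_isDP_fromView hδ₀ hδ₀' hπ,
        DProv.vanilla_isDP_transcript hδ₀ hδ₀' hπ⟩
    · exact ⟨DProv.additiveGaussian_isDP_toAnalyst hδ₀ hδ₀' hπ,
        DProv.additiveGaussian_isDP_fromView hδ₀ hδ₀' hπ,
        DProv.additiveGaussian_isDP_transcript hδ₀ hδ₀' hπ⟩
  -- A fixed sequence is a constant policy, hence measurable and admissible for every analyst at
  -- once.
  exact ⟨fun q i => (key _ fun _ => measurable_const).1 i fun _ _ _ _ => rfl, key⟩
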